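/- Let $F:\mathcal M\to\mathcal N$ be an exact functor between (Quillen) exact categories that support long exact sequences (equivalently: every map with a right inverse has a kernel). Conventions. For an exact category $\mathcal C$, a chain complex of $\mathcal C$ is a $\mathbb Z$-graded complex with differential of degree $-1$. It is acyclic if it is obtained by splicing short exact sequences of $\mathcal C$, and a chain map is a quasi-isomorphism if its mapping cone is acyclic. A binary chain complex $(N,d,d')$ is a graded object with two differentials; its top and bottom are $\top N=(N,d)$ and $\bot N=(N,d')$. It is acyclic if both are, and diagonal if $d=d'$. Maps of binary complexes commute with both differentials, and exactness of sequences of (binary) complexes is defined degreewise. * $K_0\mathcal C$ is the Grothendieck group of $\mathcal C$. * $K_1\mathcal C:=K_0\Omega\,\mathcal C$ is the abelian group generated by the bounded acyclic binary complexes $N$ of $\mathcal C$, with relations $[N]=[N']+[N'']$ for every short exact sequence $0\to N'\to N\to N''\to 0$ of such complexes, and $[N]=0$ for $N$ diagonal. * $B[F]$ is the exact category of triples $X=(M,N,u)$, where $M=(\top M,\bot M)$ is a pair of bounded chain complexes of $\mathcal M$, $N$ is a bounded binary chain complex of $\mathcal N$, and $u$ is a pair of quasi-isomorphisms $F\top M\to\top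 N$, $F\bot M\to\bot N$. Maps are maps of $M$ and of $N$ compatible with $u$; exactness is defined degreewise on $M$ and on $N$. The diagonal objects are those coming from a single quasi-isomorphism $FM_0\to N_0$ of bounded chain complexes, with $M_0$ in $\mathcal M$ and $N_0$ in $\mathcal N$. * $K_0\Omega[F]$ is the quotient of $K_0 B[F]$ by the relations $[X]=0$ for $X$ diagonal, and $[X]=[X']$ whenever there is a map $X\to X'$ whose two components on $M$ are quasi-isomorphisms and whose component on $N$ is an isomorphism. * For a bounded chain complex $C$ of $\mathcal M$, $\chi(C)=\sum_i(-1)^i[C_i]\in K_0\mathcal M$. Then there are homomorphisms $$K_1\mathcal M\xrightarrow{\;k_1\;}K_1\mathcal N\xrightarrow{\;i\;}K_0\Omega[F]\xrightarrow{\;p\;}K_0\mathcal M\xrightarrow{\;k_0\;}K_0\mathcal N$$ given on generators by $k_1[M]=[FM]$, $i[N]=[(0,N,0)]$, $p[(M,N,u)]=\chi(\top M)-\chi(\bot M)$ and $k_0[A]=[FA]$, and the sequence is exact at $K_1\mathcal N$, at $K_0\Omega[F]$ and at $K_0\mathcal M$. Moreover, the end terms are themselves instances of the construction $K_0\Omega[-]$: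 if $0$ denotes a zero category, the formulas $[N]\mapsto[(0,N,0)]$ and $[(M,0,u)]\mapsto\chi(\top M)-\chi(\bot M)$ define isomorphisms $K_1\mathcal N\cong K_0\Omega[0\to\mathcal N]$ and $K_0\Omega[\mathcal N\to 0]\cong K_0\mathcal N$. -/

import Mathlib

universe v v₁ v₂ v₃ u u₁ u₂ u₃

open CategoryTheory CategoryTheory.Limits ZeroObject

noncomputable section

namespace RelK


/-! ### Exact categories -/

section Exact

variable {C : Type u} [Category.{v} C] [Preadditive C]

/-- `i` is the first map of a member of the class `P` of short sequences. -/
def IsInflationOf (P : ObjectProperty (ShortComplex C)) {X Y : C} (i : X ⟶ Y) : Prop :=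
  ∃ (Z : C) (p : Y ⟶ Z) (w : i ≫ p = 0), P (ShortComplex.mk i p w)

/-- `p` is the second map of a member of the class `P` of short sequences. -/
def IsDeflationOf (P : ObjectProperty (ShortComplex C)) {Y Z : C} (p : Y ⟶ Z) : Prop :=
  ∃ (X : C) (i : X ⟶ Y) (w : i ≫ p = 0), P (ShortComplex.mk i p w)

/-- A `ℤ`-graded object is bounded if all but finitely many of its components are zero. -/
def IsBoundedGraded (X : ℤ → C) : Prop :=
  ∃ a b : ℤ, ∀ i, (i < a ∨ b < i) → IsZero (X i)

end Exact

/-- An exact structure (in the sense of Quillen) on the additive category `C`: a class of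
kernel-cokernel pairs, closed under isomorphism, the "short exact sequences" of `C`. -/
class ExactCategory (C : Type u) [Category.{v} C] [Preadditive C] [HasZeroObject C]
    [HasBinaryBiproducts C] where
  shortExact : ObjectProperty (ShortComplex C)
  of_iso : ∀ {S T : ShortComplex C}, (S ≅ T) → shortExact S → shortExact T
  isKernel : ∀ {S : ShortComplex C}, shortExact S →
    Nonempty (IsLimit (KernelFork.ofι S.f S.zero))
  isCokernel : ∀ {S : ShortComplex C}, shortExact S →
    Nonempty (IsColimit (CokernelCofork.ofπ S.g S.zero))
  id_inflation : ∀ X : C, IsInflationOf shortExact (𝟙 X)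
  id_deflation : ∀ X : C, IsDeflationOf shortExact (𝟙 X)
  comp_inflation : ∀ {X Y Z : C} (i : X ⟶ Y) (j : Y ⟶ Z),
    IsInflationOf shortExact i → IsInflationOf shortExact j → IsInflationOf shortExact (i ≫ j)
  comp_deflation : ∀ {X Y Z : C} (p : X ⟶ Y) (q : Y ⟶ Z),
    IsDeflationOf shortExact p → IsDeflationOf shortExact q → IsDeflationOf shortExact (p ≫ q)
  pushout_inflation : ∀ {X Y X' : C} (i : X ⟶ Y) (f : X ⟶ X'), IsInflationOf shortExact i →
    ∃ (Y' : C) (i' : X' ⟶ Y') (f' : Y ⟶ Y'),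
      IsPushout i f f' i' ∧ IsInflationOf shortExact i'
  pullback_deflation : ∀ {Y Z Z' : C} (p : Y ⟶ Z) (f : Z' ⟶ Z), IsDeflationOf shortExact p →
    ∃ (Y' : C) (p' : Y' ⟶ Z') (f' : Y' ⟶ Y),
      IsPullback f' p' p f ∧ IsDeflationOf shortExact p'

section Basic

variable (C : Type u) [Category.{v} C] [Preadditive C] [HasZeroObject C]
  [HasBinaryBiproducts C] [ExactCategory C]

/-- `C` supports long exact sequences: every map with a right inverse has a kernel.
(This is the intrinsic form of the condition that, in a suitable ambient abelian category,
bounded chain complexes of objects of `C` that are exact there are long exact sequences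
of `C`.) -/
def SupportsLongExactSequences : Prop :=
  ∀ ⦃X Y : C⦄ (p : X ⟶ Y), (∃ s : Y ⟶ X, s ≫ p = 𝟙 Y) → HasKernel p

variable {C}

/-- `0 ⟶ X ⟶ Y ⟶ Z ⟶ 0` is one of the short exact sequences of `C`. -/
def IsShortExact {X Y Z : C} (f : X ⟶ Y) (g : Y ⟶ Z) : Prop :=
  ∃ w : f ≫ g = 0, ExactCategory.shortExact (ShortComplex.mk f g w)

/-- A chain complex is acyclic (a long exact sequence of `C`) if it is spliced together from
short exact sequences `0 ⟶ Z (i + 1) ⟶ X (i + 1) ⟶ Z i ⟶ 0` of `C`. -/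
def IsAcyclic (K : ChainComplex C ℤ) : Prop :=
  ∃ (Z : ℤ → C) (j : ∀ i, Z i ⟶ K.X i) (p : ∀ i, K.X (i + 1) ⟶ Z i),
    (∀ i, K.d (i + 1) i = p i ≫ j i) ∧ ∀ i, IsShortExact (j (i + 1)) (p i)

/-- A map of chain complexes is a quasi-isomorphism if its mapping cone is acyclic. -/
def IsQuasiIso {K L : ChainComplex C ℤ} (f : K ⟶ L) : Prop :=
  IsAcyclic (HomologicalComplex.homotopyCofiber f)

/-- Short exact sequences of chain complexes are defined degreewise. -/
def IsShortExactComplex {K L Q : ChainComplex C ℤ} (f : K ⟶ L) (g : L ⟶ Q) : Prop :=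
  ∀ i, IsShortExact (f.f i) (g.f i)

lemma IsShortExact.of_iso {X Y Z X' Y' Z' : C} {f : X ⟶ Y} {g : Y ⟶ Z}
    {f' : X' ⟶ Y'} {g' : Y' ⟶ Z'} (h : IsShortExact f g) (a : X ≅ X') (b : Y ≅ Y')
    (c : Z ≅ Z') (hf : a.hom ≫ f' = f ≫ b.hom) (hg : b.hom ≫ g' = g ≫ c.hom) :
    IsShortExact f' g' := by
  obtain ⟨w, hw⟩ := h
  have w' : f' ≫ g' = 0 := by
    rw [← cancel_epi a.hom, ← Category.assoc, hf, Category.assoc, hg, ← Category.assoc, w]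
    simp
  exact ⟨w', ExactCategory.of_iso (ShortComplex.isoMk a b c hf hg) hw⟩

lemma IsAcyclic.of_iso {K L : ChainComplex C ℤ} (h : IsAcyclic K) (e : K ≅ L) :
    IsAcyclic L := by
  obtain ⟨Z, j, p, hd, hs⟩ := h
  refine ⟨Z, fun i => j i ≫ e.hom.f i, fun i => e.inv.f (i + 1) ≫ p i, fun i => ?_, fun i => ?_⟩
  · have := e.inv.comm (i + 1) i
    calc L.d (i + 1) i = L.d (i + 1) i ≫ e.inv.f i ≫ e.hom.f i := by
          rw [← HomologicalComplex.comp_f, e.inv_hom_id]; simp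
      _ = _ := by rw [← Category.assoc, ← this, hd]; simp
  · refine (hs i).of_iso (Iso.refl _) ((HomologicalComplex.eval C _ (i + 1)).mapIso e)
      (Iso.refl _) ?_ ?_
    · simp
    · simp [← HomologicalComplex.comp_f_assoc]

/-- A map out of a zero complex is a quasi-isomorphism when its target is acyclic. -/
lemma IsQuasiIso.of_isZero {K L : ChainComplex C ℤ} (f : K ⟶ L) (hK : ∀ i, IsZero (K.X i))
    (hL : IsAcyclic L) : IsQuasiIso f := by
  have : ∀ i, IsIso ((HomologicalComplex.homotopyCofiber.inr f).f i) := fun i => by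
    have hr : (ComplexShape.down ℤ).Rel i (i - 1) := by simp
    refine ⟨HomologicalComplex.homotopyCofiber.sndX f i, ?_, ?_⟩
    · simp [HomologicalComplex.homotopyCofiber.inr]
    · refine HomologicalComplex.homotopyCofiber.ext_from_X f (i - 1) i hr ?_ ?_
      · exact (hK _).eq_of_src _ _
      · simp [HomologicalComplex.homotopyCofiber.inr]
  have : IsIso (HomologicalComplex.homotopyCofiber.inr f) :=
    HomologicalComplex.Hom.isIso_of_components _
  exact hL.of_iso (asIso (HomologicalComplex.homotopyCofiber.inr f))

end Basic

/-! ### Exact functors -/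

section Functor

variable {M : Type u₁} [Category.{v₁} M] [Preadditive M] [HasZeroObject M]
  [HasBinaryBiproducts M] [ExactCategory M]
  {N : Type u₂} [Category.{v₂} N] [Preadditive N] [HasZeroObject N]
  [HasBinaryBiproducts N] [ExactCategory N]

/-- An additive functor is exact if it preserves short exact sequences. -/
def IsExactFunctor (F : M ⥤ N) [F.Additive] : Prop :=
  ∀ ⦃X Y Z : M⦄ (f : X ⟶ Y) (g : Y ⟶ Z), IsShortExact f g → IsShortExact (F.map f) (F.map g)

/-- The functor induced by `F` on chain complexes. -/
abbrev mapC (F : M ⥤ N) [F.Additive] : ChainComplex M ℤ ⥤ ChainComplex N ℤ :=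
  F.mapHomologicalComplex (ComplexShape.down ℤ)

lemma IsAcyclic.map {K : ChainComplex M ℤ} (h : IsAcyclic K) (F : M ⥤ N) [F.Additive]
    (hF : IsExactFunctor F) : IsAcyclic ((mapC F).obj K) := by
  obtain ⟨Z, j, p, hd, hs⟩ := h
  refine ⟨fun i => F.obj (Z i), fun i => F.map (j i), fun i => F.map (p i), fun i => ?_,
    fun i => hF _ _ (hs i)⟩
  change F.map (K.d (i + 1) i) = F.map (p i) ≫ F.map (j i)
  rw [← F.map_comp, hd]

lemma IsBoundedGraded.map {M : Type u₁} [Category.{v₁} M] [Preadditive M]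
    {N : Type u₂} [Category.{v₂} N] [Preadditive N]
    {X : ℤ → M} (h : IsBoundedGraded X) (F : M ⥤ N) [F.Additive] :
    IsBoundedGraded (fun i => F.obj (X i)) := by
  obtain ⟨a, b, h⟩ := h
  exact ⟨a, b, fun i hi => F.map_isZero (h i hi)⟩

end Functor

/-! ### Binary chain complexes -/

/-- A binary chain complex `(X, d, d')`: a graded object with two differentials of degree `-1`,
the top one `d` and the bottom one `d'`. -/
structure BinaryComplex (C : Type u) [Category.{v} C] [Preadditive C] where
  X : ℤ → C
  d : ∀ i j, X i ⟶ X j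
  d' : ∀ i j, X i ⟶ X j
  shape : ∀ i j, ¬ (ComplexShape.down ℤ).Rel i j → d i j = 0
  shape' : ∀ i j, ¬ (ComplexShape.down ℤ).Rel i j → d' i j = 0
  d_comp_d : ∀ i j k, d i j ≫ d j k = 0
  d'_comp_d' : ∀ i j k, d' i j ≫ d' j k = 0

namespace BinaryComplex

section

variable {C : Type u} [Category.{v} C] [Preadditive C]

/-- The chain complex given by the top differential. -/
@[simps]
def top (B : BinaryComplex C) : ChainComplex C ℤ where
  X := B.X
  d := B.d
  shape := B.shape
  d_comp_d' _ _ _ _ _ := B.d_comp_d _ _ _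

/-- The chain complex given by the bottom differential. -/
@[simps]
def bot (B : BinaryComplex C) : ChainComplex C ℤ where
  X := B.X
  d := B.d'
  shape := B.shape'
  d_comp_d' _ _ _ _ _ := B.d'_comp_d' _ _ _

/-- A map of binary chain complexes is a map of graded objects commuting with both
differentials. -/
@[ext]
structure Hom (A B : BinaryComplex C) where
  f : ∀ i, A.X i ⟶ B.X i
  comm : ∀ i j, f i ≫ B.d i j = A.d i j ≫ f j
  comm' : ∀ i j, f i ≫ B.d' i j = A.d' i j ≫ f j

instance : Category (BinaryComplex C) where
  Hom := Hom
  id A := { f := fun _ => 𝟙 _, comm := by simp, comm' := by simp }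
  comp g h :=
    { f := fun i => g.f i ≫ h.f i
      comm := fun i j => by rw [Category.assoc, h.comm, ← Category.assoc, g.comm, Category.assoc]
      comm' := fun i j => by
        rw [Category.assoc, h.comm', ← Category.assoc, g.comm', Category.assoc] }
  id_comp _ := Hom.ext (funext fun _ => Category.id_comp _)
  comp_id _ := Hom.ext (funext fun _ => Category.comp_id _)
  assoc _ _ _ := Hom.ext (funext fun _ => Category.assoc _ _ _)

/-- The map of top complexes induced by a map of binary complexes. -/
@[simps]
def topMap {A B : BinaryComplex C} (g : A ⟶ B) : A.top ⟶ B.top where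
  f := Hom.f g
  comm' _ _ _ := Hom.comm g _ _

/-- The map of bottom complexes induced by a map of binary complexes. -/
@[simps]
def botMap {A B : BinaryComplex C} (g : A ⟶ B) : A.bot ⟶ B.bot where
  f := Hom.f g
  comm' _ _ _ := Hom.comm' g _ _

/-- The diagonal binary complex `(K, d, d)` of a chain complex `(K, d)`. -/
@[simps]
def diag (K : ChainComplex C ℤ) : BinaryComplex C where
  X := K.X
  d := K.d
  d' := K.d
  shape := K.shape
  shape' := K.shape
  d_comp_d := K.d_comp_d
  d'_comp_d' := K.d_comp_d

end

/-- Short exact sequences of binary complexes are defined degreewise. -/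
def IsShortExactBinary {C : Type u} [Category.{v} C] [Preadditive C] [HasZeroObject C]
    [HasBinaryBiproducts C] [ExactCategory C] {A B D : BinaryComplex C}
    (f : A ⟶ B) (g : B ⟶ D) : Prop :=
  ∀ i, IsShortExact (Hom.f f i) (Hom.f g i)

/-- The image of a binary complex under an additive functor. -/
@[simps]
def map {M : Type u₁} [Category.{v₁} M] [Preadditive M] {N : Type u₂} [Category.{v₂} N]
    [Preadditive N] (F : M ⥤ N) [F.Additive] (B : BinaryComplex M) : BinaryComplex N where
  X i := F.obj (B.X i)
  d i j := F.map (B.d i j)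
  d' i j := F.map (B.d' i j)
  shape i j h := by rw [B.shape i j h, F.map_zero]
  shape' i j h := by rw [B.shape' i j h, F.map_zero]
  d_comp_d i j k := by rw [← F.map_comp, B.d_comp_d, F.map_zero]
  d'_comp_d' i j k := by rw [← F.map_comp, B.d'_comp_d', F.map_zero]

end BinaryComplex

/-- The objects of `B^q C`: bounded acyclic binary chain complexes of `C`, i.e. those for which
both differentials give an acyclic complex. -/
structure AcyclicBinaryComplex (C : Type u) [Category.{v} C] [Preadditive C] [HasZeroObject C]
    [HasBinaryBiproducts C] [ExactCategory C] where
  cx : BinaryComplex C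
  bounded : IsBoundedGraded cx.X
  acyclic_top : IsAcyclic cx.top
  acyclic_bot : IsAcyclic cx.bot

namespace AcyclicBinaryComplex

/-- The diagonal object of `B^q C` of a bounded acyclic chain complex. -/
def diag {C : Type u} [Category.{v} C] [Preadditive C] [HasZeroObject C]
    [HasBinaryBiproducts C] [ExactCategory C] (K : ChainComplex C ℤ)
    (hb : IsBoundedGraded K.X) (ha : IsAcyclic K) : AcyclicBinaryComplex C where
  cx := BinaryComplex.diag K
  bounded := hb
  acyclic_top := ha
  acyclic_bot := ha

variable {M : Type u₁} [Category.{v₁} M] [Preadditive M] [HasZeroObject M]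
  [HasBinaryBiproducts M] [ExactCategory M]
  {N : Type u₂} [Category.{v₂} N] [Preadditive N] [HasZeroObject N]
  [HasBinaryBiproducts N] [ExactCategory N]

/-- The image of a bounded acyclic binary complex under an exact functor. -/
def map (F : M ⥤ N) [F.Additive] (hF : IsExactFunctor F) (B : AcyclicBinaryComplex M) :
    AcyclicBinaryComplex N where
  cx := B.cx.map F
  bounded := B.bounded.map F
  acyclic_top := B.acyclic_top.map F hF
  acyclic_bot := B.acyclic_bot.map F hF

end AcyclicBinaryComplex

/-! ### The Grothendieck groups `K₀ C` and `K₁ C = K₀ Ω C` -/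

section KGroups

variable (C : Type u) [Category.{v} C] [Preadditive C] [HasZeroObject C]
  [HasBinaryBiproducts C] [ExactCategory C]

/-- The relations `[Y] = [X] + [Z]` for short exact sequences `0 ⟶ X ⟶ Y ⟶ Z ⟶ 0`. -/
def K0Relations : Set (FreeAbelianGroup C) :=
  {r | ∃ (X Y Z : C) (f : X ⟶ Y) (g : Y ⟶ Z), IsShortExact f g ∧
    r = FreeAbelianGroup.of Y - FreeAbelianGroup.of X - FreeAbelianGroup.of Z}

/-- The Grothendieck group of the exact category `C`. -/
def K0 : Type u := FreeAbelianGroup C ⧸ AddSubgroup.closure (K0Relations C)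

instance : AddCommGroup (K0 C) :=
  inferInstanceAs (AddCommGroup (FreeAbelianGroup C ⧸ AddSubgroup.closure (K0Relations C)))

/-- The relations of `K₀ Ω C`: additivity over short exact sequences of bounded acyclic binary
complexes, and the vanishing of diagonal ones. -/
def K1Relations : Set (FreeAbelianGroup (AcyclicBinaryComplex C)) :=
  {r | ∃ (X Y Z : AcyclicBinaryComplex C) (f : X.cx ⟶ Y.cx) (g : Y.cx ⟶ Z.cx),
    BinaryComplex.IsShortExactBinary f g ∧
      r = FreeAbelianGroup.of Y - FreeAbelianGroup.of X - FreeAbelianGroup.of Z} ∪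
  {r | ∃ (K : ChainComplex C ℤ) (hb : IsBoundedGraded K.X) (ha : IsAcyclic K),
    r = FreeAbelianGroup.of (AcyclicBinaryComplex.diag K hb ha)}

/-- The group `K₁ C := K₀ Ω C`. -/
def K1 : Type (max u v) :=
  FreeAbelianGroup (AcyclicBinaryComplex C) ⧸ AddSubgroup.closure (K1Relations C)

instance : AddCommGroup (K1 C) :=
  inferInstanceAs (AddCommGroup
    (FreeAbelianGroup (AcyclicBinaryComplex C) ⧸ AddSubgroup.closure (K1Relations C)))

variable {C}

/-- The class of an object in `K₀ C`. -/
def K0.cls (X : C) : K0 C :=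
  QuotientAddGroup.mk' (AddSubgroup.closure (K0Relations C)) (FreeAbelianGroup.of X)

/-- The class of a bounded acyclic binary complex in `K₁ C`. -/
def K1.cls (X : AcyclicBinaryComplex C) : K1 C :=
  QuotientAddGroup.mk' (AddSubgroup.closure (K1Relations C)) (FreeAbelianGroup.of X)

/-- The Euler characteristic `∑ (-1)^i [K_i]` in `K₀ C` of a (bounded) chain complex; the sum
is finite because zero objects have class `0`. -/
def eulerChar (K : ChainComplex C ℤ) : K0 C :=
  ∑ᶠ i : ℤ, i.negOnePow • K0.cls (K.X i)

end KGroups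

/-! ### Relative objects and the group `K₀ Ω[F]` -/

section Relative

variable {M : Type u₁} [Category.{v₁} M] [Preadditive M] [HasZeroObject M]
  [HasBinaryBiproducts M] [ExactCategory M]
  {N : Type u₂} [Category.{v₂} N] [Preadditive N] [HasZeroObject N]
  [HasBinaryBiproducts N] [ExactCategory N]
  (F : M ⥤ N) [F.Additive]

/-- The objects of `C[F]`: triples `(M, N, u)` with `u : F M ⟶ N` a quasi-isomorphism of
bounded chain complexes. -/
structure RelComplex where
  src : ChainComplex M ℤ
  src_bounded : IsBoundedGraded src.X
  tar : ChainComplex N ℤ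
  tar_bounded : IsBoundedGraded tar.X
  comp : (mapC F).obj src ⟶ tar
  comp_quasiIso : IsQuasiIso comp

/-- The objects of `B[F]`: a pair of bounded chain complexes of `M`, a bounded binary complex of
`N`, and quasi-isomorphisms from the image under `F` of the pair to the top and the bottom
of the binary complex. -/
structure RelBinary where
  srcTop : ChainComplex M ℤ
  srcBot : ChainComplex M ℤ
  srcTop_bounded : IsBoundedGraded srcTop.X
  srcBot_bounded : IsBoundedGraded srcBot.X
  tar : BinaryComplex N
  tar_bounded : IsBoundedGraded tar.X
  compTop : (mapC F).obj srcTop ⟶ tar.top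
  compBot : (mapC F).obj srcBot ⟶ tar.bot
  compTop_quasiIso : IsQuasiIso compTop
  compBot_quasiIso : IsQuasiIso compBot

variable {F}

namespace RelBinary

/-- Maps in `B[F]`. -/
@[ext]
structure Hom (X Y : RelBinary F) where
  srcTop : X.srcTop ⟶ Y.srcTop
  srcBot : X.srcBot ⟶ Y.srcBot
  tar : X.tar ⟶ Y.tar
  comm_top : (mapC F).map srcTop ≫ Y.compTop = X.compTop ≫ BinaryComplex.topMap tar
  comm_bot : (mapC F).map srcBot ≫ Y.compBot = X.compBot ≫ BinaryComplex.botMap tar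

/-- Short exact sequences of `B[F]`. -/
def IsShortExactRel {X Y Z : RelBinary F} (f : Hom X Y) (g : Hom Y Z) : Prop :=
  IsShortExactComplex f.srcTop g.srcTop ∧ IsShortExactComplex f.srcBot g.srcBot ∧
    BinaryComplex.IsShortExactBinary f.tar g.tar

/-- The class `p = (q, i)` of maps of `B[F]`: quasi-isomorphisms on sources and isomorphisms
on targets. -/
def Hom.IsP {X Y : RelBinary F} (f : Hom X Y) : Prop :=
  IsQuasiIso f.srcTop ∧ IsQuasiIso f.srcBot ∧ IsIso f.tar

/-- The diagonal functor `C[F] ⟶ B[F]` on objects. -/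
def diag (X : RelComplex F) : RelBinary F where
  srcTop := X.src
  srcBot := X.src
  srcTop_bounded := X.src_bounded
  srcBot_bounded := X.src_bounded
  tar := BinaryComplex.diag X.tar
  tar_bounded := X.tar_bounded
  compTop := X.comp
  compBot := X.comp
  compTop_quasiIso := X.comp_quasiIso
  compBot_quasiIso := X.comp_quasiIso

variable (F) in
/-- The object `(0, N, 0)` of `B[F]` of a bounded acyclic binary complex `N`. -/
def ofAcyclic (B : AcyclicBinaryComplex N) : RelBinary F where
  srcTop := HomologicalComplex.zero
  srcBot := HomologicalComplex.zero
  srcTop_bounded := ⟨0, 0, fun _ _ => isZero_zero M⟩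
  srcBot_bounded := ⟨0, 0, fun _ _ => isZero_zero M⟩
  tar := B.cx
  tar_bounded := B.bounded
  compTop := 0
  compBot := 0
  compTop_quasiIso := IsQuasiIso.of_isZero _ (fun _ => F.map_isZero (isZero_zero M)) B.acyclic_top
  compBot_quasiIso := IsQuasiIso.of_isZero _ (fun _ => F.map_isZero (isZero_zero M)) B.acyclic_bot

end RelBinary

variable (F)

/-- The relations of `K₀ Ω[F]`: additivity over short exact sequences of `B[F]`, the vanishing of
the diagonal objects, and the equality of source and target of every map in `p`. -/
def K0OmegaRelations : Set (FreeAbelianGroup (RelBinary F)) :=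
  {r | ∃ (X Y Z : RelBinary F) (f : RelBinary.Hom X Y) (g : RelBinary.Hom Y Z),
    RelBinary.IsShortExactRel f g ∧
      r = FreeAbelianGroup.of Y - FreeAbelianGroup.of X - FreeAbelianGroup.of Z} ∪
  {r | ∃ X : RelComplex F, r = FreeAbelianGroup.of (RelBinary.diag X)} ∪
  {r | ∃ (X Y : RelBinary F) (f : RelBinary.Hom X Y), f.IsP ∧
    r = FreeAbelianGroup.of Y - FreeAbelianGroup.of X}

/-- The group `K₀ Ω[F]`. -/
def K0Omega : Type (max u₁ v₁ u₂ v₂) :=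
  FreeAbelianGroup (RelBinary F) ⧸ AddSubgroup.closure (K0OmegaRelations F)

instance : AddCommGroup (K0Omega F) :=
  inferInstanceAs (AddCommGroup
    (FreeAbelianGroup (RelBinary F) ⧸ AddSubgroup.closure (K0OmegaRelations F)))

variable {F}

/-- The class of an object of `B[F]` in `K₀ Ω[F]`. -/
def K0Omega.cls (X : RelBinary F) : K0Omega F :=
  QuotientAddGroup.mk' (AddSubgroup.closure (K0OmegaRelations F)) (FreeAbelianGroup.of X)

end Relative

end RelK

end

noncomputable section

set_option linter.unusedSectionVars false

namespace RelK

/-! ### Pullback squares of biproducts -/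

section Biprod

variable {C : Type u} [Category.{v} C] [Preadditive C] [HasBinaryBiproducts C]

/-! Consecutive composites vanish by additivity, so the content lies in constructing preimages.
Three facts carry the proof.

(1) Bounded complexes `K`, `L` with equal Euler characteristic become isomorphic as graded objects
after adding bounded acyclic complexes (`exists_iso_of_eulerChar_eq`). Indeed, consider graded
isomorphism classes modulo those of acyclic complexes. Cones of identities make each single-degree
class invertible, and short exact sequences give additive relations, so `K₀` maps to the units of
this monoid and `χ(K)` goes to the graded class of `K`. Hence `K` and `L` are quasi-isomorphic to
the top and the bottom of one binary complex (`exists_binaryComplex`). Applied in `N` to `F A` and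
`F B`, this gives exactness at `K₀ M`.

(2) An additive function on bounded binary complexes that kills the diagonal ones is zero
(`BinaryComplex.eq_zero_of_additive`), because the graded pieces of the degree filtration have zero
differentials and so are diagonal. In particular `(B, F B, 1)` has class zero in `K₀ Ω[F]`. If an
object has sources with equal Euler characteristics, (1) provides a binary complex `B` over the
sources (`Over`). Replacing the sources by `B` and taking cones then shows that the class is the
image of `[cone (F B ⟶ N)]` (`K0Omega.cls_eq_toK0Omega_val`). Adding a swapped object balances the
Euler characteristics, and exactness at `K₀ Ω[F]` follows.

(3) For exactness at `K₁ N`, the class of `cone (F B ⟶ N)` is taken modulo the image of `K₁ M`. A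
cylinder construction shows that this value is independent of `B` (`Over.gval_eq`) and additive. It
is defined only on objects with balanced sources, so it is not yet a homomorphism. But `X ⊕ X.swap`
always has a value, so every relation of `K₀ Ω[F]` can be completed to one between objects with
values (`RelBinary.HasVal.eq_of_cls_eq`). Since `(0, N, 0)` has value `[N]`, the kernel of `i` is
the image of `k₁`.

Support of long exact sequences enters through `IsDefl.of_comp`: it gives two out of three for
acyclicity in short exact sequences of bounded complexes, and with it the calculus of
quasi-isomorphisms. The identification of the end terms follows from the exact sequence, since `K₀`
and `K₁` of a zero category vanish. -/

lemma isPullback_biprod_map_id {Y Z : C} (g : Y ⟶ Z) (W : C) :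
    IsPullback (biprod.fst : Y ⊞ W ⟶ Y) (biprod.map g (𝟙 W)) g biprod.fst := by
  refine ⟨⟨by simp⟩, ⟨PullbackCone.IsLimit.mk _ (fun s => biprod.lift s.fst (s.snd ≫ biprod.snd))
    (fun s => by simp) (fun s => ?_) (fun s m h1 h2 => ?_)⟩⟩
  · ext
    · simpa using s.condition
    · simp
  · ext
    · simpa using h1
    · simpa using congr($h2 ≫ biprod.snd)

lemma isPullback_biprod_id_map {Y Z : C} (g : Y ⟶ Z) (W : C) :
    IsPullback (biprod.snd : W ⊞ Y ⟶ Y) (biprod.map (𝟙 W) g) g biprod.snd := by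
  refine ⟨⟨by simp⟩, ⟨PullbackCone.IsLimit.mk _ (fun s => biprod.lift (s.snd ≫ biprod.fst) s.fst)
    (fun s => by simp) (fun s => ?_) (fun s m h1 h2 => ?_)⟩⟩
  · ext
    · simp
    · simpa using s.condition
  · ext
    · simpa using congr($h2 ≫ biprod.fst)
    · simpa using h1

end Biprod

/-! ### Inflations, deflations and short exact sequences -/

section ExactBasics

variable {C : Type u} [Category.{v} C] [Preadditive C] [HasZeroObject C]
  [HasBinaryBiproducts C] [ExactCategory C]

/-- The second maps of short exact sequences. -/
def IsDefl {Y Z : C} (p : Y ⟶ Z) : Prop := ∃ (X : C) (i : X ⟶ Y), IsShortExact i p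

/-- The first maps of short exact sequences. -/
def IsInfl {X Y : C} (i : X ⟶ Y) : Prop := ∃ (Z : C) (p : Y ⟶ Z), IsShortExact i p

namespace IsShortExact

variable {X Y Z : C} {i : X ⟶ Y} {p : Y ⟶ Z}

lemma zero (h : IsShortExact i p) : i ≫ p = 0 := h.1

lemma mono (h : IsShortExact i p) : Mono i := by
  obtain ⟨w, hw⟩ := h
  obtain ⟨hl⟩ := ExactCategory.isKernel hw
  exact mono_of_isLimit_fork hl

lemma epi (h : IsShortExact i p) : Epi p := by
  obtain ⟨w, hw⟩ := h
  obtain ⟨hl⟩ := ExactCategory.isCokernel hw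
  exact epi_of_isColimit_cofork hl

lemma exists_lift (h : IsShortExact i p) {T : C} (t : T ⟶ Y) (ht : t ≫ p = 0) :
    ∃ l : T ⟶ X, l ≫ i = t := by
  obtain ⟨w, hw⟩ := h
  obtain ⟨hl⟩ := ExactCategory.isKernel hw
  obtain ⟨l, hl⟩ := KernelFork.IsLimit.lift' hl t ht
  exact ⟨l, hl⟩

lemma exists_desc (h : IsShortExact i p) {T : C} (t : Y ⟶ T) (ht : i ≫ t = 0) :
    ∃ l : Z ⟶ T, p ≫ l = t := by
  obtain ⟨w, hw⟩ := h
  obtain ⟨hl⟩ := ExactCategory.isCokernel hw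
  obtain ⟨l, hl⟩ := CokernelCofork.IsColimit.desc' hl t ht
  exact ⟨l, hl⟩

lemma isDefl (h : IsShortExact i p) : IsDefl p := ⟨_, _, h⟩

lemma isInfl (h : IsShortExact i p) : IsInfl i := ⟨_, _, h⟩

end IsShortExact

/-- Kernels are unique up to isomorphism and short exact sequences are closed under isomorphism, so
any kernel of a deflation will do. -/
lemma IsDefl.shortExact_of_kernel {X Y Z : C} {i : X ⟶ Y} {p : Y ⟶ Z} (hp : IsDefl p) [Mono i]
    (w : i ≫ p = 0) (hi : ∀ {T : C} (t : T ⟶ Y), t ≫ p = 0 → ∃ l : T ⟶ X, l ≫ i = t) :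
    IsShortExact i p := by
  obtain ⟨X', i', h⟩ := hp
  obtain ⟨a, ha⟩ := hi i' h.zero
  obtain ⟨b, hb⟩ := h.exists_lift i w
  have := h.mono
  refine h.of_iso ⟨a, b, ?_, ?_⟩ (Iso.refl _) (Iso.refl _) (by simpa using ha) (by simp)
  · rw [← cancel_mono i', Category.assoc, hb, ha, Category.id_comp]
  · rw [← cancel_mono i, Category.assoc, ha, hb, Category.id_comp]

lemma IsInfl.shortExact_of_cokernel {X Y Z : C} {i : X ⟶ Y} {p : Y ⟶ Z} (hi : IsInfl i) [Epi p]
    (w : i ≫ p = 0) (hp : ∀ {T : C} (t : Y ⟶ T), i ≫ t = 0 → ∃ l : Z ⟶ T, p ≫ l = t) :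
    IsShortExact i p := by
  obtain ⟨X', p', h⟩ := hi
  obtain ⟨a, ha⟩ := hp p' h.zero
  obtain ⟨b, hb⟩ := h.exists_desc p w
  have := h.epi
  refine h.of_iso (Iso.refl _) (Iso.refl _) ⟨b, a, ?_, ?_⟩ (by simp) (by simpa using hb.symm)
  · rw [← cancel_epi p', ← Category.assoc, hb, ha, Category.comp_id]
  · rw [← cancel_epi p, ← Category.assoc, ha, hb, Category.comp_id]

lemma IsDefl.comp {X Y Z : C} {p : X ⟶ Y} {q : Y ⟶ Z} (hp : IsDefl p) (hq : IsDefl q) :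
    IsDefl (p ≫ q) := ExactCategory.comp_deflation p q hp hq

lemma IsInfl.comp {X Y Z : C} {p : X ⟶ Y} {q : Y ⟶ Z} (hp : IsInfl p) (hq : IsInfl q) :
    IsInfl (p ≫ q) := ExactCategory.comp_inflation p q hp hq

lemma isDefl_of_iso {X Y : C} (e : X ⟶ Y) [IsIso e] : IsDefl e := by
  obtain ⟨K, k, h⟩ := ExactCategory.id_deflation X
  have h : IsShortExact k (𝟙 X) := h
  exact ⟨K, k, h.of_iso (Iso.refl _) (Iso.refl _) (asIso e) (by simp) (by simp)⟩

lemma isInfl_of_iso {X Y : C} (e : X ⟶ Y) [IsIso e] : IsInfl e := by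
  obtain ⟨K, k, h⟩ := ExactCategory.id_inflation X
  have h : IsShortExact (𝟙 X) k := h
  exact ⟨K, inv e ≫ k, h.of_iso (Iso.refl _) (asIso e) (Iso.refl _) (by simp) (by simp)⟩

lemma isShortExact_iso_zero {X Y Z : C} (e : X ⟶ Y) [IsIso e] (q : Y ⟶ Z) (hZ : IsZero Z) :
    IsShortExact e q := by
  have : Epi q := ⟨fun _ _ _ => hZ.eq_of_src _ _⟩
  refine (isInfl_of_iso e).shortExact_of_cokernel (hZ.eq_of_tgt _ _) fun t ht => ⟨0, ?_⟩
  rw [← cancel_epi e, ht]; simp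

lemma isShortExact_zero_iso {X Y Z : C} (i : X ⟶ Y) (e : Y ⟶ Z) [IsIso e] (hX : IsZero X) :
    IsShortExact i e := by
  have : Mono i := ⟨fun _ _ _ => hX.eq_of_tgt _ _⟩
  refine (isDefl_of_iso e).shortExact_of_kernel (hX.eq_of_src _ _) fun t ht => ⟨0, ?_⟩
  rw [← cancel_mono e, ht]; simp

lemma isShortExact_of_isZero {X Y Z : C} (i : X ⟶ Y) (p : Y ⟶ Z) (hX : IsZero X) (hY : IsZero Y)
    (hZ : IsZero Z) : IsShortExact i p := by
  have : IsIso i := ⟨0, hX.eq_of_src _ _, hY.eq_of_src _ _⟩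
  exact isShortExact_iso_zero i p hZ

lemma IsShortExact.isZero_left {X Y Z : C} {i : X ⟶ Y} {p : Y ⟶ Z} (h : IsShortExact i p)
    (hY : IsZero Y) : IsZero X := by
  have := h.mono
  exact IsZero.of_mono i hY

lemma IsShortExact.isZero_right {X Y Z : C} {i : X ⟶ Y} {p : Y ⟶ Z} (h : IsShortExact i p)
    (hY : IsZero Y) : IsZero Z := by
  have := h.epi
  exact IsZero.of_epi p hY

lemma IsDefl.of_isPullback {Y' Z' Y Z : C} {f' : Y' ⟶ Y} {p' : Y' ⟶ Z'} {p : Y ⟶ Z}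
    {f : Z' ⟶ Z} (sq : IsPullback f' p' p f) (hp : IsDefl p) : IsDefl p' := by
  obtain ⟨W, q, g, sq', hq⟩ := ExactCategory.pullback_deflation p f hp
  have hq : IsDefl q := hq
  have e := (sq.isoIsPullback_hom_snd _ _ sq')
  rw [← e]
  exact (isDefl_of_iso _).comp hq

lemma IsInfl.of_isPushout {X Y X' Y' : C} {i : X ⟶ Y} {f : X ⟶ X'} {f' : Y ⟶ Y'}
    {i' : X' ⟶ Y'} (sq : IsPushout i f f' i') (hi : IsInfl i) : IsInfl i' := by
  obtain ⟨W, q, g, sq', hq⟩ := ExactCategory.pushout_inflation i f hi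
  have hq : IsInfl q := hq
  have e := (sq'.inr_isoIsPushout_hom _ _ sq)
  rw [← e]
  exact hq.comp (isInfl_of_iso _)

/-- The projection is the base change of `X ⟶ 0`, a deflation with kernel `𝟙 X`. -/
lemma isDefl_biprod_snd (X Y : C) : IsDefl (biprod.snd : X ⊞ Y ⟶ Y) :=
  IsDefl.of_isPullback (IsPullback.of_has_biproduct X Y)
    ⟨X, 𝟙 X, isShortExact_iso_zero (𝟙 X) (0 : X ⟶ 0) (isZero_zero C)⟩

/-- A split sequence is short exact. -/
lemma isShortExact_of_splitting {X Y Z : C} {i : X ⟶ Y} {p : Y ⟶ Z} (r : Y ⟶ X) (s : Z ⟶ Y)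
    (hr : i ≫ r = 𝟙 X) (hs : s ≫ p = 𝟙 Z) (w : i ≫ p = 0) (h : r ≫ i + p ≫ s = 𝟙 Y) :
    IsShortExact i p := by
  have hsr : s ≫ r = 0 := by
    have h1 : s ≫ (r ≫ i + p ≫ s) ≫ r = s ≫ r := by rw [h, Category.id_comp]
    have : s ≫ r + s ≫ r = s ≫ r := by
      conv_rhs => rw [← h1]
      simp only [Preadditive.add_comp, Preadditive.comp_add, Category.assoc, hr, Category.comp_id]
      rw [reassoc_of% hs]
    simpa using this
  let e : X ⊞ Z ≅ Y :=
    { hom := biprod.desc i s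
      inv := biprod.lift r p
      hom_inv_id := by
        ext <;> simp [hr, hs, w, hsr]
      inv_hom_id := by simpa using h }
  have h0 : IsShortExact (biprod.inl : X ⟶ X ⊞ Z) biprod.snd :=
    (isDefl_biprod_snd X Z).shortExact_of_kernel (by simp)
      fun t ht => ⟨t ≫ biprod.fst, by ext <;> simp [ht]⟩
  exact h0.of_iso (Iso.refl _) e (Iso.refl _) (by simp [e]) (by ext <;> simp [e, w, hs])

lemma isShortExact_inl_snd (X Y : C) :
    IsShortExact (biprod.inl : X ⟶ X ⊞ Y) (biprod.snd : X ⊞ Y ⟶ Y) :=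
  isShortExact_of_splitting biprod.fst biprod.inr (by simp) (by simp) (by simp) (by simp)

lemma isShortExact_inr_fst (X Y : C) :
    IsShortExact (biprod.inr : Y ⟶ X ⊞ Y) (biprod.fst : X ⊞ Y ⟶ X) :=
  isShortExact_of_splitting biprod.snd biprod.inl (by simp) (by simp) (by simp)
    (by rw [add_comm]; simp)

lemma IsDefl.biprod_map {Y Z Y' Z' : C} {g : Y ⟶ Z} {g' : Y' ⟶ Z'} (h : IsDefl g)
    (h' : IsDefl g') : IsDefl (biprod.map g g') := by
  have : biprod.map g g' = biprod.map g (𝟙 _) ≫ biprod.map (𝟙 _) g' := by ext <;> simp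
  rw [this]
  exact (h.of_isPullback (isPullback_biprod_map_id g _)).comp
    (h'.of_isPullback (isPullback_biprod_id_map g' _))

lemma IsShortExact.biprod_map {X Y Z X' Y' Z' : C} {f : X ⟶ Y} {g : Y ⟶ Z} {f' : X' ⟶ Y'}
    {g' : Y' ⟶ Z'} (h : IsShortExact f g) (h' : IsShortExact f' g') :
    IsShortExact (biprod.map f f') (biprod.map g g') := by
  have := h.mono
  have := h'.mono
  have : Mono (biprod.map f f') := by
    refine ⟨fun a b hab => ?_⟩
    ext
    · rw [← cancel_mono f]; simpa using congr($hab ≫ biprod.fst)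
    · rw [← cancel_mono f']; simpa using congr($hab ≫ biprod.snd)
  refine (h.isDefl.biprod_map h'.isDefl).shortExact_of_kernel
    (by ext <;> simp [h.zero, h'.zero]) fun t ht => ?_
  obtain ⟨l, hl⟩ := h.exists_lift (t ≫ biprod.fst) (by simpa using congr($ht ≫ biprod.fst))
  obtain ⟨l', hl'⟩ := h'.exists_lift (t ≫ biprod.snd) (by simpa using congr($ht ≫ biprod.snd))
  exact ⟨biprod.lift l l', by ext <;> simp [hl, hl']⟩

/-! ### Ladders of short exact sequences -/

section Ladder

variable {A₁ B₁ C₁ A₀ B₀ C₀ : C} {i₁ : A₁ ⟶ B₁} {p₁ : B₁ ⟶ C₁} {i₀ : A₀ ⟶ B₀} {p₀ : B₀ ⟶ C₀}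
  {a : A₁ ⟶ A₀} {b : B₁ ⟶ B₀} {c : C₁ ⟶ C₀}

/-- `k ≫ i₁` is an inflation, being a composite of two, so it remains to recognize `b` as its
cokernel. A map `t` killing it is descended by pushing out the lower row along the map that `t`
induces on `A₀`. -/
lemma IsShortExact.of_ladder_of_iso_right {p₀ : B₀ ⟶ C₁} (h₁ : IsShortExact i₁ p₁)
    (h₀ : IsShortExact i₀ p₀) (hab : i₁ ≫ b = a ≫ i₀) (hbc : b ≫ p₀ = p₁)
    {K : C} {k : K ⟶ A₁} (hk : IsShortExact k a) : IsShortExact (k ≫ i₁) b := by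
  have := h₁.epi
  have := h₀.mono
  have := hk.epi
  have : Epi b := by
    refine Preadditive.epi_of_cancel_zero _ fun r hr => ?_
    have h1 : i₀ ≫ r = 0 := by
      rw [← cancel_epi a, ← Category.assoc, ← hab, Category.assoc, hr]; simp
    obtain ⟨s, rfl⟩ := h₀.exists_desc r h1
    have : s = 0 := by
      rw [← cancel_epi p₁, ← hbc, Category.assoc, hr]; simp
    simp [this]
  refine (hk.isInfl.comp h₁.isInfl).shortExact_of_cokernel
    (by rw [Category.assoc, hab, ← Category.assoc, hk.zero, zero_comp]) fun {T} t ht => ?_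
  obtain ⟨s, hs⟩ := hk.exists_desc (i₁ ≫ t) (by simpa using ht)
  obtain ⟨T', i', g, sq, -⟩ := ExactCategory.pushout_inflation i₀ s h₀.isInfl
  have hi' : IsInfl i' := IsInfl.of_isPushout sq h₀.isInfl
  let q : T' ⟶ C₁ := sq.desc p₀ 0 (by simp [h₀.zero])
  have hgq : g ≫ q = p₀ := sq.inl_desc _ _ _
  have hiq : i' ≫ q = 0 := sq.inr_desc _ _ _
  have hq : IsShortExact i' q := by
    have : Epi q := by
      have : Epi (g ≫ q) := by rw [hgq]; exact h₀.epi
      exact epi_of_epi g q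
    refine hi'.shortExact_of_cokernel hiq fun u hu => ?_
    obtain ⟨m, hm⟩ := h₀.exists_desc (g ≫ u) (by
      rw [← Category.assoc, sq.w, Category.assoc, hu, comp_zero])
    refine ⟨m, sq.hom_ext ?_ ?_⟩
    · rw [← Category.assoc, hgq, hm]
    · rw [← Category.assoc, hiq, hu, zero_comp]
  -- `b ≫ g` and `t ≫ i'` agree on `A₁`, so they differ by a map `e` from `C₁`. Correcting `g` by
  -- `p₀ ≫ e` makes it land in the kernel `T` of `q`.
  obtain ⟨e, he⟩ := h₁.exists_desc (b ≫ g - t ≫ i') (by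
    rw [Preadditive.comp_sub, ← Category.assoc, hab, ← Category.assoc, ← hs, Category.assoc,
      Category.assoc, sq.w, sub_self])
  have hm : b ≫ (g - p₀ ≫ e) = t ≫ i' := by
    rw [Preadditive.comp_sub, ← Category.assoc b p₀, hbc, he]; abel
  obtain ⟨l, hl⟩ := hq.exists_lift (g - p₀ ≫ e) (by
    rw [← cancel_epi b, ← Category.assoc, hm, Category.assoc, hiq]; simp)
  have := hq.mono
  refine ⟨l, ?_⟩
  rw [← cancel_mono i', Category.assoc, hl, hm]

/-- The comparison map to a pullback of the lower row of a ladder. -/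
lemma exists_pullback_ladder (h₁ : IsShortExact i₁ p₁) (h₀ : IsShortExact i₀ p₀)
    (hab : i₁ ≫ b = a ≫ i₀) (hbc : b ≫ p₀ = p₁ ≫ c) (ha : IsDefl a) :
    ∃ (E : C) (f : E ⟶ B₀) (q : E ⟶ C₁) (b' : B₁ ⟶ E), IsPullback f q p₀ c ∧ b' ≫ f = b ∧
      b' ≫ q = p₁ ∧ IsDefl b' := by
  obtain ⟨K, k, hk⟩ := ha
  obtain ⟨E, q, f, sq, hq⟩ := ExactCategory.pullback_deflation p₀ c h₀.isDefl
  have hq : IsDefl q := hq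
  have := h₀.mono
  let j : A₀ ⟶ E := sq.lift i₀ 0 (by simp [h₀.zero])
  have hjf : j ≫ f = i₀ := sq.lift_fst _ _ _
  have hjq : j ≫ q = 0 := sq.lift_snd _ _ _
  have : Mono j := by
    have : Mono (j ≫ f) := by rw [hjf]; infer_instance
    exact mono_of_mono j f
  have hj : IsShortExact j q := hq.shortExact_of_kernel hjq fun t ht => by
    obtain ⟨l, hl⟩ := h₀.exists_lift (t ≫ f) (by
      rw [Category.assoc, sq.w, ← Category.assoc, ht, zero_comp])
    refine ⟨l, sq.hom_ext ?_ ?_⟩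
    · rw [Category.assoc, hjf, hl]
    · rw [Category.assoc, hjq, ht, comp_zero]
  have hf : sq.lift b p₁ hbc ≫ f = b := sq.lift_fst _ _ _
  have hp : sq.lift b p₁ hbc ≫ q = p₁ := sq.lift_snd _ _ _
  refine ⟨E, f, q, sq.lift b p₁ hbc, sq, hf, hp, ?_⟩
  refine (h₁.of_ladder_of_iso_right hj (sq.hom_ext ?_ ?_) hp hk).isDefl
  · rw [Category.assoc, hf, hab, Category.assoc, hjf]
  · rw [Category.assoc, hp, h₁.zero, Category.assoc, hjq, comp_zero]

/-- `b` is a deflation onto the pullback of `p₀` along `c`, followed by a base change of `c`. -/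
lemma IsDefl.of_ladder (h₁ : IsShortExact i₁ p₁) (h₀ : IsShortExact i₀ p₀)
    (hab : i₁ ≫ b = a ≫ i₀) (hbc : b ≫ p₀ = p₁ ≫ c) (ha : IsDefl a) (hc : IsDefl c) :
    IsDefl b := by
  obtain ⟨E, f, q, b', sq, rfl, -, hb'⟩ := exists_pullback_ladder h₁ h₀ hab hbc ha
  exact hb'.comp (hc.of_isPullback sq.flip)

/-- The kernels of a ladder of deflations form a short exact sequence. -/
lemma IsShortExact.ladder_kernels (h₁ : IsShortExact i₁ p₁) (h₀ : IsShortExact i₀ p₀)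
    (hab : i₁ ≫ b = a ≫ i₀) (hbc : b ≫ p₀ = p₁ ≫ c) {Ka Kb Kc : C} {ka : Ka ⟶ A₁}
    {kb : Kb ⟶ B₁} {kc : Kc ⟶ C₁} (ha : IsShortExact ka a) (hb : IsShortExact kb b)
    (hc : IsShortExact kc c) {α : Ka ⟶ Kb} {β : Kb ⟶ Kc} (hα : α ≫ kb = ka ≫ i₁)
    (hβ : β ≫ kc = kb ≫ p₁) : IsShortExact α β := by
  obtain ⟨E, f, q, b', sq, hf, hq, hb'⟩ := exists_pullback_ladder h₁ h₀ hab hbc ha.isDefl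
  have := ha.mono
  have := hb.mono
  have := hc.mono
  have := h₁.mono
  have := h₀.mono
  have : Mono α := by
    have : Mono (α ≫ kb) := by rw [hα]; infer_instance
    exact mono_of_mono α kb
  -- `m` embeds `Kc` as the kernel of `E ⟶ B₀`, and `β` is the base change of the deflation `b'`
  -- along it.
  let m : Kc ⟶ E := sq.lift 0 kc (by simp [hc.zero])
  have hmf : m ≫ f = 0 := sq.lift_fst _ _ _
  have hmq : m ≫ q = kc := sq.lift_snd _ _ _
  have hs : ∀ s : PullbackCone b' m, s.fst ≫ b = 0 := fun s => by
    rw [← hf, ← Category.assoc, s.condition, Category.assoc, hmf, comp_zero]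
  have sq' : IsPullback kb β b' m := by
    refine ⟨⟨sq.hom_ext ?_ ?_⟩, ⟨PullbackCone.IsLimit.mk _
      (fun s => (hb.exists_lift s.fst (hs s)).choose) (fun s => ?_) (fun s => ?_)
      (fun s l h1 h2 => ?_)⟩⟩
    · rw [Category.assoc, hf, hb.zero, Category.assoc, hmf, comp_zero]
    · rw [Category.assoc, hq, Category.assoc, hmq, hβ]
    · exact (hb.exists_lift s.fst (hs s)).choose_spec
    · rw [← cancel_mono kc, Category.assoc, hβ, ← Category.assoc,
        (hb.exists_lift s.fst (hs s)).choose_spec, ← hq, ← Category.assoc, s.condition,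
        Category.assoc, hmq]
    · rw [← cancel_mono kb, h1]
      exact (hb.exists_lift s.fst (hs s)).choose_spec.symm
  refine (hb'.of_isPullback sq').shortExact_of_kernel ?_ fun t ht => ?_
  · rw [← cancel_mono kc, Category.assoc, hβ, ← Category.assoc, hα, Category.assoc, h₁.zero]
    simp
  · obtain ⟨l, hl⟩ := h₁.exists_lift (t ≫ kb) (by
      rw [Category.assoc, ← hβ, ← Category.assoc, ht, zero_comp])
    obtain ⟨l', hl'⟩ := ha.exists_lift l (by
      rw [← cancel_mono i₀, Category.assoc, ← hab, ← Category.assoc, hl, Category.assoc, hb.zero]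
      simp)
    refine ⟨l', ?_⟩
    rw [← cancel_mono kb, Category.assoc, hα, ← Category.assoc, hl', hl]

end Ladder

/-- If `f ≫ g` is a deflation of a weakly idempotent complete category, then so is `g`. -/
lemma IsDefl.of_comp (hC : SupportsLongExactSequences C) {X Y Z : C} {f : X ⟶ Y} {g : Y ⟶ Z}
    (h : IsDefl (f ≫ g)) : IsDefl g := by
  have h1 : IsDefl (biprod.desc (𝟙 Z) g : Z ⊞ Y ⟶ Z) :=
    ⟨Y, biprod.lift (-g) (𝟙 Y), isShortExact_of_splitting biprod.snd biprod.inl (by simp) (by simp)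
      (by simp) (by ext <;> simp)⟩
  -- Although `g` is not known to be a deflation, `(f ≫ g, g)` is one, as a composite of two. The
  -- shear `θ` then turns it into `(0, g)`.
  have h2 : IsDefl (biprod.desc (f ≫ g) g : X ⊞ Y ⟶ Z) := by
    have : (biprod.desc (f ≫ g) g : X ⊞ Y ⟶ Z) =
      biprod.map (f ≫ g) (𝟙 Y) ≫ biprod.desc (𝟙 Z) g := by ext <;> simp
    rw [this]
    exact (h.biprod_map (isDefl_of_iso _)).comp h1
  let θ : X ⊞ Y ≅ X ⊞ Y :=
    { hom := biprod.desc (biprod.lift (𝟙 X) (-f)) biprod.inr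
      inv := biprod.desc (biprod.lift (𝟙 X) f) biprod.inr
      hom_inv_id := by ext <;> simp
      inv_hom_id := by ext <;> simp }
  have h3 : IsDefl (biprod.snd ≫ g : X ⊞ Y ⟶ Z) := by
    have : (biprod.snd ≫ g : X ⊞ Y ⟶ Z) = θ.hom ≫ biprod.desc (f ≫ g) g := by
      ext <;> simp [θ]
    rw [this]
    have hθ : IsIso θ.hom := θ.isIso_hom
    exact (isDefl_of_iso θ.hom).comp h2
  -- `X` is a retract of the kernel `K` of `(0, g)`. The hypothesis on `C` provides the
  -- complementary summand, which is the kernel of `g`.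
  obtain ⟨K, κ, hκ⟩ := h3
  obtain ⟨l, hl⟩ := hκ.exists_lift (biprod.inl : X ⟶ X ⊞ Y) (by simp)
  have := hκ.mono
  have hlr : l ≫ (κ ≫ biprod.fst) = 𝟙 X := by rw [← Category.assoc, hl]; simp
  have := hC (κ ≫ biprod.fst) ⟨l, hlr⟩
  let ι := kernel.ι (κ ≫ biprod.fst)
  have hι : ι ≫ κ ≫ biprod.fst = 0 := kernel.condition _
  let π : K ⟶ kernel (κ ≫ biprod.fst) := kernel.lift _ (𝟙 K - (κ ≫ biprod.fst) ≫ l) (by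
    rw [Preadditive.sub_comp, Category.assoc _ l, hlr]; simp)
  have hπ : π ≫ ι = 𝟙 K - (κ ≫ biprod.fst) ≫ l := kernel.lift_ι _ _ _
  have hιπ : ι ≫ π = 𝟙 _ := by
    rw [← cancel_mono ι, Category.assoc, hπ, Preadditive.comp_sub, ← Category.assoc ι, hι]; simp
  have hlπ : l ≫ π = 0 := by
    rw [← cancel_mono ι, Category.assoc, hπ, Preadditive.comp_sub, ← Category.assoc l, hlr]; simp
  have hπj : π ≫ ι ≫ κ ≫ biprod.snd = κ ≫ biprod.snd := by
    rw [← Category.assoc, hπ, Preadditive.sub_comp, Category.assoc _ l, ← Category.assoc l, hl]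
    simp
  -- Pushing out the inflation `κ` along the projection that discards `X` shows that the complement
  -- is included in `Y` by an inflation; `g` is its cokernel.
  have sq : IsPushout κ π (biprod.snd : X ⊞ Y ⟶ Y) (ι ≫ κ ≫ biprod.snd) := by
    have key : ∀ s : PushoutCocone κ π, s.inl = biprod.snd ≫ biprod.inr ≫ s.inl := fun s => by
      have : biprod.inl ≫ s.inl = 0 := by
        rw [← hl, Category.assoc, s.condition, ← Category.assoc, hlπ, zero_comp]
      ext
      · simp [this]
      · simp
    refine ⟨⟨hπj.symm⟩, ⟨PushoutCocone.IsColimit.mk _ (fun s => biprod.inr ≫ s.inl)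
      (fun s => (key s).symm) (fun s => ?_) (fun s m h1 h2 => ?_)⟩⟩
    · rw [Category.assoc, Category.assoc, ← key s, s.condition, ← Category.assoc, hιπ,
        Category.id_comp]
    · rw [← h1]; simp
  have hj : IsInfl (ι ≫ κ ≫ biprod.snd) := IsInfl.of_isPushout sq hκ.isInfl
  have hepi : Epi (biprod.snd ≫ g : X ⊞ Y ⟶ Z) := hκ.epi
  have : Epi g := epi_of_epi (biprod.snd : X ⊞ Y ⟶ Y) g
  refine (hj.shortExact_of_cokernel ?_ fun t ht => ?_).isDefl
  · have := hκ.zero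
    rw [Category.assoc, Category.assoc, this, comp_zero]
  · obtain ⟨m, hm⟩ := hκ.exists_desc (biprod.snd ≫ t) (by
      rw [← Category.assoc, ← hπj, Category.assoc, ht, comp_zero])
    refine ⟨m, ?_⟩
    rw [← cancel_epi (biprod.snd : X ⊞ Y ⟶ Y), ← Category.assoc, hm]

end ExactBasics


/-! ### Shifts, mapping cones and direct sums of complexes -/

section Cone

variable {C : Type u} [Category.{v} C]

lemma IsBoundedGraded.mono {X Y : ℤ → C} (h : IsBoundedGraded X)
    (hXY : ∀ i, IsZero (X i) → IsZero (Y i)) : IsBoundedGraded Y := by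
  obtain ⟨a, b, h⟩ := h
  exact ⟨a, b, fun i hi => hXY i (h i hi)⟩

lemma IsBoundedGraded.shift {X : ℤ → C} (h : IsBoundedGraded X) :
    IsBoundedGraded (fun i => X (i - 1)) := by
  obtain ⟨a, b, h⟩ := h
  exact ⟨a + 1, b + 1, fun i hi => h (i - 1) (by omega)⟩

variable [Preadditive C]

lemma IsBoundedGraded.biprod [HasBinaryBiproducts C] {X Y : ℤ → C} (hX : IsBoundedGraded X)
    (hY : IsBoundedGraded Y) : IsBoundedGraded (fun i => X i ⊞ Y i) := by
  obtain ⟨a, b, h⟩ := hX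
  obtain ⟨a', b', h'⟩ := hY
  refine ⟨min a a', max b b', fun i hi => ?_⟩
  rw [biprod_isZero_iff]
  exact ⟨h i (by omega), h' i (by omega)⟩

/-- A graded map of degree zero, regarded as a map between arbitrary components. -/
def degZero {K L : ChainComplex C ℤ} (φ : K ⟶ L) (i j : ℤ) : K.X i ⟶ L.X j :=
  if h : i = j then φ.f i ≫ eqToHom (by rw [h]) else 0

section

variable {K L K' L' : ChainComplex C ℤ} (φ : K ⟶ L)

@[simp]
lemma degZero_self (i : ℤ) : degZero φ i i = φ.f i := by simp [degZero]

lemma degZero_of_ne {i j : ℤ} (h : i ≠ j) : degZero φ i j = 0 := dif_neg h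

lemma degZero_d {i j k k' : ℤ} (h : i = j) (h' : k' = k) :
    degZero φ i j ≫ L.d j k = K.d i k' ≫ degZero φ k' k := by
  subst h h'; simp

lemma degZero_naturality {φ : K ⟶ L} {φ' : K' ⟶ L'} {α : K ⟶ K'} {β : L ⟶ L'}
    (h : φ ≫ β = α ≫ φ') (i j : ℤ) : degZero φ i j ≫ β.f j = α.f i ≫ degZero φ' i j := by
  by_cases hij : i = j
  · subst hij
    simpa using congr(($h).f i)
  · simp [degZero_of_ne _ hij]

@[simp]
lemma degZero_zero (i j : ℤ) : degZero (0 : K ⟶ L) i j = 0 := by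
  simp [degZero]

end

/-- The shift of a chain complex. -/
@[simps]
abbrev shift (K : ChainComplex C ℤ) : ChainComplex C ℤ where
  X i := K.X (i - 1)
  d i j := -K.d (i - 1) (j - 1)
  shape i j h := by rw [K.shape, neg_zero]; simp at h ⊢; omega
  d_comp_d' i j k _ _ := by simp

lemma isBoundedGraded_zero [HasZeroObject C] :
    IsBoundedGraded (HomologicalComplex.zero : ChainComplex C ℤ).X :=
  ⟨0, 0, fun _ _ => isZero_zero C⟩

variable [HasBinaryBiproducts C]

/-- The mapping cone of a chain map. -/
@[simps]
abbrev cone {K L : ChainComplex C ℤ} (φ : K ⟶ L) : ChainComplex C ℤ where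
  X i := K.X (i - 1) ⊞ L.X i
  -- `degZero` stands in for a cast along `i - 1 = j`.
  d i j := biprod.desc (biprod.lift (-K.d (i - 1) (j - 1)) (degZero φ (i - 1) j))
    (biprod.lift 0 (L.d i j))
  shape i j h := by
    simp only [ComplexShape.down_Rel] at h
    rw [K.shape, L.shape, degZero_of_ne]
    · ext <;> simp
    · omega
    · simpa using h
    · simp; omega
  d_comp_d' i j k hij hjk := by
    simp only [ComplexShape.down_Rel] at hij hjk
    ext
    · simp
    · simp [degZero_d φ (show i - 1 = j by omega) (show j - 1 = k by omega)]
    · simp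
    · simp

lemma IsBoundedGraded.cone {K L : ChainComplex C ℤ} (hK : IsBoundedGraded K.X)
    (hL : IsBoundedGraded L.X) (φ : K ⟶ L) : IsBoundedGraded (cone φ).X :=
  hK.shift.biprod hL

/-- The map of cones induced by a commutative square. -/
@[simps]
def coneMap {K L K' L' : ChainComplex C ℤ} {φ : K ⟶ L} {φ' : K' ⟶ L'} (α : K ⟶ K') (β : L ⟶ L')
    (h : φ ≫ β = α ≫ φ') : cone φ ⟶ cone φ' where
  f i := biprod.map (α.f (i - 1)) (β.f i)
  comm' i j _ := by
    ext
    · simp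
    · simp [degZero_naturality h]
    · simp
    · simp

/-- The map out of a cone which vanishes on the shifted source. -/
@[simps]
def coneDesc {K L R : ChainComplex C ℤ} {φ : K ⟶ L} (ψ : L ⟶ R) (h : φ ≫ ψ = 0) :
    cone φ ⟶ R where
  f i := biprod.snd ≫ ψ.f i
  comm' i j _ := by
    have h' : φ ≫ ψ = (0 : K ⟶ K) ≫ 0 := by simpa using h
    ext
    · simp [degZero_naturality h']
    · simp

/-- The inclusion of the target into the cone. -/
@[simps]
def coneInr {K L : ChainComplex C ℤ} (φ : K ⟶ L) : L ⟶ cone φ where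
  f i := biprod.inr
  comm' i j _ := by ext <;> simp

/-- The projection of the cone onto the shifted source. -/
@[simps]
def coneFst {K L : ChainComplex C ℤ} (φ : K ⟶ L) : cone φ ⟶ shift K where
  f i := biprod.fst
  comm' i j _ := by ext <;> simp

/-- The direct sum of two chain complexes. -/
@[simps]
abbrev sumC (K L : ChainComplex C ℤ) : ChainComplex C ℤ where
  X i := K.X i ⊞ L.X i
  d i j := biprod.map (K.d i j) (L.d i j)
  shape i j h := by rw [K.shape _ _ h, L.shape _ _ h]; ext <;> simp
  d_comp_d' i j k _ _ := by ext <;> simp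

namespace sumC

variable (K L : ChainComplex C ℤ)

/-- The first inclusion. -/
@[simps]
def inl : K ⟶ sumC K L where
  f i := biprod.inl

/-- The second inclusion. -/
@[simps]
def inr : L ⟶ sumC K L where
  f i := biprod.inr

/-- The first projection. -/
@[simps]
def fst : sumC K L ⟶ K where
  f i := biprod.fst

/-- The second projection. -/
@[simps]
def snd : sumC K L ⟶ L where
  f i := biprod.snd

variable {K L}

/-- The map into a direct sum with given components. -/
@[simps]
def lift {T : ChainComplex C ℤ} (a : T ⟶ K) (b : T ⟶ L) : T ⟶ sumC K L where
  f i := biprod.lift (a.f i) (b.f i)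
  comm' i j _ := by ext <;> simp

/-- The map out of a direct sum with given components. -/
@[simps]
def desc {T : ChainComplex C ℤ} (a : K ⟶ T) (b : L ⟶ T) : sumC K L ⟶ T where
  f i := biprod.desc (a.f i) (b.f i)
  comm' i j _ := by ext <;> simp

/-- The direct sum of two maps. -/
@[simps]
def map {K' L' : ChainComplex C ℤ} (a : K ⟶ K') (b : L ⟶ L') : sumC K L ⟶ sumC K' L' where
  f i := biprod.map (a.f i) (b.f i)
  comm' i j _ := by ext <;> simp

end sumC

/-- The cone is isomorphic to the homotopy cofiber. -/
def coneIso {K L : ChainComplex C ℤ} (φ : K ⟶ L) :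
    HomologicalComplex.homotopyCofiber φ ≅ cone φ :=
  HomologicalComplex.Hom.isoOfComponents
    (fun i =>
      { hom := biprod.lift (HomologicalComplex.homotopyCofiber.fstX φ i (i - 1) (by simp))
          (HomologicalComplex.homotopyCofiber.sndX φ i)
        inv := biprod.desc (HomologicalComplex.homotopyCofiber.inlX φ (i - 1) i (by simp))
          (HomologicalComplex.homotopyCofiber.inrX φ i)
        hom_inv_id := HomologicalComplex.homotopyCofiber.ext_from_X φ (i - 1) i (by simp)
          (by simp) (by simp)
        inv_hom_id := by ext <;> simp }) (by
    intro i j hij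
    obtain rfl : i = j + 1 := by simpa using hij.symm
    have e : j + 1 - 1 = j := by omega
    -- The cone produces the index `j + 1 - 1` where the cofiber has `j`; a variable `k` equal to
    -- `j` allows substitution.
    have hφ : ∀ (k : ℤ) (_ : k = j) (h1),
        HomologicalComplex.homotopyCofiber.fstX φ (j + 1) k h1 ≫ degZero φ k j =
          HomologicalComplex.homotopyCofiber.fstX φ (j + 1) j (by simp) ≫ φ.f j := by
      rintro k rfl h1
      simp
    have hd : ∀ (k : ℤ) (_ : k = j) (h1),
        HomologicalComplex.homotopyCofiber.fstX φ (j + 1) k h1 ≫ K.d k (j - 1) =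
          HomologicalComplex.homotopyCofiber.fstX φ (j + 1) j (by simp) ≫ K.d j (j - 1) := by
      rintro k rfl h1
      rfl
    ext
    · simp [hd _ e,
        HomologicalComplex.homotopyCofiber.d_fstX φ (j + 1) j (j - 1) (by simp) (by simp)]
    · simp [hφ _ e, HomologicalComplex.homotopyCofiber.d_sndX φ (j + 1) j (by simp)])

end Cone

/-! ### Acyclic complexes and two out of three in short exact sequences -/

section Acyclic

variable {C : Type u} [Category.{v} C] [Preadditive C] [HasZeroObject C]
  [HasBinaryBiproducts C] [ExactCategory C]

/-- The differential from degree `k` to degree `i` is a deflation onto the kernel of the next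
differential. -/
def AcyclicAt (K : ChainComplex C ℤ) (k i : ℤ) : Prop :=
  ∃ (Z : C) (j : Z ⟶ K.X i) (p : K.X k ⟶ Z), K.d k i = p ≫ j ∧ Mono j ∧ IsDefl p ∧
    ∀ {T : C} (t : T ⟶ K.X i), (∀ l, t ≫ K.d i l = 0) → ∃ s : T ⟶ Z, s ≫ j = t

/-- The kernel property in `AcyclicAt` determines the cycles, so factorizations chosen separately in
each degree still splice. -/
lemma isAcyclic_iff (K : ChainComplex C ℤ) :
    IsAcyclic K ↔ ∀ k i, i + 1 = k → AcyclicAt K k i := by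
  constructor
  · rintro ⟨Z, j, p, hd, hs⟩ k i rfl
    obtain ⟨m, rfl⟩ : ∃ m, m + 1 = i := ⟨i - 1, by omega⟩
    refine ⟨_, j (m + 1), p (m + 1), hd _, (hs m).mono, (hs (m + 1)).isDefl, fun t ht => ?_⟩
    refine (hs m).exists_lift t ?_
    obtain ⟨n, rfl⟩ : ∃ n, n + 1 = m := ⟨m - 1, by omega⟩
    have := (hs n).mono
    rw [← cancel_mono (j (n + 1)), Category.assoc, ← hd, ht, zero_comp]
  · intro h
    choose Z j p hd hj hp hk using fun i => h (i + 1) i rfl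
    refine ⟨Z, j, p, hd, fun i => (hp i).shortExact_of_kernel ?_ fun t ht => hk _ t fun l => ?_⟩
    · have : Epi (p (i + 1)) := by obtain ⟨_, _, h⟩ := hp (i + 1); exact h.epi
      rw [← cancel_epi (p (i + 1)), ← cancel_mono (j i)]
      have := K.d_comp_d (i + 1 + 1) (i + 1) i
      rw [hd, hd] at this
      simpa using this
    · by_cases hl : l = i
      · subst hl
        rw [hd, ← Category.assoc, ht, zero_comp]
      · rw [K.shape _ _ (by simp; omega), comp_zero]

/-- The sign of the shifted differential is absorbed into the deflation `p`. -/
lemma isAcyclic_shift_iff (K : ChainComplex C ℤ) : IsAcyclic (shift K) ↔ IsAcyclic K := by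
  have key : ∀ k i : ℤ, AcyclicAt (shift K) k i ↔ AcyclicAt K (k - 1) (i - 1) := by
    intro k i
    constructor
    · rintro ⟨Z, j, p, hd, hj, hp, hk⟩
      refine ⟨Z, j, -p, ?_, hj, ?_, fun t ht => hk t fun l => ?_⟩
      · rw [Preadditive.neg_comp, ← hd]; simp
      · have : -p = p ≫ (-(𝟙 Z)) := by simp
        rw [this]
        have : IsIso (-(𝟙 Z)) := ⟨-𝟙 Z, by simp, by simp⟩
        exact hp.comp (isDefl_of_iso _)
      · simp [ht]
    · rintro ⟨Z, j, p, hd, hj, hp, hk⟩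
      refine ⟨Z, j, -p, ?_, hj, ?_, fun t ht => hk t fun l => ?_⟩
      · rw [Preadditive.neg_comp, ← hd]
      · have : -p = p ≫ (-(𝟙 Z)) := by simp
        rw [this]
        have : IsIso (-(𝟙 Z)) := ⟨-𝟙 Z, by simp, by simp⟩
        exact hp.comp (isDefl_of_iso _)
      · obtain ⟨m, rfl⟩ : ∃ m, l = m - 1 := ⟨l + 1, by omega⟩
        simpa using ht m
  rw [isAcyclic_iff, isAcyclic_iff]
  constructor
  · intro h k i hki
    have := (key (k + 1) (i + 1)).1 (h _ _ (by omega))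
    simpa using this
  · intro h k i hki
    exact (key k i).2 (h _ _ (by omega))

lemma IsAcyclic.of_isZero {K : ChainComplex C ℤ} (h : ∀ i, IsZero (K.X i)) : IsAcyclic K :=
  ⟨K.X, fun _ => 𝟙 _, fun _ => 0, fun _ => (h _).eq_of_src _ _,
    fun _ => isShortExact_of_isZero _ _ (h _) (h _) (h _)⟩

section ShortExact

variable {A B D : ChainComplex C ℤ} {f : A ⟶ B} {g : B ⟶ D}

lemma IsShortExactComplex.zero (h : IsShortExactComplex f g) : f ≫ g = 0 := by
  ext i; exact (h i).zero

/-- The cycles of a short exact sequence of complexes in one degree form a short exact sequence,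
extending given factorizations of the differentials. -/
structure CyclesLadder (f : A ⟶ B) (g : B ⟶ D) (i : ℤ) {ZA ZB ZD : C}
    (jA : ZA ⟶ A.X i) (jB : ZB ⟶ B.X i) (jD : ZD ⟶ D.X i) : Prop where
  exists_ladder : ∃ (α : ZA ⟶ ZB) (β : ZB ⟶ ZD), IsShortExact α β ∧ α ≫ jB = jA ≫ f.f i ∧
    β ≫ jD = jB ≫ g.f i

/-- The cycles in degree `i + 1` are the kernels of the deflations onto the cycles in degree `i`, so
`IsShortExact.ladder_kernels` carries the exact sequence of cycles one degree up. -/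
lemma CyclesLadder.succ (h : IsShortExactComplex f g) {i : ℤ} {ZA ZB ZD : C} {jA : ZA ⟶ A.X i}
    {jB : ZB ⟶ B.X i} {jD : ZD ⟶ D.X i} (hl : CyclesLadder f g i jA jB jD)
    [Mono jA] [Mono jB] [Mono jD]
    {pA : A.X (i + 1) ⟶ ZA} {pB : B.X (i + 1) ⟶ ZB} {pD : D.X (i + 1) ⟶ ZD}
    (hA : A.d (i + 1) i = pA ≫ jA) (hB : B.d (i + 1) i = pB ≫ jB) (hD : D.d (i + 1) i = pD ≫ jD)
    {ZA' ZB' ZD' : C} {jA' : ZA' ⟶ A.X (i + 1)} {jB' : ZB' ⟶ B.X (i + 1)}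
    {jD' : ZD' ⟶ D.X (i + 1)} (sA : IsShortExact jA' pA) (sB : IsShortExact jB' pB)
    (sD : IsShortExact jD' pD) : CyclesLadder f g (i + 1) jA' jB' jD' := by
  obtain ⟨α, β, hαβ, hα, hβ⟩ := hl
  have h1 : f.f (i + 1) ≫ pB = pA ≫ α := by
    rw [← cancel_mono jB, Category.assoc, ← hB, Category.assoc, hα, ← Category.assoc, ← hA]
    simp
  have h2 : pB ≫ β = g.f (i + 1) ≫ pD := by
    rw [← cancel_mono jD, Category.assoc, hβ, ← Category.assoc, ← hB, Category.assoc, ← hD]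
    simp
  obtain ⟨α', hα'⟩ := sB.exists_lift (jA' ≫ f.f (i + 1)) (by
    rw [Category.assoc, h1, ← Category.assoc, sA.zero, zero_comp])
  obtain ⟨β', hβ'⟩ := sD.exists_lift (jB' ≫ g.f (i + 1)) (by
    rw [Category.assoc, ← h2, ← Category.assoc, sB.zero, zero_comp])
  exact ⟨α', β', (h (i + 1)).ladder_kernels hαβ h1 h2 sA sB sD hα' hβ', hα', hβ'⟩

/-- A complex which vanishes in low degrees is acyclic as soon as one can produce factorizations
of its differentials inductively. -/
lemma isAcyclic_of_induction {K : ChainComplex C ℤ} (a : ℤ) (hK : ∀ i < a, IsZero (K.X i))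
    (P : ∀ i : ℤ, ∀ {Z : C}, (Z ⟶ K.X i) → Prop) (h0 : ∀ i < a, P i (𝟙 (K.X i)))
    (hs : ∀ (i : ℤ) {Z Z' : C} (j : Z ⟶ K.X i) (p : K.X (i + 1) ⟶ Z) (j' : Z' ⟶ K.X (i + 1))
      (p' : K.X (i + 1 + 1) ⟶ Z'), Mono j → P i j → K.d (i + 1) i = p ≫ j → IsShortExact j' p →
      K.d (i + 1 + 1) (i + 1) = p' ≫ j' → P (i + 1) j' ∧ IsDefl p') : IsAcyclic K := by
  -- Each new object of cycles is the kernel of the preceding deflation. The property `P` travels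
  -- along and supplies what is needed to see that the next differential is a deflation onto it.
  have key : ∀ i, ∃ (Z : C) (j : Z ⟶ K.X i) (p : K.X (i + 1) ⟶ Z), K.d (i + 1) i = p ≫ j ∧ Mono j ∧
      IsDefl p ∧ P i j ∧ ∀ {T : C} (t : T ⟶ K.X i), (∀ l, t ≫ K.d i l = 0) →
        ∃ s : T ⟶ Z, s ≫ j = t := by
    have low : ∀ i, i + 1 < a → ∃ (Z : C) (j : Z ⟶ K.X i) (p : K.X (i + 1) ⟶ Z),
        K.d (i + 1) i = p ≫ j ∧ Mono j ∧ IsDefl p ∧ P i j ∧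
        ∀ {T : C} (t : T ⟶ K.X i), (∀ l, t ≫ K.d i l = 0) → ∃ s : T ⟶ Z, s ≫ j = t := by
      intro i hi
      have z0 : IsZero (K.X i) := hK i (by omega)
      have z1 : IsZero (K.X (i + 1)) := hK _ (by omega)
      exact ⟨K.X i, 𝟙 _, 0, z0.eq_of_tgt _ _, inferInstance,
        (isShortExact_of_isZero (0 : K.X i ⟶ _) _ z0 z1 z0).isDefl, h0 i (by omega),
        fun t _ => ⟨t, by simp⟩⟩
    intro i
    -- `a - 2` is the last degree `i` for which both `K.X i` and `K.X (i + 1)` are known to vanish.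
    by_cases hi : i < a - 2
    · exact low i (by omega)
    · have hi' : a - 2 ≤ i := by omega
      clear hi
      induction i, hi' using Int.leInduction with
      | base => exact low (a - 2) (by omega)
      | succ i _ ih =>
        obtain ⟨Z, j, p, hd, hj, ⟨Z', j', hp⟩, hP, -⟩ := ih
        obtain ⟨p', hp'⟩ := hp.exists_lift (K.d (i + 1 + 1) (i + 1)) (by
          rw [← cancel_mono j, Category.assoc, ← hd]; simp)
        obtain ⟨h1, h2⟩ := hs i j p j' p' hj hP hd hp hp'.symm
        refine ⟨Z', j', p', hp'.symm, hp.mono, h2, h1, fun t ht => hp.exists_lift t ?_⟩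
        rw [← cancel_mono j, Category.assoc, ← hd, ht, zero_comp]
  rw [isAcyclic_iff]
  rintro k i rfl
  obtain ⟨Z, j, p, hd, hj, hp, -, hk⟩ := key i
  exact ⟨Z, j, p, hd, hj, hp, hk⟩

/-- Climbing from the lowest degree, the cycles of the three complexes form short exact sequences,
and `IsDefl.of_ladder` makes the next differential of `B` a deflation onto its cycles. -/
lemma IsAcyclic.of_shortExact_middle (h : IsShortExactComplex f g) (hA : IsAcyclic A)
    (hD : IsAcyclic D) (hb : IsBoundedGraded B.X) : IsAcyclic B := by
  obtain ⟨ZA, jA, pA, dA, sA⟩ := hA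
  obtain ⟨ZD, jD, pD, dD, sD⟩ := hD
  have mA : ∀ i, Mono (jA i) := fun i => by
    obtain ⟨m, rfl⟩ : ∃ m, m + 1 = i := ⟨i - 1, by omega⟩
    exact (sA m).mono
  have mD : ∀ i, Mono (jD i) := fun i => by
    obtain ⟨m, rfl⟩ : ∃ m, m + 1 = i := ⟨i - 1, by omega⟩
    exact (sD m).mono
  obtain ⟨a, b, hb⟩ := hb
  refine isAcyclic_of_induction a (fun i hi => hb i (Or.inl hi))
    (fun i _ j => CyclesLadder f g i (jA i) j (jD i)) ?_ ?_
  · intro i hi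
    replace hi := hb i (Or.inl hi)
    have zA : IsZero (ZA i) := IsZero.of_mono (jA i) ((h i).isZero_left hi)
    have zD : IsZero (ZD i) := IsZero.of_mono (jD i) ((h i).isZero_right hi)
    exact ⟨0, 0, isShortExact_of_isZero _ _ zA hi zD, zA.eq_of_src _ _, hi.eq_of_src _ _⟩
  · intro i Z Z' j p j' p' hj hl hd hs hd'
    have hl' := hl.succ h (dA i) hd (dD i) (sA i) hs (sD i)
    refine ⟨hl', ?_⟩
    obtain ⟨α, β, hαβ, hα, hβ⟩ := hl'
    have := hs.mono
    refine IsDefl.of_ladder (h (i + 1 + 1)) hαβ (a := pA (i + 1)) (c := pD (i + 1)) ?_ ?_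
      (sA (i + 1)).isDefl (sD (i + 1)).isDefl
    · rw [← cancel_mono j', Category.assoc, ← hd', Category.assoc, hα, ← Category.assoc, ← dA]
      simp
    · have := mD (i + 1)
      rw [← cancel_mono (jD (i + 1)), Category.assoc, hβ, ← Category.assoc, ← hd', Category.assoc,
        ← dD]
      simp

/-- The induction runs as for the middle term, but now only the composite of `g` with the next
differential is visibly a deflation; `IsDefl.of_comp` strips off `g`, and this is where the
hypothesis on `C` is needed. -/
lemma IsAcyclic.of_shortExact_right (hC : SupportsLongExactSequences C)
    (h : IsShortExactComplex f g) (hA : IsAcyclic A) (hB : IsAcyclic B)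
    (hb : IsBoundedGraded B.X) : IsAcyclic D := by
  obtain ⟨ZA, jA, pA, dA, sA⟩ := hA
  obtain ⟨ZB, jB, pB, dB, sB⟩ := hB
  have mA : ∀ i, Mono (jA i) := fun i => by
    obtain ⟨m, rfl⟩ : ∃ m, m + 1 = i := ⟨i - 1, by omega⟩
    exact (sA m).mono
  have mB : ∀ i, Mono (jB i) := fun i => by
    obtain ⟨m, rfl⟩ : ∃ m, m + 1 = i := ⟨i - 1, by omega⟩
    exact (sB m).mono
  obtain ⟨a, b, hb⟩ := hb
  refine isAcyclic_of_induction a (fun i hi => (h i).isZero_right (hb i (Or.inl hi)))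
    (fun i _ j => CyclesLadder f g i (jA i) (jB i) j) ?_ ?_
  · intro i hi
    replace hi := hb i (Or.inl hi)
    have zA : IsZero (ZA i) := IsZero.of_mono (jA i) ((h i).isZero_left hi)
    have zB : IsZero (ZB i) := IsZero.of_mono (jB i) hi
    exact ⟨0, 0, isShortExact_of_isZero _ _ zA zB ((h i).isZero_right hi), zA.eq_of_src _ _,
      zB.eq_of_src _ _⟩
  · intro i Z Z' j p j' p' hj hl hd hs hd'
    have hl' := hl.succ h (dA i) (dB i) hd (sA i) (sB i) hs
    refine ⟨hl', ?_⟩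
    obtain ⟨α, β, hαβ, hα, hβ⟩ := hl'
    have := hs.mono
    have e : g.f (i + 1 + 1) ≫ p' = pB (i + 1) ≫ β := by
      rw [← cancel_mono j', Category.assoc, ← hd', Category.assoc, hβ, ← Category.assoc, ← dB]
      simp
    exact IsDefl.of_comp hC (f := g.f (i + 1 + 1)) (e ▸ (sB (i + 1)).isDefl.comp hαβ.isDefl)

lemma isAcyclic_cone_id (K : ChainComplex C ℤ) : IsAcyclic (cone (𝟙 K)) := by
  rw [isAcyclic_iff]
  rintro k i hk
  have e : k - 1 = i := by omega
  -- The cycles in degree `i` are the graph of `-d`, a copy of `K.X i`; writing `i` as `k - 1` makes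
  -- the projection from degree `k` free of casts.
  refine ⟨K.X (k - 1), biprod.lift (-K.d (k - 1) (i - 1)) (degZero (𝟙 K) (k - 1) i),
    biprod.desc (𝟙 _) (K.d k (k - 1)), ?_, ?_, ?_, fun {T} t ht => ?_⟩
  · ext
    · simp
    · simp
    · simp
    · subst e; simp
  · subst e
    have : Mono (biprod.lift (-K.d (k - 1) (k - 1 - 1)) (degZero (𝟙 K) (k - 1) (k - 1)) ≫
      biprod.snd) := by simp; infer_instance
    exact mono_of_mono _ biprod.snd
  · exact ⟨_, _, isShortExact_of_splitting (i := biprod.lift (-K.d k (k - 1)) (𝟙 _))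
      biprod.snd biprod.inl (by simp) (by simp) (by simp) (by ext <;> simp)⟩
  · subst e
    refine ⟨t ≫ biprod.snd, ?_⟩
    have h1 : (cone (𝟙 K)).d (k - 1) (k - 1 - 1) ≫ biprod.snd =
        biprod.fst + biprod.snd ≫ K.d (k - 1) (k - 1 - 1) := by ext <;> simp
    have h2 : t ≫ (biprod.fst + biprod.snd ≫ K.d (k - 1) (k - 1 - 1)) = 0 := by
      rw [← h1, ← Category.assoc, ht, zero_comp]
    ext
    · simp only [Preadditive.comp_add] at h2
      simp [eq_neg_of_add_eq_zero_left h2]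
    · simp

lemma isShortExactComplex_coneInr_coneFst (φ : A ⟶ B) :
    IsShortExactComplex (coneInr φ) (coneFst φ) := fun _ => isShortExact_inr_fst _ _

lemma isShortExactComplex_coneMap {A' B' D' : ChainComplex C ℤ} {f' : A' ⟶ B'} {g' : B' ⟶ D'}
    {φ : A ⟶ A'} {ψ : B ⟶ B'} {χ : D ⟶ D'} (h : IsShortExactComplex f g)
    (h' : IsShortExactComplex f' g') (hf : φ ≫ f' = f ≫ ψ) (hg : ψ ≫ g' = g ≫ χ) :
    IsShortExactComplex (coneMap f f' hf) (coneMap g g' hg) :=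
  fun i => (h (i - 1)).biprod_map (h' i)

/-- Rotation reduces this to the other two cases: `cone (𝟙 A) ⟶ cone f ⟶ D` shows that `cone f` is
acyclic, then `B ⟶ cone f ⟶ shift A` that the shift of `A` is. -/
lemma IsAcyclic.of_shortExact_left (hC : SupportsLongExactSequences C)
    (h : IsShortExactComplex f g) (hB : IsAcyclic B) (hD : IsAcyclic D)
    (hb : IsBoundedGraded B.X) : IsAcyclic A := by
  have hA : IsBoundedGraded A.X := hb.mono fun i hi => (h i).isZero_left hi
  have h1 : IsShortExactComplex (coneMap (𝟙 A) f (by simp) : cone (𝟙 A) ⟶ cone f)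
      (coneDesc g h.zero) := fun i => by
    refine ((isShortExact_iso_zero (𝟙 (A.X (i - 1))) 0 (isZero_zero C)).biprod_map (h i)).of_iso
      (Iso.refl _) (Iso.refl _)
      ⟨biprod.snd, biprod.inr, by ext; simp, by simp⟩ ?_ ?_
    · simp
    · simp
  have h2 : IsAcyclic (cone f) :=
    .of_shortExact_middle h1 (isAcyclic_cone_id A) hD (hA.cone hb f)
  have h3 := IsAcyclic.of_shortExact_right hC (isShortExactComplex_coneInr_coneFst f) hB h2
    (hA.cone hb f)
  rwa [isAcyclic_shift_iff] at h3

end ShortExact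

end Acyclic


/-! ### Quasi-isomorphisms -/

section QuasiIso

variable {C : Type u} [Category.{v} C] [Preadditive C] [HasZeroObject C]
  [HasBinaryBiproducts C] [ExactCategory C]

lemma isQuasiIso_iff {K L : ChainComplex C ℤ} (φ : K ⟶ L) :
    IsQuasiIso φ ↔ IsAcyclic (cone φ) :=
  ⟨fun h => h.of_iso (coneIso φ), fun h => h.of_iso (coneIso φ).symm⟩

lemma isQuasiIso_id (K : ChainComplex C ℤ) : IsQuasiIso (𝟙 K) :=
  (isQuasiIso_iff _).2 (isAcyclic_cone_id K)

lemma isQuasiIso_iff_of_acyclic_source (hC : SupportsLongExactSequences C)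
    {K L : ChainComplex C ℤ} (φ : K ⟶ L) (hK : IsBoundedGraded K.X) (hL : IsBoundedGraded L.X)
    (h : IsAcyclic K) : IsQuasiIso φ ↔ IsAcyclic L := by
  rw [isQuasiIso_iff]
  have h' := (isAcyclic_shift_iff K).2 h
  exact ⟨fun h1 => .of_shortExact_left hC (isShortExactComplex_coneInr_coneFst φ) h1 h'
    (hK.cone hL φ), fun h1 => .of_shortExact_middle (isShortExactComplex_coneInr_coneFst φ) h1 h'
    (hK.cone hL φ)⟩

lemma isQuasiIso_iff_of_acyclic_target (hC : SupportsLongExactSequences C)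
    {K L : ChainComplex C ℤ} (φ : K ⟶ L) (hK : IsBoundedGraded K.X) (hL : IsBoundedGraded L.X)
    (h : IsAcyclic L) : IsQuasiIso φ ↔ IsAcyclic K := by
  rw [isQuasiIso_iff, ← isAcyclic_shift_iff K]
  exact ⟨fun h1 => .of_shortExact_right hC (isShortExactComplex_coneInr_coneFst φ) h h1
    (hK.cone hL φ), fun h1 => .of_shortExact_middle (isShortExactComplex_coneInr_coneFst φ) h h1
    (hK.cone hL φ)⟩

section Ladder

variable {A B D A' B' D' : ChainComplex C ℤ} {f : A ⟶ B} {g : B ⟶ D} {f' : A' ⟶ B'}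
  {g' : B' ⟶ D'} {φ : A ⟶ A'} {ψ : B ⟶ B'} {χ : D ⟶ D'}

lemma IsQuasiIso.ladder_middle (h : IsShortExactComplex f g) (h' : IsShortExactComplex f' g')
    (hf : φ ≫ f' = f ≫ ψ) (hg : ψ ≫ g' = g ≫ χ) (hB : IsBoundedGraded B.X)
    (hB' : IsBoundedGraded B'.X) (hφ : IsQuasiIso φ) (hχ : IsQuasiIso χ) : IsQuasiIso ψ := by
  rw [isQuasiIso_iff] at *
  exact .of_shortExact_middle (isShortExactComplex_coneMap h h' hf hg) hφ hχ (hB.cone hB' ψ)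

lemma IsQuasiIso.ladder_right (hC : SupportsLongExactSequences C) (h : IsShortExactComplex f g)
    (h' : IsShortExactComplex f' g') (hf : φ ≫ f' = f ≫ ψ) (hg : ψ ≫ g' = g ≫ χ)
    (hB : IsBoundedGraded B.X) (hB' : IsBoundedGraded B'.X) (hφ : IsQuasiIso φ)
    (hψ : IsQuasiIso ψ) : IsQuasiIso χ := by
  rw [isQuasiIso_iff] at *
  exact .of_shortExact_right hC (isShortExactComplex_coneMap h h' hf hg) hφ hψ (hB.cone hB' ψ)

lemma IsQuasiIso.ladder_left (hC : SupportsLongExactSequences C) (h : IsShortExactComplex f g)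
    (h' : IsShortExactComplex f' g') (hf : φ ≫ f' = f ≫ ψ) (hg : ψ ≫ g' = g ≫ χ)
    (hB : IsBoundedGraded B.X) (hB' : IsBoundedGraded B'.X) (hψ : IsQuasiIso ψ)
    (hχ : IsQuasiIso χ) : IsQuasiIso φ := by
  rw [isQuasiIso_iff] at *
  exact .of_shortExact_left hC (isShortExactComplex_coneMap h h' hf hg) hψ hχ (hB.cone hB' ψ)

end Ladder

lemma isAcyclic_zero : IsAcyclic (HomologicalComplex.zero : ChainComplex C ℤ) :=
  .of_isZero fun _ => isZero_zero C

lemma isShortExactComplex_id_zero (K : ChainComplex C ℤ) :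
    IsShortExactComplex (𝟙 K) (0 : K ⟶ HomologicalComplex.zero) :=
  fun _ => isShortExact_iso_zero (𝟙 _) _ (isZero_zero C)

lemma isShortExactComplex_zero_id (K : ChainComplex C ℤ) :
    IsShortExactComplex (0 : HomologicalComplex.zero ⟶ K) (𝟙 K) :=
  fun _ => isShortExact_zero_iso _ (𝟙 _) (isZero_zero C)

section

variable {K L R : ChainComplex C ℤ} {f : K ⟶ L} {g : L ⟶ R}

lemma IsQuasiIso.of_acyclic_kernel (hC : SupportsLongExactSequences C)
    (h : IsShortExactComplex f g) (hL : IsBoundedGraded L.X) (hK : IsAcyclic K) :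
    IsQuasiIso g := by
  have hK' : IsBoundedGraded K.X := hL.mono fun i hi => (h i).isZero_left hi
  have hR' : IsBoundedGraded R.X := hL.mono fun i hi => (h i).isZero_right hi
  exact IsQuasiIso.ladder_middle h (isShortExactComplex_zero_id R)
    (φ := (0 : K ⟶ HomologicalComplex.zero)) (χ := 𝟙 R) (by simp [h.zero]) (by simp) hL hR'
    ((isQuasiIso_iff_of_acyclic_source hC _ hK' isBoundedGraded_zero hK).2 isAcyclic_zero)
    (isQuasiIso_id R)

lemma IsQuasiIso.of_acyclic_cokernel (hC : SupportsLongExactSequences C)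
    (h : IsShortExactComplex f g) (hL : IsBoundedGraded L.X) (hR : IsAcyclic R) :
    IsQuasiIso f := by
  have hK' : IsBoundedGraded K.X := hL.mono fun i hi => (h i).isZero_left hi
  have hR' : IsBoundedGraded R.X := hL.mono fun i hi => (h i).isZero_right hi
  exact IsQuasiIso.ladder_middle (isShortExactComplex_id_zero K) h
    (φ := 𝟙 K) (χ := (0 : HomologicalComplex.zero ⟶ R)) (by simp) (by simp [h.zero]) hK' hL
    (isQuasiIso_id K)
    ((isQuasiIso_iff_of_acyclic_source hC _ isBoundedGraded_zero hR' isAcyclic_zero).2 hR)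

end

lemma isQuasiIso_of_isIso (hC : SupportsLongExactSequences C) {K L : ChainComplex C ℤ} (e : K ⟶ L)
    [IsIso e] (hK : IsBoundedGraded K.X) : IsQuasiIso e :=
  .of_acyclic_kernel hC (f := (0 : HomologicalComplex.zero ⟶ K))
    (fun _ => isShortExact_zero_iso _ _ (isZero_zero C)) hK isAcyclic_zero

lemma isShortExactComplex_inl_snd (K L : ChainComplex C ℤ) :
    IsShortExactComplex (sumC.inl K L) (sumC.snd K L) := fun _ => isShortExact_inl_snd _ _

lemma isShortExactComplex_inr_fst (K L : ChainComplex C ℤ) :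
    IsShortExactComplex (sumC.inr K L) (sumC.fst K L) := fun _ => isShortExact_inr_fst _ _

lemma IsShortExactComplex.map {A B D A' B' D' : ChainComplex C ℤ} {f : A ⟶ B} {g : B ⟶ D}
    {f' : A' ⟶ B'} {g' : B' ⟶ D'} (h : IsShortExactComplex f g) (h' : IsShortExactComplex f' g') :
    IsShortExactComplex (sumC.map f f') (sumC.map g g') := fun i => (h i).biprod_map (h' i)

/-- The triangular map `W` from `K ⊕ L` to `L ⊕ R`, with diagonal entries `φ` and `ψ` and the
identity of `L` off the diagonal, is a quasi-isomorphism. In other coordinates it is an extension of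
`𝟙 L` by `φ ≫ ψ`, so `φ ≫ ψ` is one too. -/
lemma IsQuasiIso.comp (hC : SupportsLongExactSequences C) {K L R : ChainComplex C ℤ} {φ : K ⟶ L}
    {ψ : L ⟶ R} (hK : IsBoundedGraded K.X) (hL : IsBoundedGraded L.X) (hR : IsBoundedGraded R.X)
    (hφ : IsQuasiIso φ) (hψ : IsQuasiIso ψ) : IsQuasiIso (φ ≫ ψ) := by
  let W : sumC K L ⟶ sumC L R := sumC.desc (sumC.lift φ 0) (sumC.lift (𝟙 L) ψ)
  have hW : IsQuasiIso W :=
    IsQuasiIso.ladder_middle (isShortExactComplex_inl_snd K L) (isShortExactComplex_inl_snd L R)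
      (φ := φ) (χ := ψ) (by ext i <;> simp [W]) (by ext i <;> simp [W]) (hK.biprod hL)
      (hL.biprod hR) hφ hψ
  have h1 : IsShortExactComplex (sumC.lift (𝟙 K) (-φ)) (sumC.desc φ (𝟙 L)) := fun i =>
    isShortExact_of_splitting biprod.fst biprod.inr (by simp) (by simp) (by simp)
      (by ext <;> simp)
  have h2 : IsShortExactComplex (sumC.lift (0 : R ⟶ L) (-𝟙 R)) (sumC.fst L R) := fun i =>
    isShortExact_of_splitting (-biprod.snd) biprod.inl (by simp) (by simp) (by simp)
      (by ext <;> simp)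
  exact IsQuasiIso.ladder_left hC h1 h2 (ψ := W) (χ := 𝟙 L) (by ext i <;> simp [W])
    (by ext i <;> simp [W]) (hK.biprod hL) (hL.biprod hR) hW (isQuasiIso_id L)

end QuasiIso

/-! ### Additive functors and cones -/

section Functor

variable {M : Type u₁} [Category.{v₁} M] [Preadditive M] [HasZeroObject M]
  [HasBinaryBiproducts M] [ExactCategory M]
  {N : Type u₂} [Category.{v₂} N] [Preadditive N] [HasZeroObject N]
  [HasBinaryBiproducts N] [ExactCategory N]

/-- An additive functor commutes with biproducts. -/
@[simps]
def mapBiprodIso (F : M ⥤ N) [F.Additive] (X Y : M) : F.obj (X ⊞ Y) ≅ F.obj X ⊞ F.obj Y where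
  hom := biprod.lift (F.map biprod.fst) (F.map biprod.snd)
  inv := biprod.desc (F.map biprod.inl) (F.map biprod.inr)
  hom_inv_id := by
    simp only [biprod.lift_desc, ← F.map_comp, ← F.map_add]
    simp
  inv_hom_id := by ext <;> simp [← F.map_comp]

lemma mapBiprodIso_hom_desc_lift (F : M ⥤ N) [F.Additive] {X Y X' Y' : M} (a : X ⟶ X')
    (b : X ⟶ Y') (c : Y ⟶ X') (d : Y ⟶ Y') :
    (mapBiprodIso F X Y).hom ≫
        biprod.desc (biprod.lift (F.map a) (F.map b)) (biprod.lift (F.map c) (F.map d)) =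
      F.map (biprod.desc (biprod.lift a b) (biprod.lift c d)) ≫ (mapBiprodIso F X' Y').hom := by
  rw [← cancel_epi (mapBiprodIso F X Y).inv, Iso.inv_hom_id_assoc]
  have key : ∀ {A B A' B' : M} (x : A ⟶ B) (y : B ⟶ A') (z : A' ⟶ B'),
      F.map x ≫ F.map y ≫ F.map z = F.map (x ≫ y ≫ z) := fun x y z => by
    rw [F.map_comp, F.map_comp]
  ext <;> simp [key]

lemma degZero_map (F : M ⥤ N) [F.Additive] {K L : ChainComplex M ℤ} (φ : K ⟶ L) (i j : ℤ) :
    degZero ((mapC F).map φ) i j = F.map (degZero φ i j) := by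
  by_cases h : i = j
  · subst h
    rw [degZero_self, degZero_self]
    rfl
  · rw [degZero_of_ne _ h, degZero_of_ne _ h, F.map_zero]
    rfl

/-- An additive functor commutes with the formation of cones. -/
def mapConeIso (F : M ⥤ N) [F.Additive] {K L : ChainComplex M ℤ} (φ : K ⟶ L) :
    (mapC F).obj (cone φ) ≅ cone ((mapC F).map φ) :=
  HomologicalComplex.Hom.isoOfComponents (fun i => mapBiprodIso F (K.X (i - 1)) (L.X i)) (by
    intro i j _
    refine Eq.trans ?_ (mapBiprodIso_hom_desc_lift F (-K.d (i - 1) (j - 1)) (degZero φ (i - 1) j)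
      0 (L.d i j))
    rw [F.map_neg, F.map_zero, ← degZero_map]
    rfl)

lemma IsQuasiIso.map {F : M ⥤ N} [F.Additive] (hF : IsExactFunctor F) {K L : ChainComplex M ℤ}
    {φ : K ⟶ L} (h : IsQuasiIso φ) : IsQuasiIso ((mapC F).map φ) := by
  rw [isQuasiIso_iff] at *
  exact (h.map F hF).of_iso (mapConeIso F φ)

end Functor


/-! ### Binary complexes, their cones and the degree filtration -/

namespace BinaryComplex

section

variable {C : Type u} [Category.{v} C] [Preadditive C]

@[ext]
lemma hom_ext {A B : BinaryComplex C} {f g : A ⟶ B} (h : ∀ i, Hom.f f i = Hom.f g i) : f = g :=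
  Hom.ext (funext h)

@[simp]
lemma id_f (A : BinaryComplex C) (i : ℤ) : Hom.f (𝟙 A) i = 𝟙 (A.X i) := rfl

@[simp]
lemma comp_f {A B D : BinaryComplex C} (f : A ⟶ B) (g : B ⟶ D) (i : ℤ) :
    Hom.f (f ≫ g) i = Hom.f f i ≫ Hom.f g i := rfl

@[simp]
lemma topMap_id (A : BinaryComplex C) : topMap (𝟙 A) = 𝟙 A.top := rfl

@[simp]
lemma botMap_id (A : BinaryComplex C) : botMap (𝟙 A) = 𝟙 A.bot := rfl

@[simp]
lemma topMap_comp {A B D : BinaryComplex C} (f : A ⟶ B) (g : B ⟶ D) :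
    topMap (f ≫ g) = topMap f ≫ topMap g := rfl

@[simp]
lemma botMap_comp {A B D : BinaryComplex C} (f : A ⟶ B) (g : B ⟶ D) :
    botMap (f ≫ g) = botMap f ≫ botMap g := rfl

/-- A graded map which commutes with both differentials. -/
abbrev homMk {A B : BinaryComplex C} (f : ∀ i, A.X i ⟶ B.X i)
    (h : ∀ i j, f i ≫ B.d i j = A.d i j ≫ f j)
    (h' : ∀ i j, f i ≫ B.d' i j = A.d' i j ≫ f j) : A ⟶ B :=
  (⟨f, h, h'⟩ : Hom A B)

/-- The binary complex with two given chain complexes, whose underlying graded objects agree, as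
top and bottom. -/
abbrev mk₂ {X : ℤ → C} (d d' : ∀ i j, X i ⟶ X j)
    (s : ∀ i j, ¬ (ComplexShape.down ℤ).Rel i j → d i j = 0)
    (s' : ∀ i j, ¬ (ComplexShape.down ℤ).Rel i j → d' i j = 0)
    (h : ∀ i j k, d i j ≫ d j k = 0) (h' : ∀ i j k, d' i j ≫ d' j k = 0) : BinaryComplex C :=
  ⟨X, d, d', s, s', h, h'⟩

lemma eq_diag_of_d_eq (B : BinaryComplex C) (h : B.d = B.d') : B = diag B.top := by
  obtain ⟨X, d, d', s, s', h₁, h₂⟩ := B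
  obtain rfl : d = d' := h
  rfl

lemma isIso_of_components {A B : BinaryComplex C} (f : A ⟶ B) [∀ i, IsIso (Hom.f f i)] :
    IsIso f :=
  ⟨homMk (fun i => inv (Hom.f f i)) (fun i j => by simp [Hom.comm f])
    (fun i j => by simp [Hom.comm' f]), by ext i; simp, by ext i; simp⟩

instance isIso_f {A B : BinaryComplex C} (f : A ⟶ B) [IsIso f] (i : ℤ) : IsIso (Hom.f f i) :=
  ⟨Hom.f (inv f) i, by rw [← comp_f, IsIso.hom_inv_id, id_f],
    by rw [← comp_f, IsIso.inv_hom_id, id_f]⟩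

/-- The binary complex with the two differentials exchanged. -/
@[simps]
abbrev swap (A : BinaryComplex C) : BinaryComplex C where
  X := A.X
  d := A.d'
  d' := A.d
  shape := A.shape'
  shape' := A.shape
  d_comp_d := A.d'_comp_d'
  d'_comp_d' := A.d_comp_d

instance (A B : BinaryComplex C) : Zero (A ⟶ B) := ⟨homMk (fun _ => 0) (by simp) (by simp)⟩

@[simp]
lemma zero_f (A B : BinaryComplex C) (i : ℤ) : Hom.f (0 : A ⟶ B) i = 0 := rfl

@[simp]
lemma topMap_zero (A B : BinaryComplex C) : topMap (0 : A ⟶ B) = 0 := rfl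

@[simp]
lemma botMap_zero (A B : BinaryComplex C) : botMap (0 : A ⟶ B) = 0 := rfl

variable [HasBinaryBiproducts C]

/-- The direct sum of two binary complexes. -/
@[simps]
abbrev sum (A B : BinaryComplex C) : BinaryComplex C where
  X i := A.X i ⊞ B.X i
  d i j := biprod.map (A.d i j) (B.d i j)
  d' i j := biprod.map (A.d' i j) (B.d' i j)
  shape := (sumC A.top B.top).shape
  shape' := (sumC A.bot B.bot).shape
  d_comp_d := (sumC A.top B.top).d_comp_d
  d'_comp_d' := (sumC A.bot B.bot).d_comp_d

/-- The first inclusion. -/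
abbrev inl (A B : BinaryComplex C) : A ⟶ sum A B :=
  homMk (fun _ => biprod.inl) (by simp) (by simp)

/-- The second inclusion. -/
abbrev inr (A B : BinaryComplex C) : B ⟶ sum A B :=
  homMk (fun _ => biprod.inr) (by simp) (by simp)

/-- The first projection. -/
abbrev fst (A B : BinaryComplex C) : sum A B ⟶ A :=
  homMk (fun _ => biprod.fst) (by simp) (by simp)

/-- The second projection. -/
abbrev snd (A B : BinaryComplex C) : sum A B ⟶ B :=
  homMk (fun _ => biprod.snd) (by simp) (by simp)

/-- The binary mapping cone of a pair of maps. -/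
abbrev cone {A D : BinaryComplex C} (f₁ : A.top ⟶ D.top) (f₂ : A.bot ⟶ D.bot) :
    BinaryComplex C where
  X i := A.X (i - 1) ⊞ D.X i
  d := (RelK.cone f₁).d
  d' := (RelK.cone f₂).d
  shape := (RelK.cone f₁).shape
  shape' := (RelK.cone f₂).shape
  d_comp_d := (RelK.cone f₁).d_comp_d
  d'_comp_d' := (RelK.cone f₂).d_comp_d

/-- The map of binary cones induced by a commutative square. -/
abbrev coneMap {A D A' D' : BinaryComplex C} {f₁ : A.top ⟶ D.top} {f₂ : A.bot ⟶ D.bot}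
    {f₁' : A'.top ⟶ D'.top} {f₂' : A'.bot ⟶ D'.bot} (s : A ⟶ A') (t : D ⟶ D')
    (h₁ : f₁ ≫ topMap t = topMap s ≫ f₁') (h₂ : f₂ ≫ botMap t = botMap s ≫ f₂') :
    cone f₁ f₂ ⟶ cone f₁' f₂' :=
  homMk (fun i => biprod.map (Hom.f s (i - 1)) (Hom.f t i))
    (RelK.coneMap (topMap s) (topMap t) h₁).comm (RelK.coneMap (botMap s) (botMap t) h₂).comm

/-- The inclusion of the target into the binary cone. -/
abbrev coneInr {A D : BinaryComplex C} (f₁ : A.top ⟶ D.top) (f₂ : A.bot ⟶ D.bot) :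
    D ⟶ cone f₁ f₂ :=
  homMk (fun _ => biprod.inr) (RelK.coneInr f₁).comm (RelK.coneInr f₂).comm

end

section Exact

variable {C : Type u} [Category.{v} C] [Preadditive C] [HasZeroObject C]
  [HasBinaryBiproducts C] [ExactCategory C]

/-- The zero binary complex. -/
abbrev zero : BinaryComplex C := diag HomologicalComplex.zero

lemma isBoundedGraded_zero : IsBoundedGraded (zero : BinaryComplex C).X :=
  RelK.isBoundedGraded_zero

lemma isShortExactBinary_inl_snd (A B : BinaryComplex C) :
    IsShortExactBinary (inl A B) (snd A B) := fun _ => isShortExact_inl_snd _ _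

lemma isShortExactBinary_iso_zero {A B Z : BinaryComplex C} (e : A ⟶ B) (q : B ⟶ Z)
    [∀ i, IsIso (Hom.f e i)] (hZ : ∀ i, IsZero (Z.X i)) : IsShortExactBinary e q :=
  fun i => isShortExact_iso_zero _ _ (hZ i)

lemma isShortExactBinary_zero_iso {A B Z : BinaryComplex C} (q : Z ⟶ A) (e : A ⟶ B)
    [∀ i, IsIso (Hom.f e i)] (hZ : ∀ i, IsZero (Z.X i)) : IsShortExactBinary q e :=
  fun i => isShortExact_zero_iso _ _ (hZ i)

lemma IsShortExactBinary.top {A B D : BinaryComplex C} {f : A ⟶ B} {g : B ⟶ D}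
    (h : IsShortExactBinary f g) : IsShortExactComplex (topMap f) (topMap g) := h

lemma IsShortExactBinary.bot {A B D : BinaryComplex C} {f : A ⟶ B} {g : B ⟶ D}
    (h : IsShortExactBinary f g) : IsShortExactComplex (botMap f) (botMap g) := h

lemma isShortExactBinary_coneMap {A B D A' B' D' : BinaryComplex C} {s : A ⟶ B} {t : B ⟶ D}
    {s' : A' ⟶ B'} {t' : B' ⟶ D'} {φ₁ : A.top ⟶ A'.top} {φ₂ : A.bot ⟶ A'.bot}
    {ψ₁ : B.top ⟶ B'.top} {ψ₂ : B.bot ⟶ B'.bot} {χ₁ : D.top ⟶ D'.top} {χ₂ : D.bot ⟶ D'.bot}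
    (h : IsShortExactBinary s t) (h' : IsShortExactBinary s' t')
    (hs₁ : φ₁ ≫ topMap s' = topMap s ≫ ψ₁) (hs₂ : φ₂ ≫ botMap s' = botMap s ≫ ψ₂)
    (ht₁ : ψ₁ ≫ topMap t' = topMap t ≫ χ₁) (ht₂ : ψ₂ ≫ botMap t' = botMap t ≫ χ₂) :
    IsShortExactBinary (coneMap s s' hs₁ hs₂) (coneMap t t' ht₁ ht₂) :=
  fun i => (h (i - 1)).biprod_map (h' i)

/-- Every graded object is the direct sum of its part in degrees at most `a` and its part in
degrees greater than `a`. -/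
lemma exists_decomposition (X : ℤ → C) (a i : ℤ) : ∃ (A Q : C) (ι : A ⟶ X i) (r : X i ⟶ A)
    (π : X i ⟶ Q) (s : Q ⟶ X i), ι ≫ r = 𝟙 A ∧ s ≫ π = 𝟙 Q ∧ ι ≫ π = 0 ∧
      r ≫ ι + π ≫ s = 𝟙 (X i) ∧ (a < i → IsZero A) ∧ (i ≤ a → IsZero Q) ∧
      (IsZero (X i) → IsZero A ∧ IsZero Q) := by
  by_cases h : i ≤ a
  · exact ⟨X i, 0, 𝟙 _, 𝟙 _, 0, 0, by simp, (isZero_zero C).eq_of_src _ _, by simp, by simp,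
      fun h' => by omega, fun _ => isZero_zero C, fun h => ⟨h, isZero_zero C⟩⟩
  · exact ⟨0, X i, 0, 0, 𝟙 _, 𝟙 _, (isZero_zero C).eq_of_src _ _, by simp, by simp, by simp,
      fun _ => isZero_zero C, fun h' => absurd h' h, fun h => ⟨isZero_zero C, h⟩⟩

/-- The short exact sequence of binary complexes given by the part in degrees at most `a`. -/
lemma exists_filtration (B : BinaryComplex C) (a : ℤ) :
    ∃ (A Q : BinaryComplex C) (f : A ⟶ B) (g : B ⟶ Q), IsShortExactBinary f g ∧
      (∀ i, a < i → IsZero (A.X i)) ∧ (∀ i ≤ a, IsZero (Q.X i)) ∧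
      (∀ i, IsZero (B.X i) → IsZero (A.X i) ∧ IsZero (Q.X i)) := by
  choose A Q ι r π s hr hs w h hA hQ hz using exists_decomposition B.X a
  -- A differential lowers degrees, so it cannot lead from degrees at most `a` to degrees above `a`;
  -- the lower part is therefore a subcomplex for both differentials at once.
  have key : ∀ (d : ∀ i j, B.X i ⟶ B.X j)
      (_ : ∀ i j, ¬ (ComplexShape.down ℤ).Rel i j → d i j = 0) (i j : ℤ),
      ι i ≫ d i j ≫ π j = 0 := by
    intro d hd i j
    by_cases hij : (ComplexShape.down ℤ).Rel i j
    · by_cases hi : i ≤ a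
      · have : j + 1 = i := by simpa using hij
        exact (hQ j (by omega)).eq_of_tgt _ _
      · exact (hA i (by omega)).eq_of_src _ _
    · simp [hd i j hij]
  have hι : ∀ (d : ∀ i j, B.X i ⟶ B.X j)
      (_ : ∀ i j, ¬ (ComplexShape.down ℤ).Rel i j → d i j = 0) (i j : ℤ),
      (ι i ≫ d i j ≫ r j) ≫ ι j = ι i ≫ d i j := by
    intro d hd i j
    calc (ι i ≫ d i j ≫ r j) ≫ ι j = ι i ≫ d i j ≫ (r j ≫ ι j + π j ≫ s j) - 
          (ι i ≫ d i j ≫ π j) ≫ s j := by simp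
      _ = ι i ≫ d i j := by rw [h, key d hd]; simp
  have hπ : ∀ (d : ∀ i j, B.X i ⟶ B.X j)
      (_ : ∀ i j, ¬ (ComplexShape.down ℤ).Rel i j → d i j = 0) (i j : ℤ),
      π i ≫ (s i ≫ d i j ≫ π j) = d i j ≫ π j := by
    intro d hd i j
    calc π i ≫ (s i ≫ d i j ≫ π j) = (r i ≫ ι i + π i ≫ s i) ≫ d i j ≫ π j - 
          r i ≫ (ι i ≫ d i j ≫ π j) := by simp
      _ = d i j ≫ π j := by rw [h, key d hd]; simp
  have hιd : ∀ (d : ∀ i j, B.X i ⟶ B.X j)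
      (_ : ∀ i j, ¬ (ComplexShape.down ℤ).Rel i j → d i j = 0) (_ : ∀ i j k, d i j ≫ d j k = 0)
      (i j k : ℤ), (ι i ≫ d i j ≫ r j) ≫ (ι j ≫ d j k ≫ r k) = 0 := by
    intro d hd hd2 i j k
    rw [← Category.assoc, hι d hd, Category.assoc, ← Category.assoc (d i j), hd2]; simp
  have hπd : ∀ (d : ∀ i j, B.X i ⟶ B.X j)
      (_ : ∀ i j, ¬ (ComplexShape.down ℤ).Rel i j → d i j = 0) (_ : ∀ i j k, d i j ≫ d j k = 0)
      (i j k : ℤ), (s i ≫ d i j ≫ π j) ≫ (s j ≫ d j k ≫ π k) = 0 := by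
    intro d hd hd2 i j k
    rw [Category.assoc, Category.assoc, hπ d hd, ← Category.assoc (d i j), hd2]; simp
  refine ⟨mk₂ (fun i j => ι i ≫ B.d i j ≫ r j) (fun i j => ι i ≫ B.d' i j ≫ r j)
      (fun i j hij => by simp [B.shape i j hij]) (fun i j hij => by simp [B.shape' i j hij])
      (hιd _ B.shape B.d_comp_d) (hιd _ B.shape' B.d'_comp_d'),
    mk₂ (fun i j => s i ≫ B.d i j ≫ π j) (fun i j => s i ≫ B.d' i j ≫ π j)
      (fun i j hij => by simp [B.shape i j hij]) (fun i j hij => by simp [B.shape' i j hij])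
      (hπd _ B.shape B.d_comp_d) (hπd _ B.shape' B.d'_comp_d'),
    homMk ι (fun i j => (hι _ B.shape i j).symm) (fun i j => (hι _ B.shape' i j).symm),
    homMk π (hπ _ B.shape) (hπ _ B.shape'),
    fun i => isShortExact_of_splitting (r i) (s i) (hr i) (hs i) (w i) (h i), hA, hQ, hz⟩

/-- An additive function on bounded binary complexes which vanishes on the diagonal ones is
zero. -/
lemma eq_zero_of_additive {G : Type*} [AddCommGroup G]
    (φ : ∀ B : BinaryComplex C, IsBoundedGraded B.X → G)
    (hadd : ∀ {X Y Z : BinaryComplex C} (hX : IsBoundedGraded X.X) (hY : IsBoundedGraded Y.X)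
      (hZ : IsBoundedGraded Z.X) (f : X ⟶ Y) (g : Y ⟶ Z), IsShortExactBinary f g →
        φ Y hY = φ X hX + φ Z hZ)
    (hdiag : ∀ (K : ChainComplex C ℤ) (hK : IsBoundedGraded K.X), φ (diag K) hK = 0)
    (B : BinaryComplex C) (hB : IsBoundedGraded B.X) : φ B hB = 0 := by
  have diag' : ∀ (B : BinaryComplex C) (hB : IsBoundedGraded B.X), B.d = B.d' → φ B hB = 0 := by
    intro B hB h
    have e : ∀ B' (_ : B = B') (hB' : IsBoundedGraded B'.X), φ B hB = φ B' hB' := by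
      rintro _ rfl _; rfl
    exact (e _ (eq_diag_of_d_eq B h) hB).trans (hdiag B.top hB)
  -- Induction on the number `n` of degrees that may be nonzero. The part in the lowest degree `a`
  -- is a subobject whose two differentials both vanish, hence diagonal.
  have key : ∀ (n : ℕ) (a : ℤ) (B : BinaryComplex C) (hB : IsBoundedGraded B.X),
      (∀ i, (i < a ∨ a + n ≤ i) → IsZero (B.X i)) → φ B hB = 0 := by
    intro n
    induction n with
    | zero =>
      intro a B hB h
      refine diag' B hB ?_
      ext i j
      exact (h i (by omega)).eq_of_src _ _
    | succ n ih =>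
      intro a B hB h
      obtain ⟨A, Q, f, g, hfg, hA, hQ, hz⟩ := B.exists_filtration a
      rw [hadd (hB.mono fun i hi => (hz i hi).1) hB (hB.mono fun i hi => (hz i hi).2) f g hfg,
        diag' A, ih (a + 1) Q, zero_add]
      · intro i hi
        by_cases hi' : i < a + 1
        · exact hQ i (by omega)
        · exact (hz i (h i (by push_cast; omega))).2
      · ext i j
        by_cases hi : a < i
        · exact (hA i hi).eq_of_src _ _
        · by_cases hij : (ComplexShape.down ℤ).Rel i j
          · have : j + 1 = i := by simpa using hij
            exact (hz j (h j (by omega))).1.eq_of_tgt _ _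
          · rw [A.shape i j hij, A.shape' i j hij]
  have hB' := hB
  obtain ⟨a, b, h⟩ := hB
  exact key (b - a + 1).toNat a B hB' fun i hi => h i (by omega)

end Exact

end BinaryComplex


/-! ### Classes of binary cones in `K₁` -/

section K1Cone

variable {C : Type u} [Category.{v} C] [Preadditive C] [HasZeroObject C]
  [HasBinaryBiproducts C] [ExactCategory C]

lemma K1.cls_add {X Y Z : AcyclicBinaryComplex C} (f : X.cx ⟶ Y.cx) (g : Y.cx ⟶ Z.cx)
    (h : BinaryComplex.IsShortExactBinary f g) : K1.cls Y = K1.cls X + K1.cls Z := by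
  rw [← sub_eq_zero, ← sub_sub]
  exact (QuotientAddGroup.eq_zero_iff _).2
    (AddSubgroup.subset_closure (Or.inl ⟨X, Y, Z, f, g, h, rfl⟩))

lemma K1.cls_diag (K : ChainComplex C ℤ) (hb : IsBoundedGraded K.X) (ha : IsAcyclic K) :
    K1.cls (AcyclicBinaryComplex.diag K hb ha) = 0 :=
  (QuotientAddGroup.eq_zero_iff _).2 (AddSubgroup.subset_closure (Or.inr ⟨K, hb, ha, rfl⟩))

lemma K1.cls_of_d_eq (Y : AcyclicBinaryComplex C) (h : Y.cx.d = Y.cx.d') : K1.cls Y = 0 := by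
  have := K1.cls_diag Y.cx.top Y.bounded Y.acyclic_top
  have e : Y = AcyclicBinaryComplex.diag Y.cx.top Y.bounded Y.acyclic_top := by
    obtain ⟨⟨X, d, d', _, _, _, _⟩, hb, h1, h2⟩ := Y
    obtain rfl : d = d' := h
    rfl
  rw [e, this]

lemma K1.cls_of_isZero (Y : AcyclicBinaryComplex C) (h : ∀ i, IsZero (Y.cx.X i)) :
    K1.cls Y = 0 :=
  K1.cls_of_d_eq Y (by ext i j; exact (h i).eq_of_src _ _)

/-- The zero acyclic binary complex. -/
def AcyclicBinaryComplex.zero : AcyclicBinaryComplex C :=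
  .diag HomologicalComplex.zero isBoundedGraded_zero isAcyclic_zero

lemma K1.cls_of_isIso {X Y : AcyclicBinaryComplex C} (f : X.cx ⟶ Y.cx)
    [∀ i, IsIso (BinaryComplex.Hom.f f i)] : K1.cls X = K1.cls Y := by
  have := K1.cls_add (Z := .zero) f 0
    (BinaryComplex.isShortExactBinary_iso_zero f 0 fun _ => isZero_zero C)
  rw [this, K1.cls_of_isZero AcyclicBinaryComplex.zero fun _ => isZero_zero C, add_zero]

/-- The class in `K₁` of the binary cone of a pair of quasi-isomorphisms. -/
def coneCls {A D : BinaryComplex C} (hA : IsBoundedGraded A.X) (hD : IsBoundedGraded D.X)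
    {f₁ : A.top ⟶ D.top} {f₂ : A.bot ⟶ D.bot} (h₁ : IsQuasiIso f₁) (h₂ : IsQuasiIso f₂) : K1 C :=
  K1.cls
    { cx := BinaryComplex.cone f₁ f₂
      bounded := hA.shift.biprod hD
      acyclic_top := (isQuasiIso_iff f₁).1 h₁
      acyclic_bot := (isQuasiIso_iff f₂).1 h₂ }

section

variable {A B D A' B' D' : BinaryComplex C} {s : A ⟶ B} {t : B ⟶ D} {s' : A' ⟶ B'} {t' : B' ⟶ D'}
  {φ₁ : A.top ⟶ A'.top} {φ₂ : A.bot ⟶ A'.bot} {ψ₁ : B.top ⟶ B'.top} {ψ₂ : B.bot ⟶ B'.bot}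
  {χ₁ : D.top ⟶ D'.top} {χ₂ : D.bot ⟶ D'.bot}

lemma coneCls_add (h : BinaryComplex.IsShortExactBinary s t)
    (h' : BinaryComplex.IsShortExactBinary s' t')
    (hs₁ : φ₁ ≫ BinaryComplex.topMap s' = BinaryComplex.topMap s ≫ ψ₁)
    (hs₂ : φ₂ ≫ BinaryComplex.botMap s' = BinaryComplex.botMap s ≫ ψ₂)
    (ht₁ : ψ₁ ≫ BinaryComplex.topMap t' = BinaryComplex.topMap t ≫ χ₁)
    (ht₂ : ψ₂ ≫ BinaryComplex.botMap t' = BinaryComplex.botMap t ≫ χ₂)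
    (hA : IsBoundedGraded A.X) (hB : IsBoundedGraded B.X) (hD : IsBoundedGraded D.X)
    (hA' : IsBoundedGraded A'.X) (hB' : IsBoundedGraded B'.X) (hD' : IsBoundedGraded D'.X)
    (q₁ : IsQuasiIso φ₁) (q₂ : IsQuasiIso φ₂) (r₁ : IsQuasiIso ψ₁) (r₂ : IsQuasiIso ψ₂)
    (x₁ : IsQuasiIso χ₁) (x₂ : IsQuasiIso χ₂) :
    coneCls hB hB' r₁ r₂ = coneCls hA hA' q₁ q₂ + coneCls hD hD' x₁ x₂ :=
  K1.cls_add _ _ (BinaryComplex.isShortExactBinary_coneMap h h' hs₁ hs₂ ht₁ ht₂)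

end

/-- The class is additive in `A`, and for diagonal `A` the cone is itself diagonal. That `A` need
not be acyclic is what makes the degree filtration applicable. -/
lemma coneCls_id {A : BinaryComplex C} (hA : IsBoundedGraded A.X) :
    coneCls hA hA (isQuasiIso_id A.top) (isQuasiIso_id A.bot) = 0 := by
  refine BinaryComplex.eq_zero_of_additive
    (fun A hA => coneCls hA hA (isQuasiIso_id A.top) (isQuasiIso_id A.bot)) ?_ ?_ A hA
  · intro X Y Z hX hY hZ f g h
    exact coneCls_add h h (by simp) (by simp) (by simp) (by simp) _ _ _ _ _ _ _ _ _ _ _ _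
  · intro K hK
    exact K1.cls_of_d_eq _ rfl

lemma coneCls_of_source_isZero {A D : BinaryComplex C} (hA : IsBoundedGraded A.X)
    (hD : IsBoundedGraded D.X) {f₁ : A.top ⟶ D.top} {f₂ : A.bot ⟶ D.bot} (h₁ : IsQuasiIso f₁)
    (h₂ : IsQuasiIso f₂) (h : ∀ i, IsZero (A.X i)) (d₁ : IsAcyclic D.top) (d₂ : IsAcyclic D.bot) :
    coneCls hA hD h₁ h₂ = K1.cls ⟨D, hD, d₁, d₂⟩ := by
  have : ∀ i, IsIso (BinaryComplex.Hom.f (BinaryComplex.coneInr f₁ f₂) i) := fun i =>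
    ⟨biprod.snd, by simp, by ext; exacts [(h _).eq_of_src _ _, by simp, by simp, by simp]⟩
  exact (K1.cls_of_isIso (X := ⟨D, hD, d₁, d₂⟩) (BinaryComplex.coneInr f₁ f₂)).symm

/-- The arrows `0 ⟶ A`, `𝟙 A` and `A ⟶ D` form a short exact sequence, and the class of the middle
one vanishes by `coneCls_id`. -/
lemma coneCls_of_target_isZero (hC : SupportsLongExactSequences C) {A D : BinaryComplex C}
    (hA : IsBoundedGraded A.X) (hD : IsBoundedGraded D.X) {f₁ : A.top ⟶ D.top}
    {f₂ : A.bot ⟶ D.bot} (h₁ : IsQuasiIso f₁) (h₂ : IsQuasiIso f₂) (h : ∀ i, IsZero (D.X i))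
    (a₁ : IsAcyclic A.top) (a₂ : IsAcyclic A.bot) :
    coneCls hA hD h₁ h₂ = -K1.cls ⟨A, hA, a₁, a₂⟩ := by
  have z₁ : IsQuasiIso (0 : (BinaryComplex.zero (C := C)).top ⟶ A.top) :=
    (isQuasiIso_iff_of_acyclic_source hC _ isBoundedGraded_zero hA isAcyclic_zero).2 a₁
  have z₂ : IsQuasiIso (0 : (BinaryComplex.zero (C := C)).bot ⟶ A.bot) :=
    (isQuasiIso_iff_of_acyclic_source hC _ isBoundedGraded_zero hA isAcyclic_zero).2 a₂
  have e₁ := BinaryComplex.isShortExactBinary_zero_iso (0 : BinaryComplex.zero ⟶ A) (𝟙 A)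
    fun _ => isZero_zero C
  have e₂ := BinaryComplex.isShortExactBinary_iso_zero (𝟙 A) (0 : A ⟶ D) h
  have := coneCls_add (φ₁ := 0) (φ₂ := 0) (ψ₁ := 𝟙 A.top) (ψ₂ := 𝟙 A.bot) (χ₁ := f₁) (χ₂ := f₂)
    e₁ e₂ (by simp) (by simp) (by ext i; exact (h i).eq_of_tgt _ _)
    (by ext i; exact (h i).eq_of_tgt _ _) BinaryComplex.isBoundedGraded_zero hA hA hA hA hD z₁ z₂
    (isQuasiIso_id _) (isQuasiIso_id _) h₁ h₂
  rw [coneCls_id, coneCls_of_source_isZero BinaryComplex.isBoundedGraded_zero hA z₁ z₂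
    (fun _ => isZero_zero C) a₁ a₂] at this
  rw [eq_neg_iff_add_eq_zero, add_comm, ← this]

end K1Cone


/-! ### Quasi-isomorphisms out of cones -/

section ConeLemmas

variable {C : Type u} [Category.{v} C] [Preadditive C] [HasZeroObject C]
  [HasBinaryBiproducts C] [ExactCategory C]

lemma IsShortExact.biprod_map_id_snd {X Y Z : C} {f : X ⟶ Y} {g : Y ⟶ Z} (h : IsShortExact f g)
    (W : C) : IsShortExact (biprod.map (𝟙 W) f) (biprod.snd ≫ g) :=
  ((isShortExact_iso_zero (𝟙 W) 0 (isZero_zero C)).biprod_map h).of_iso (Iso.refl _) (Iso.refl _)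
    ⟨biprod.snd, biprod.inr, by ext; simp, by simp⟩ (by simp) (by simp)

/-- The map from a cone onto the cokernel of the inclusion of a subcomplex of the target is a
quasi-isomorphism if the source is quasi-isomorphic to that subcomplex. -/
lemma IsQuasiIso.coneDesc (hC : SupportsLongExactSequences C) {K L L' R : ChainComplex C ℤ}
    {φ : K ⟶ L} {φ' : K ⟶ L'} {x : L ⟶ L'} {y : L' ⟶ R} (h : IsShortExactComplex x y)
    (hφ : φ ≫ x = φ') (w : φ' ≫ y = 0) (hK : IsBoundedGraded K.X) (hL' : IsBoundedGraded L'.X)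
    (q : IsQuasiIso φ) : IsQuasiIso (coneDesc y w) :=
  -- The kernel is the cone of `φ`, which is acyclic.
  .of_acyclic_kernel hC (f := coneMap (𝟙 K) x (by simpa using hφ))
    (fun i => (h i).biprod_map_id_snd _) (hK.cone hL' φ') ((isQuasiIso_iff φ).1 q)

end ConeLemmas

/-! ### Binary complexes over an object of `B[F]` and their values -/

section Relative

variable {M : Type u₁} [Category.{v₁} M] [Preadditive M] [HasZeroObject M]
  [HasBinaryBiproducts M] [ExactCategory M]
  {N : Type u₂} [Category.{v₂} N] [Preadditive N] [HasZeroObject N]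
  [HasBinaryBiproducts N] [ExactCategory N]

/-- The map of binary complexes induced by an additive functor. -/
@[simps]
def BinaryComplex.mapHom (F : M ⥤ N) [F.Additive] {A B : BinaryComplex M} (s : A ⟶ B) :
    A.map F ⟶ B.map F where
  f i := F.map (BinaryComplex.Hom.f s i)
  comm i j := ((mapC F).map (BinaryComplex.topMap s)).comm i j
  comm' i j := ((mapC F).map (BinaryComplex.botMap s)).comm i j

lemma BinaryComplex.IsShortExactBinary.map {F : M ⥤ N} [F.Additive] (hF : IsExactFunctor F)
    {A B D : BinaryComplex M} {s : A ⟶ B} {t : B ⟶ D} (h : IsShortExactBinary s t) :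
    IsShortExactBinary (mapHom F s) (mapHom F t) := fun i => hF _ _ (h i)

variable (F : M ⥤ N) [F.Additive] (hF : IsExactFunctor F)

/-- The map on `K₁` induced by an exact functor. -/
def K1.map : K1 M →+ K1 N :=
  QuotientAddGroup.lift (AddSubgroup.closure (K1Relations M))
    (FreeAbelianGroup.lift fun X => K1.cls (X.map F hF)) (by
      rw [AddSubgroup.closure_le]
      rintro r (⟨X, Y, Z, f, g, h, rfl⟩ | ⟨K, hb, ha, rfl⟩)
      · simp only [SetLike.mem_coe, AddMonoidHom.mem_ker, map_sub, FreeAbelianGroup.lift_apply_of]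
        rw [sub_sub, sub_eq_zero]
        exact K1.cls_add (X := X.map F hF) (Z := Z.map F hF) (BinaryComplex.mapHom F f)
          (BinaryComplex.mapHom F g) (h.map hF)
      · simp only [SetLike.mem_coe, AddMonoidHom.mem_ker, FreeAbelianGroup.lift_apply_of]
        exact K1.cls_of_d_eq _ rfl)

@[simp]
lemma K1.map_cls (X : AcyclicBinaryComplex M) :
    K1.map F hF (K1.cls X) = K1.cls (X.map F hF) :=
  (QuotientAddGroup.lift_mk' _ _ _).trans (FreeAbelianGroup.lift_apply_of _ _)

/-- The cokernel of the map induced by `F` on `K₁`. -/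
abbrev K1Coker : Type _ := K1 N ⧸ (K1.map F hF).range

variable {F}

/-- A binary complex `B` of `M` with quasi-isomorphisms from its top and bottom to the sources of
an object of `B[F]`. -/
structure Over (X : RelBinary F) where
  B : BinaryComplex M
  bounded : IsBoundedGraded B.X
  a : B.top ⟶ X.srcTop
  b : B.bot ⟶ X.srcBot
  qa : IsQuasiIso a
  qb : IsQuasiIso b

namespace Over

variable {X Y Z : RelBinary F}

/-- The composite map to the top of the target. -/
abbrev compTop (o : Over X) : (o.B.map F).top ⟶ X.tar.top := (mapC F).map o.a ≫ X.compTop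

/-- The composite map to the bottom of the target. -/
abbrev compBot (o : Over X) : (o.B.map F).bot ⟶ X.tar.bot := (mapC F).map o.b ≫ X.compBot

lemma compTop_quasiIso (hN : SupportsLongExactSequences N) (hF : IsExactFunctor F) (o : Over X) :
    IsQuasiIso o.compTop :=
  (o.qa.map hF).comp hN (o.bounded.map F) (X.srcTop_bounded.map F) X.tar_bounded
    X.compTop_quasiIso

lemma compBot_quasiIso (hN : SupportsLongExactSequences N) (hF : IsExactFunctor F) (o : Over X) :
    IsQuasiIso o.compBot :=
  (o.qb.map hF).comp hN (o.bounded.map F) (X.srcBot_bounded.map F) X.tar_bounded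
    X.compBot_quasiIso

/-- The class of the binary cone of the composite maps to the target. -/
def val (hN : SupportsLongExactSequences N) (hF : IsExactFunctor F) (o : Over X) : K1 N :=
  coneCls (o.bounded.map F) X.tar_bounded (o.compTop_quasiIso hN hF) (o.compBot_quasiIso hN hF)

/-- The class of `Over.val` modulo the image of `K₁ M`. -/
def gval (hN : SupportsLongExactSequences N) (hF : IsExactFunctor F) (o : Over X) :
    K1Coker F hF := QuotientAddGroup.mk (o.val hN hF)

variable (hN : SupportsLongExactSequences N) (hF : IsExactFunctor F)

/-- Additivity is immediate when the complexes over the three terms themselves form a short exact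
sequence; the cylinders below reduce the general case to this one. -/
lemma gval_add {f : RelBinary.Hom X Y} {g : RelBinary.Hom Y Z}
    (h : RelBinary.IsShortExactRel f g) (oX : Over X) (oY : Over Y) (oZ : Over Z)
    {s : oX.B ⟶ oY.B} {t : oY.B ⟶ oZ.B} (hst : BinaryComplex.IsShortExactBinary s t)
    (hs₁ : BinaryComplex.topMap s ≫ oY.a = oX.a ≫ f.srcTop)
    (hs₂ : BinaryComplex.botMap s ≫ oY.b = oX.b ≫ f.srcBot)
    (ht₁ : BinaryComplex.topMap t ≫ oZ.a = oY.a ≫ g.srcTop)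
    (ht₂ : BinaryComplex.botMap t ≫ oZ.b = oY.b ≫ g.srcBot) :
    oY.gval hN hF = oX.gval hN hF + oZ.gval hN hF := by
  have key : oY.val hN hF = oX.val hN hF + oZ.val hN hF := by
    refine coneCls_add (hst.map hF) h.2.2 ?_ ?_ ?_ ?_ _ _ _ _ _ _ _ _ _ _ _ _
    · change ((mapC F).map oX.a ≫ X.compTop) ≫ BinaryComplex.topMap f.tar =
        (mapC F).map (BinaryComplex.topMap s) ≫ (mapC F).map oY.a ≫ Y.compTop
      rw [← Functor.map_comp_assoc, hs₁, Functor.map_comp, Category.assoc, Category.assoc,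
        f.comm_top]
    · change ((mapC F).map oX.b ≫ X.compBot) ≫ BinaryComplex.botMap f.tar =
        (mapC F).map (BinaryComplex.botMap s) ≫ (mapC F).map oY.b ≫ Y.compBot
      rw [← Functor.map_comp_assoc, hs₂, Functor.map_comp, Category.assoc, Category.assoc,
        f.comm_bot]
    · change ((mapC F).map oY.a ≫ Y.compTop) ≫ BinaryComplex.topMap g.tar =
        (mapC F).map (BinaryComplex.topMap t) ≫ (mapC F).map oZ.a ≫ Z.compTop
      rw [← Functor.map_comp_assoc, ht₁, Functor.map_comp, Category.assoc, Category.assoc,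
        g.comm_top]
    · change ((mapC F).map oY.b ≫ Y.compBot) ≫ BinaryComplex.botMap g.tar =
        (mapC F).map (BinaryComplex.botMap t) ≫ (mapC F).map oZ.b ≫ Z.compBot
      rw [← Functor.map_comp_assoc, ht₂, Functor.map_comp, Category.assoc, Category.assoc,
        g.comm_bot]
  rw [gval, key]; rfl

/-- This is why values are taken modulo the image of `K₁ M`: a complex over a zero object is an
acyclic binary complex of `M`, and its cone class is minus the image of its class in `K₁ M`. -/
lemma gval_of_isZero (hM : SupportsLongExactSequences M) (o : Over X)
    (h₁ : ∀ i, IsZero (X.srcTop.X i)) (h₂ : ∀ i, IsZero (X.srcBot.X i))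
    (h : ∀ i, IsZero (X.tar.X i)) : o.gval hN hF = 0 := by
  have a₁ : IsAcyclic o.B.top := (isQuasiIso_iff_of_acyclic_target hM o.a o.bounded
    X.srcTop_bounded (.of_isZero h₁)).1 o.qa
  have a₂ : IsAcyclic o.B.bot := (isQuasiIso_iff_of_acyclic_target hM o.b o.bounded
    X.srcBot_bounded (.of_isZero h₂)).1 o.qb
  have : o.val hN hF = -K1.cls ((⟨o.B, o.bounded, a₁, a₂⟩ : AcyclicBinaryComplex M).map F hF) :=
    coneCls_of_target_isZero hN _ _ _ _ h _ _
  refine (QuotientAddGroup.eq_zero_iff _).2 ?_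
  rw [this]
  exact neg_mem ⟨_, K1.map_cls F hF _⟩

end Over

variable (F) in
/-- The zero object of `B[F]`. -/
abbrev RelBinary.zero : RelBinary F := RelBinary.ofAcyclic F .zero

namespace RelBinary

/-- The identity map. -/
@[simps]
def Hom.id (X : RelBinary F) : Hom X X where
  srcTop := 𝟙 _
  srcBot := 𝟙 _
  tar := 𝟙 _
  comm_top := by simp
  comm_bot := by simp

/-- The map to the zero object. -/
@[simps]
def Hom.toZero (X : RelBinary F) : Hom X (zero F) where
  srcTop := 0
  srcBot := 0
  tar := 0
  comm_top := by simp
  comm_bot := by simp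

lemma isShortExactRel_id_toZero (X : RelBinary F) :
    IsShortExactRel (Hom.id X) (Hom.toZero X) :=
  ⟨isShortExactComplex_id_zero _, isShortExactComplex_id_zero _,
    fun _ => isShortExact_iso_zero (𝟙 _) _ (isZero_zero N)⟩

end RelBinary

namespace Over

variable (hM : SupportsLongExactSequences M)

/-- The cone of the identity over the zero object. -/
def coneId (B : BinaryComplex M) (hB : IsBoundedGraded B.X) : Over (RelBinary.zero F) where
  B := BinaryComplex.cone (𝟙 B.top) (𝟙 B.bot)
  bounded := hB.shift.biprod hB
  a := 0
  b := 0
  qa := (isQuasiIso_iff_of_acyclic_source hM _ (hB.shift.biprod hB) isBoundedGraded_zero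
    (isAcyclic_cone_id B.top)).2 isAcyclic_zero
  qb := (isQuasiIso_iff_of_acyclic_source hM _ (hB.shift.biprod hB) isBoundedGraded_zero
    (isAcyclic_cone_id B.bot)).2 isAcyclic_zero

variable {X Y Z : RelBinary F}

/-- The object over `Y` built from the sources of `Y` and the swap of a given object over `Y`. -/
def swapCone (o : Over Y) : Over Y where
  -- On top, `o.b` cancels `srcBot` and leaves `srcTop`; on the bottom, `o.a` cancels `srcTop` and
  -- leaves `srcBot`. The swap puts the bottom of `o.B` on top, and the two cones share their graded
  -- object.
  B := BinaryComplex.cone (A := o.B.swap) (D := .diag (sumC Y.srcTop Y.srcBot))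
    (sumC.lift 0 o.b : o.B.bot ⟶ sumC Y.srcTop Y.srcBot)
    (sumC.lift o.a 0 : o.B.top ⟶ sumC Y.srcTop Y.srcBot)
  bounded := o.bounded.shift.biprod (Y.srcTop_bounded.biprod Y.srcBot_bounded)
  a := coneDesc (φ := (sumC.lift 0 o.b : o.B.bot ⟶ sumC Y.srcTop Y.srcBot)) (sumC.fst _ _)
    (by ext; simp)
  b := coneDesc (φ := (sumC.lift o.a 0 : o.B.top ⟶ sumC Y.srcTop Y.srcBot)) (sumC.snd _ _)
    (by ext; simp)
  qa := .coneDesc hM (isShortExactComplex_inr_fst _ _) (by ext <;> simp) _ o.bounded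
    (Y.srcTop_bounded.biprod Y.srcBot_bounded) o.qb
  qb := .coneDesc hM (isShortExactComplex_inl_snd _ _) (by ext <;> simp) _ o.bounded
    (Y.srcTop_bounded.biprod Y.srcBot_bounded) o.qa

end Over

end Relative


/-! ### Cylinders, and independence of the value from the choice of complex -/

section Relative

variable {M : Type u₁} [Category.{v₁} M] [Preadditive M] [HasZeroObject M]
  [HasBinaryBiproducts M] [ExactCategory M]
  {N : Type u₂} [Category.{v₂} N] [Preadditive N] [HasZeroObject N]
  [HasBinaryBiproducts N] [ExactCategory N]
  {F : M ⥤ N} [F.Additive]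

namespace Over

variable {X Y Z : RelBinary F}

/-- The map defining the top of `Over.cyl`. -/
abbrev cylTop (f : RelBinary.Hom X Y) (oX : Over X) (oY : Over Y) :
    sumC oX.B.top oY.B.bot ⟶ sumC oX.B.top (sumC Y.srcTop Y.srcBot) :=
  sumC.desc (sumC.lift (𝟙 _) (sumC.lift (oX.a ≫ f.srcTop) 0))
    (sumC.lift 0 (sumC.lift 0 oY.b))

/-- The map defining the bottom of `Over.cyl`. -/
abbrev cylBot (f : RelBinary.Hom X Y) (oX : Over X) (oY : Over Y) :
    sumC oX.B.bot oY.B.top ⟶ sumC oX.B.bot (sumC Y.srcTop Y.srcBot) :=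
  sumC.desc (sumC.lift (𝟙 _) (sumC.lift 0 (oX.b ≫ f.srcBot)))
    (sumC.lift 0 (sumC.lift oY.a 0))

/-- The map defining the top of `Over.quot`. -/
abbrev quotTop (f : RelBinary.Hom X Y) (oX : Over X) (oY : Over Y) :
    sumC oX.B.top oY.B.bot ⟶ sumC Y.srcTop Y.srcBot :=
  sumC.desc (sumC.lift (oX.a ≫ f.srcTop) 0) (sumC.lift 0 oY.b)

/-- The map defining the bottom of `Over.quot`. -/
abbrev quotBot (f : RelBinary.Hom X Y) (oX : Over X) (oY : Over Y) :
    sumC oX.B.bot oY.B.top ⟶ sumC Y.srcTop Y.srcBot :=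
  sumC.desc (sumC.lift 0 (oX.b ≫ f.srcBot)) (sumC.lift oY.a 0)

section

variable (f : RelBinary.Hom X Y) (oX : Over X) (oY : Over Y)

/-- The binary complex underlying `Over.cyl`. -/
abbrev cylB : BinaryComplex M :=
  BinaryComplex.cone (A := .sum oX.B oY.B.swap)
    (D := .sum oX.B (.diag (sumC Y.srcTop Y.srcBot))) (cylTop f oX oY) (cylBot f oX oY)

/-- The binary complex underlying `Over.quot`. -/
abbrev quotB : BinaryComplex M :=
  BinaryComplex.cone (A := .sum oX.B oY.B.swap)
    (D := .diag (sumC Y.srcTop Y.srcBot)) (quotTop f oX oY) (quotBot f oX oY)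

lemma cylB_bounded : IsBoundedGraded (cylB f oX oY).X :=
  (oX.bounded.biprod oY.bounded).shift.biprod
    (oX.bounded.biprod (Y.srcTop_bounded.biprod Y.srcBot_bounded))

lemma quotB_bounded : IsBoundedGraded (quotB f oX oY).X :=
  (oX.bounded.biprod oY.bounded).shift.biprod (Y.srcTop_bounded.biprod Y.srcBot_bounded)

variable (hM : SupportsLongExactSequences M)

/-- The inclusion of `Over.swapCone` into `Over.cyl`. -/
def swapConeToCyl : (oY.swapCone hM).B ⟶ cylB f oX oY :=
  BinaryComplex.coneMap (BinaryComplex.inr _ _) (BinaryComplex.inr _ _)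
    (show sumC.lift 0 oY.b ≫ sumC.inr _ _ = sumC.inr _ _ ≫ cylTop f oX oY by ext <;> simp)
    (show sumC.lift oY.a 0 ≫ sumC.inr _ _ = sumC.inr _ _ ≫ cylBot f oX oY by ext <;> simp)

/-- The projection of `Over.cyl` to the cone of the identity. -/
def cylToConeId : cylB f oX oY ⟶ (coneId (F := F) hM oX.B oX.bounded).B :=
  BinaryComplex.coneMap (BinaryComplex.fst _ _) (BinaryComplex.fst _ _)
    (show cylTop f oX oY ≫ sumC.fst _ _ = sumC.fst _ _ ≫ 𝟙 _ by ext <;> simp)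
    (show cylBot f oX oY ≫ sumC.fst _ _ = sumC.fst _ _ ≫ 𝟙 _ by ext <;> simp)

/-- The cone of the identity lies over zero and so has value zero; hence the cylinder has the same
value as `oY.swapCone`, whatever `oX` is. -/
lemma isShortExactBinary_cyl :
    BinaryComplex.IsShortExactBinary (swapConeToCyl f oX oY hM) (cylToConeId f oX oY hM) :=
  fun _ => (isShortExact_inr_fst _ _).biprod_map (isShortExact_inr_fst _ _)

/-- The map from the top of `Over.cyl`. -/
def cylA : RelK.cone (cylTop f oX oY) ⟶ Y.srcTop :=
  -- The sign cancels the component `oX.a ≫ f.srcTop` of `cylTop` against its identity component. It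
  -- is undone by the sign in `toCyl`.
  coneDesc (sumC.desc (-(oX.a ≫ f.srcTop)) (sumC.fst _ _)) (by ext <;> simp)

/-- The map from the bottom of `Over.cyl`. -/
def cylA' : RelK.cone (cylBot f oX oY) ⟶ Y.srcBot :=
  coneDesc (sumC.desc (-(oX.b ≫ f.srcBot)) (sumC.snd _ _)) (by ext <;> simp)

lemma swapConeToCyl_cylA :
    BinaryComplex.topMap (swapConeToCyl f oX oY hM) ≫ cylA f oX oY = (oY.swapCone hM).a := by
  refine HomologicalComplex.hom_ext _ _ fun i => ?_
  change biprod.map biprod.inr biprod.inr ≫ biprod.snd ≫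
    biprod.desc (-(oX.a.f i ≫ f.srcTop.f i)) biprod.fst = biprod.snd ≫ biprod.fst
  ext <;> simp

lemma swapConeToCyl_cylA' :
    BinaryComplex.botMap (swapConeToCyl f oX oY hM) ≫ cylA' f oX oY = (oY.swapCone hM).b := by
  refine HomologicalComplex.hom_ext _ _ fun i => ?_
  change biprod.map biprod.inr biprod.inr ≫ biprod.snd ≫
    biprod.desc (-(oX.b.f i ≫ f.srcBot.f i)) biprod.snd = biprod.snd ≫ biprod.snd
  ext <;> simp

/-- A mapping cylinder of a map in `B[F]`, as an object over the target. -/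
def cyl : Over Y where
  B := cylB f oX oY
  bounded := cylB_bounded f oX oY
  a := cylA f oX oY
  b := cylA' f oX oY
  qa := .ladder_middle (isShortExactBinary_cyl f oX oY hM).top (isShortExactComplex_id_zero _)
    ((Category.comp_id _).trans (swapConeToCyl_cylA f oX oY hM).symm)
    (by ext; exact (isZero_zero M).eq_of_tgt _ _) (cylB_bounded f oX oY) Y.srcTop_bounded
    (oY.swapCone hM).qa (coneId (F := F) hM oX.B oX.bounded).qa
  qb := .ladder_middle (isShortExactBinary_cyl f oX oY hM).bot (isShortExactComplex_id_zero _)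
    ((Category.comp_id _).trans (swapConeToCyl_cylA' f oX oY hM).symm)
    (by ext; exact (isZero_zero M).eq_of_tgt _ _) (cylB_bounded f oX oY) Y.srcBot_bounded
    (oY.swapCone hM).qb (coneId (F := F) hM oX.B oX.bounded).qb

/-- The inclusion of the given object into `Over.cyl`. -/
def toCyl : oX.B ⟶ cylB f oX oY :=
  BinaryComplex.homMk (fun _ => -𝟙 _) (by simp) (by simp) ≫ BinaryComplex.inl _ _ ≫
    BinaryComplex.coneInr _ _

/-- The projection of `Over.cyl` to `Over.quot`. -/
def cylToQuot : cylB f oX oY ⟶ quotB f oX oY :=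
  BinaryComplex.coneMap (𝟙 _) (BinaryComplex.snd _ _)
    (show cylTop f oX oY ≫ sumC.snd _ _ = 𝟙 _ ≫ quotTop f oX oY by ext <;> simp)
    (show cylBot f oX oY ≫ sumC.snd _ _ = 𝟙 _ ≫ quotBot f oX oY by ext <;> simp)

/-- There need be no map `oX.B ⟶ oY.B` over `f`, but `oX.B` always maps into the cylinder over `f`,
as a degreewise split subobject. The quotient then lies over `Z`. -/
lemma isShortExactBinary_toCyl :
    BinaryComplex.IsShortExactBinary (toCyl f oX oY) (cylToQuot f oX oY) := fun i =>
  isShortExact_of_splitting (-(biprod.snd ≫ biprod.fst)) (biprod.map (𝟙 _) biprod.inr)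
    (by simp [toCyl]) (by ext <;> simp [cylToQuot]) (by ext <;> simp [toCyl, cylToQuot])
    (by ext <;> simp [toCyl, cylToQuot])

variable {f} {g : RelBinary.Hom Y Z} (h : RelBinary.IsShortExactRel f g)

/-- The map from the top of `Over.quot`. -/
def quotA : RelK.cone (quotTop f oX oY) ⟶ Z.srcTop :=
  coneDesc (sumC.fst _ _ ≫ g.srcTop) (by
    refine HomologicalComplex.hom_ext _ _ fun i => ?_
    change biprod.desc (biprod.lift (oX.a.f i ≫ f.srcTop.f i) 0) (biprod.lift 0 (oY.b.f i)) ≫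
      biprod.fst ≫ g.srcTop.f i = 0
    ext <;> simp [(h.1 i).zero])

/-- The map from the bottom of `Over.quot`. -/
def quotA' : RelK.cone (quotBot f oX oY) ⟶ Z.srcBot :=
  coneDesc (sumC.snd _ _ ≫ g.srcBot) (by
    refine HomologicalComplex.hom_ext _ _ fun i => ?_
    change biprod.desc (biprod.lift 0 (oX.b.f i ≫ f.srcBot.f i)) (biprod.lift (oY.a.f i) 0) ≫
      biprod.snd ≫ g.srcBot.f i = 0
    ext <;> simp [(h.2.1 i).zero])

variable (f) in
lemma toCyl_cylA : BinaryComplex.topMap (toCyl f oX oY) ≫ cylA f oX oY = oX.a ≫ f.srcTop := by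
  refine HomologicalComplex.hom_ext _ _ fun i => ?_
  change ((-𝟙 _) ≫ biprod.inl ≫ biprod.inr) ≫ biprod.snd ≫
    biprod.desc (-(oX.a.f i ≫ f.srcTop.f i)) biprod.fst = oX.a.f i ≫ f.srcTop.f i
  simp

variable (f) in
lemma toCyl_cylA' : BinaryComplex.botMap (toCyl f oX oY) ≫ cylA' f oX oY = oX.b ≫ f.srcBot := by
  refine HomologicalComplex.hom_ext _ _ fun i => ?_
  change ((-𝟙 _) ≫ biprod.inl ≫ biprod.inr) ≫ biprod.snd ≫
    biprod.desc (-(oX.b.f i ≫ f.srcBot.f i)) biprod.snd = oX.b.f i ≫ f.srcBot.f i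
  simp

lemma cylToQuot_quotA :
    BinaryComplex.topMap (cylToQuot f oX oY) ≫ quotA oX oY h = cylA f oX oY ≫ g.srcTop := by
  refine HomologicalComplex.hom_ext _ _ fun i => ?_
  change biprod.map (𝟙 _) biprod.snd ≫ biprod.snd ≫ biprod.fst ≫ g.srcTop.f i =
    (biprod.snd ≫ biprod.desc (-(oX.a.f i ≫ f.srcTop.f i)) biprod.fst) ≫ g.srcTop.f i
  ext <;> simp [(h.1 i).zero]

lemma cylToQuot_quotA' :
    BinaryComplex.botMap (cylToQuot f oX oY) ≫ quotA' oX oY h = cylA' f oX oY ≫ g.srcBot := by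
  refine HomologicalComplex.hom_ext _ _ fun i => ?_
  change biprod.map (𝟙 _) biprod.snd ≫ biprod.snd ≫ biprod.snd ≫ g.srcBot.f i =
    (biprod.snd ≫ biprod.desc (-(oX.b.f i ≫ f.srcBot.f i)) biprod.snd) ≫ g.srcBot.f i
  ext <;> simp [(h.2.1 i).zero]

/-- Objects over the first two terms of a short exact sequence give one over the third term. -/
def quot : Over Z where
  B := quotB f oX oY
  bounded := quotB_bounded f oX oY
  a := quotA oX oY h
  b := quotA' oX oY h
  qa := .ladder_right hM (isShortExactBinary_toCyl f oX oY).top h.1 (toCyl_cylA f oX oY).symm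
    (cylToQuot_quotA oX oY h).symm (cylB_bounded f oX oY) Y.srcTop_bounded oX.qa
    (cyl f oX oY hM).qa
  qb := .ladder_right hM (isShortExactBinary_toCyl f oX oY).bot h.2.1 (toCyl_cylA' f oX oY).symm
    (cylToQuot_quotA' oX oY h).symm (cylB_bounded f oX oY) Y.srcBot_bounded oX.qb
    (cyl f oX oY hM).qb

variable (hN : SupportsLongExactSequences N) (hF : IsExactFunctor F)

variable (f) in
lemma gval_cyl : (cyl f oX oY hM).gval hN hF = (oY.swapCone hM).gval hN hF := by
  rw [gval_add hN hF (RelBinary.isShortExactRel_id_toZero Y) (oY.swapCone hM) (cyl f oX oY hM)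
    (coneId hM oX.B oX.bounded) (isShortExactBinary_cyl f oX oY hM)
    ((swapConeToCyl_cylA f oX oY hM).trans (Category.comp_id _).symm)
    ((swapConeToCyl_cylA' f oX oY hM).trans (Category.comp_id _).symm)
    (by ext; exact (isZero_zero M).eq_of_tgt _ _) (by ext; exact (isZero_zero M).eq_of_tgt _ _),
    gval_of_isZero hN hF hM (coneId hM oX.B oX.bounded) (fun _ => isZero_zero M)
      (fun _ => isZero_zero M) (fun _ => isZero_zero N), add_zero]

lemma gval_quot_aux :
    (oY.swapCone hM).gval hN hF = oX.gval hN hF + (quot oX oY hM h).gval hN hF := by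
  rw [← gval_cyl f oX oY hM hN hF]
  exact gval_add hN hF h oX (cyl f oX oY hM) (quot oX oY hM h) (isShortExactBinary_toCyl f oX oY)
    (toCyl_cylA f oX oY) (toCyl_cylA' f oX oY) (cylToQuot_quotA oX oY h) (cylToQuot_quotA' oX oY h)

/-- The class `Over.gval` depends only on the object of `B[F]`. -/
lemma gval_eq (hM : SupportsLongExactSequences M) (o o' : Over Y) : o.gval hN hF = o'.gval hN hF := by
  -- In the sequence `Y ⟶ Y ⟶ 0`, put `o` over the first term and `o'` over the second. The quotient
  -- lies over zero, so `o'.swapCone` has the value of `o`, for every pair `o`, `o'`.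
  have key : ∀ o o' : Over Y, (o'.swapCone hM).gval hN hF = o.gval hN hF := fun o o' => by
    rw [gval_quot_aux o o' hM (RelBinary.isShortExactRel_id_toZero Y) hN hF,
      gval_of_isZero hN hF hM (quot o o' hM (RelBinary.isShortExactRel_id_toZero Y)) (fun _ => isZero_zero M)
      (fun _ => isZero_zero M) (fun _ => isZero_zero N), add_zero]
  rw [← key o o', ← key o' o']

lemma gval_quot : oY.gval hN hF = oX.gval hN hF + (quot oX oY hM h).gval hN hF := by
  rw [← gval_quot_aux, gval_eq hN hF hM]

end

end Over

end Relative


/-! ### `K₀` and Euler characteristics -/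

section KZero

variable {C : Type u} [Category.{v} C] [Preadditive C] [HasZeroObject C]
  [HasBinaryBiproducts C] [ExactCategory C]

lemma K0.cls_add {X Y Z : C} {f : X ⟶ Y} {g : Y ⟶ Z} (h : IsShortExact f g) :
    K0.cls Y = K0.cls X + K0.cls Z := by
  rw [← sub_eq_zero, ← sub_sub]
  exact (QuotientAddGroup.eq_zero_iff _).2
    (AddSubgroup.subset_closure ⟨X, Y, Z, f, g, h, rfl⟩)

lemma K0.cls_of_isZero {X : C} (h : IsZero X) : K0.cls X = 0 := by
  have := K0.cls_add (isShortExact_of_isZero (𝟙 X) (𝟙 X) h h h)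
  simpa using this

lemma K0.cls_biprod (X Y : C) : K0.cls (X ⊞ Y) = K0.cls X + K0.cls Y :=
  K0.cls_add (isShortExact_inl_snd X Y)

/-- An additive function on objects induces a map on the Grothendieck group. -/
def K0.lift {G : Type*} [AddCommGroup G] (φ : C → G)
    (h : ∀ {X Y Z : C} (f : X ⟶ Y) (g : Y ⟶ Z), IsShortExact f g → φ Y = φ X + φ Z) :
    K0 C →+ G :=
  QuotientAddGroup.lift (AddSubgroup.closure (K0Relations C)) (FreeAbelianGroup.lift φ) (by
    rw [AddSubgroup.closure_le]
    rintro r ⟨X, Y, Z, f, g, hfg, rfl⟩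
    simp only [SetLike.mem_coe, AddMonoidHom.mem_ker, map_sub, FreeAbelianGroup.lift_apply_of]
    rw [h f g hfg]; abel)

@[simp]
lemma K0.lift_cls {G : Type*} [AddCommGroup G] (φ : C → G)
    (h : ∀ {X Y Z : C} (f : X ⟶ Y) (g : Y ⟶ Z), IsShortExact f g → φ Y = φ X + φ Z) (X : C) :
    K0.lift φ h (K0.cls X) = φ X :=
  (QuotientAddGroup.lift_mk' _ _ _).trans (FreeAbelianGroup.lift_apply_of _ _)

/-- A function on acyclic binary complexes which is additive and vanishes on diagonal ones induces
a map on `K₁`. -/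
def K1.lift {G : Type*} [AddCommGroup G] (φ : AcyclicBinaryComplex C → G)
    (h : ∀ {X Y Z : AcyclicBinaryComplex C} (f : X.cx ⟶ Y.cx) (g : Y.cx ⟶ Z.cx),
      BinaryComplex.IsShortExactBinary f g → φ Y = φ X + φ Z)
    (h₀ : ∀ (K : ChainComplex C ℤ) (hb : IsBoundedGraded K.X) (ha : IsAcyclic K),
      φ (.diag K hb ha) = 0) : K1 C →+ G :=
  QuotientAddGroup.lift (AddSubgroup.closure (K1Relations C)) (FreeAbelianGroup.lift φ) (by
    rw [AddSubgroup.closure_le]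
    rintro r (⟨X, Y, Z, f, g, hfg, rfl⟩ | ⟨K, hb, ha, rfl⟩)
    · simp only [SetLike.mem_coe, AddMonoidHom.mem_ker, map_sub, FreeAbelianGroup.lift_apply_of]
      rw [h f g hfg]; abel
    · simp only [SetLike.mem_coe, AddMonoidHom.mem_ker, FreeAbelianGroup.lift_apply_of, h₀])

/-- Sums of objects merge the positive terms of a combination into one generator and the negative
terms into another. -/
lemma FreeAbelianGroup.exists_of_sub_of {α G : Type*} [AddCommGroup G]
    (φ : FreeAbelianGroup α →+ G) (z : α) (hz : φ (.of z) = 0) (s : α → α → α)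
    (hs : ∀ a b, φ (.of (s a b)) = φ (.of a) + φ (.of b)) (x : FreeAbelianGroup α) :
    ∃ a b, φ x = φ (.of a) - φ (.of b) := by
  induction x using FreeAbelianGroup.induction_on with
  | zero => exact ⟨z, z, by simp⟩
  | of a => exact ⟨a, z, by simp [hz]⟩
  | neg a => exact ⟨z, a, by simp [hz]⟩
  | add x y hx hy =>
    obtain ⟨a, b, h⟩ := hx
    obtain ⟨c, d, h'⟩ := hy
    exact ⟨s a c, s b d, by rw [map_add, h, h', hs, hs]; abel⟩

lemma K0.exists_sub (x : K0 C) : ∃ A B : C, x = K0.cls A - K0.cls B := by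
  obtain ⟨x, rfl⟩ := QuotientAddGroup.mk'_surjective _ x
  exact FreeAbelianGroup.exists_of_sub_of (G := K0 C) _ 0 (K0.cls_of_isZero (isZero_zero C))
    (· ⊞ ·) K0.cls_biprod x

lemma eulerChar_eq_sum {K : ChainComplex C ℤ} {s : Finset ℤ} (h : ∀ i ∉ s, IsZero (K.X i)) :
    eulerChar K = ∑ i ∈ s, i.negOnePow • K0.cls (K.X i) :=
  finsum_eq_sum_of_support_subset _ fun i hi => by
    by_contra h'
    exact hi (by simp [K0.cls_of_isZero (h i h')])

lemma IsBoundedGraded.exists_finset {X : ℤ → C} (h : IsBoundedGraded X) :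
    ∃ s : Finset ℤ, ∀ i ∉ s, IsZero (X i) := by
  obtain ⟨a, b, h⟩ := h
  exact ⟨Finset.Icc a b, fun i hi => h i (by rw [Finset.mem_Icc] at hi; omega)⟩

lemma IsBoundedGraded.finite_support {X : ℤ → C} (h : IsBoundedGraded X) :
    (Function.support fun i : ℤ => i.negOnePow • K0.cls (X i)).Finite := by
  obtain ⟨s, hs⟩ := h.exists_finset
  refine s.finite_toSet.subset fun i hi => ?_
  by_contra h'
  exact hi (by simp [K0.cls_of_isZero (hs i h')])

lemma eulerChar_add {K L R : ChainComplex C ℤ} {f : K ⟶ L} {g : L ⟶ R}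
    (h : IsShortExactComplex f g) (hL : IsBoundedGraded L.X) :
    eulerChar L = eulerChar K + eulerChar R := by
  have hK : IsBoundedGraded K.X := hL.mono fun i hi => (h i).isZero_left hi
  have hR : IsBoundedGraded R.X := hL.mono fun i hi => (h i).isZero_right hi
  rw [eulerChar, eulerChar, eulerChar, ← finsum_add_distrib hK.finite_support hR.finite_support]
  exact finsum_congr fun i => by rw [K0.cls_add (h i), smul_add]

lemma eulerChar_shift (K : ChainComplex C ℤ) : eulerChar (shift K) = -eulerChar K := by
  rw [eulerChar, eulerChar, ← finsum_neg_distrib]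
  refine (finsum_congr fun i => ?_).trans (finsum_comp_equiv (Equiv.subRight (1 : ℤ)))
  simp [Int.negOnePow_sub]

/-- Substituting `[K_{i+1}] = [Z_{i+1}] + [Z_i]` makes the alternating sum telescope. -/
lemma eulerChar_of_isAcyclic {K : ChainComplex C ℤ} (hK : IsBoundedGraded K.X)
    (h : IsAcyclic K) : eulerChar K = 0 := by
  obtain ⟨Z, j, p, -, hs⟩ := h
  have hb : IsBoundedGraded Z := by
    obtain ⟨a, b, h⟩ := hK
    exact ⟨a - 1, b - 1, fun i hi => (hs i).isZero_right (h _ (by omega))⟩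
  have key : eulerChar K = ∑ᶠ i : ℤ, (i.negOnePow • K0.cls (Z i) -
      (i - 1).negOnePow • K0.cls (Z (i - 1))) := by
    refine finsum_congr fun i => ?_
    obtain ⟨i, rfl⟩ : ∃ k, i = k + 1 := ⟨i - 1, by ring⟩
    have e : i + 1 - 1 = i := by ring
    rw [K0.cls_add (hs i), e, Int.negOnePow_succ, smul_add, Units.neg_smul, Units.neg_smul]
    abel
  rw [key, finsum_sub_distrib hb.finite_support, sub_eq_zero]
  · exact (finsum_comp_equiv (Equiv.subRight (1 : ℤ))).symm
  · exact hb.finite_support.preimage (sub_left_injective (b := (1 : ℤ))).injOn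

lemma eulerChar_cone {K L : ChainComplex C ℤ} (φ : K ⟶ L) (hK : IsBoundedGraded K.X)
    (hL : IsBoundedGraded L.X) : eulerChar (cone φ) = eulerChar L - eulerChar K := by
  rw [eulerChar_add (isShortExactComplex_coneInr_coneFst φ) (hK.cone hL φ), eulerChar_shift,
    sub_eq_add_neg]

lemma IsQuasiIso.eulerChar_eq {K L : ChainComplex C ℤ} {φ : K ⟶ L} (h : IsQuasiIso φ)
    (hK : IsBoundedGraded K.X) (hL : IsBoundedGraded L.X) : eulerChar K = eulerChar L := by
  rw [eq_comm, ← sub_eq_zero, ← eulerChar_cone φ hK hL,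
    eulerChar_of_isAcyclic (hK.cone hL φ) ((isQuasiIso_iff φ).1 h)]

lemma eulerChar_sumC {K L : ChainComplex C ℤ} (hK : IsBoundedGraded K.X)
    (hL : IsBoundedGraded L.X) : eulerChar (sumC K L) = eulerChar K + eulerChar L :=
  eulerChar_add (isShortExactComplex_inl_snd K L) (hK.biprod hL)

end KZero

section KZeroMap

variable {M : Type u₁} [Category.{v₁} M] [Preadditive M] [HasZeroObject M]
  [HasBinaryBiproducts M] [ExactCategory M]
  {N : Type u₂} [Category.{v₂} N] [Preadditive N] [HasZeroObject N]
  [HasBinaryBiproducts N] [ExactCategory N]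

/-- The map on `K₀` induced by an exact functor. -/
def K0.map (F : M ⥤ N) [F.Additive] (hF : IsExactFunctor F) : K0 M →+ K0 N :=
  K0.lift (fun A => K0.cls (F.obj A)) fun f g h => K0.cls_add (hF f g h)

@[simp]
lemma K0.map_cls (F : M ⥤ N) [F.Additive] (hF : IsExactFunctor F) (A : M) :
    K0.map F hF (K0.cls A) = K0.cls (F.obj A) := K0.lift_cls _ (fun f g h => K0.cls_add (hF f g h)) _

lemma K0.map_eulerChar (F : M ⥤ N) [F.Additive] (hF : IsExactFunctor F) {K : ChainComplex M ℤ}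
    (hK : IsBoundedGraded K.X) :
    K0.map F hF (eulerChar K) = eulerChar ((mapC F).obj K) := by
  rw [eulerChar, AddMonoidHom.map_finsum _ hK.finite_support]
  refine finsum_congr fun i => ?_
  rw [Units.smul_def, map_zsmul, K0.map_cls]
  rfl

end KZeroMap

/-! ### Monoids of isomorphism classes -/

section IsoClass

variable {D : Type*} [Category D]

/-- The commutative monoid of isomorphism classes of a category with chosen finite products. -/
abbrev isoClassMonoid (t : LimitCone (Functor.empty.{0} D))
    (b : ∀ X Y : D, LimitCone (pair X Y)) : AddCommMonoid (Additive (Skeleton D)) :=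
  -- The product is a braided monoidal structure, so the isomorphism classes form a commutative
  -- monoid.
  letI := CartesianMonoidalCategory.ofChosenFiniteProducts t b
  letI : BraidedCategory D := .ofCartesianMonoidalCategory
  inferInstanceAs (AddCommMonoid (Additive (Skeleton D)))

lemma isoClassMonoid_add (t : LimitCone (Functor.empty.{0} D))
    (b : ∀ X Y : D, LimitCone (pair X Y)) (X Y : D) :
    letI := isoClassMonoid t b
    Additive.ofMul (toSkeleton X) + Additive.ofMul (toSkeleton Y) =
      Additive.ofMul (toSkeleton (b X Y).cone.pt) :=
  letI := CartesianMonoidalCategory.ofChosenFiniteProducts t b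
  (Skeleton.toSkeleton_tensorObj X Y).symm

end IsoClass

section Graded

variable (C : Type u) [Category.{v} C] [Preadditive C] [HasZeroObject C]
  [HasBinaryBiproducts C]

/-- The monoid of isomorphism classes of an additive category, under direct sum. -/
def SumClass : Type _ := Additive (Skeleton C)

instance : AddCommMonoid (SumClass C) :=
  isoClassMonoid ⟨_, HasZeroObject.zeroIsTerminal⟩ fun X Y =>
    ⟨_, BinaryBiproduct.isLimit X Y⟩

variable {C}

/-- The isomorphism class of an object. -/
def SumClass.mk (X : C) : SumClass C := Additive.ofMul (toSkeleton X)

lemma SumClass.mk_eq_iff {X Y : C} : SumClass.mk X = SumClass.mk Y ↔ Nonempty (X ≅ Y) :=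
  toSkeleton_eq_toSkeleton_iff

lemma SumClass.mk_biprod (X Y : C) :
    SumClass.mk (X ⊞ Y) = SumClass.mk X + SumClass.mk Y :=
  (isoClassMonoid_add (D := C) ⟨_, HasZeroObject.zeroIsTerminal⟩
    (fun X Y => ⟨_, BinaryBiproduct.isLimit X Y⟩) X Y).symm

lemma SumClass.mk_of_isZero {X : C} (h : IsZero X) : SumClass.mk X = 0 :=
  SumClass.mk_eq_iff.2 ⟨h.iso (isZero_zero C)⟩

end Graded

/-! ### Graded isomorphism classes modulo acyclic complexes -/

section AcyclicCongruence

variable {C : Type u} [Category.{v} C] [Preadditive C] [HasZeroObject C]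
  [HasBinaryBiproducts C] [ExactCategory C]

/-- The degreewise isomorphism class of a graded object. -/
def gradedClass (X : ℤ → C) : ℤ → SumClass C := fun i => SumClass.mk (X i)

lemma gradedClass_biprod (X Y : ℤ → C) :
    gradedClass (fun i => X i ⊞ Y i) = gradedClass X + gradedClass Y :=
  funext fun _ => SumClass.mk_biprod _ _

lemma gradedClass_of_isZero {X : ℤ → C} (h : ∀ i, IsZero (X i)) : gradedClass X = 0 :=
  funext fun i => SumClass.mk_of_isZero (h i)

lemma IsAcyclic.sumC {K L : ChainComplex C ℤ} (hK : IsAcyclic K) (hL : IsAcyclic L)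
    (bK : IsBoundedGraded K.X) (bL : IsBoundedGraded L.X) : IsAcyclic (sumC K L) :=
  .of_shortExact_middle (isShortExactComplex_inl_snd K L) hK hL (bK.biprod bL)

variable (C) in
/-- Graded isomorphism classes modulo those of bounded acyclic complexes. -/
def acyclicCon : AddCon (ℤ → SumClass C) where
  -- Nothing can be subtracted in this monoid, so acyclic complexes are added on both sides.
  -- Equality in the quotient then unfolds to actual isomorphisms.
  r x y := ∃ K L : ChainComplex C ℤ, IsBoundedGraded K.X ∧ IsBoundedGraded L.X ∧
    IsAcyclic K ∧ IsAcyclic L ∧ x + gradedClass K.X = y + gradedClass L.X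
  iseqv :=
    { refl := fun x => ⟨.zero, .zero, isBoundedGraded_zero, isBoundedGraded_zero, isAcyclic_zero,
        isAcyclic_zero, rfl⟩
      symm := fun ⟨K, L, bK, bL, aK, aL, h⟩ => ⟨L, K, bL, bK, aL, aK, h.symm⟩
      trans := fun {x y z} ⟨K, L, bK, bL, aK, aL, h⟩ ⟨K', L', bK', bL', aK', aL', h'⟩ =>
        ⟨sumC K K', sumC L L', bK.biprod bK', bL.biprod bL', aK.sumC aK' bK bK',
          aL.sumC aL' bL bL', by
            rw [gradedClass_biprod, gradedClass_biprod, ← add_assoc, h, add_right_comm, h']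
            abel⟩ }
  add' := fun {x y z w} ⟨K, L, bK, bL, aK, aL, h⟩ ⟨K', L', bK', bL', aK', aL', h'⟩ =>
    ⟨sumC K K', sumC L L', bK.biprod bK', bL.biprod bL', aK.sumC aK' bK bK',
      aL.sumC aL' bL bL', by
        rw [gradedClass_biprod, gradedClass_biprod, add_add_add_comm, h, h', add_add_add_comm]⟩

variable (C) in
/-- The monoid of graded isomorphism classes modulo those of bounded acyclic complexes. -/
def AcyclicQuot : Type _ := (acyclicCon C).Quotient

instance : AddCommMonoid (AcyclicQuot C) :=
  inferInstanceAs (AddCommMonoid (acyclicCon C).Quotient)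

/-- The class of a family of isomorphism classes modulo acyclic complexes. -/
def acyclicQuot : (ℤ → SumClass C) →+ AcyclicQuot C := (acyclicCon C).mk'

lemma acyclicQuot_of_isAcyclic {K : ChainComplex C ℤ} (bK : IsBoundedGraded K.X)
    (h : IsAcyclic K) : acyclicQuot (gradedClass K.X) = 0 := by
  rw [← map_zero acyclicQuot]
  refine (AddCon.eq _).2 ⟨.zero, K, isBoundedGraded_zero, bK, isAcyclic_zero, h, ?_⟩
  rw [gradedClass_of_isZero (X := HomologicalComplex.zero.X) fun _ => isZero_zero C, add_comm]

/-- The complex with an object in a single degree. -/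
abbrev singleC (A : C) (n : ℤ) : ChainComplex C ℤ :=
  (HomologicalComplex.single C (ComplexShape.down ℤ) n).obj A

lemma isZero_singleC (A : C) {n i : ℤ} (h : i ≠ n) : IsZero ((singleC A n).X i) :=
  HomologicalComplex.isZero_single_obj_X _ _ _ _ h

lemma singleC_bounded (A : C) (n : ℤ) : IsBoundedGraded (singleC A n).X :=
  ⟨n, n, fun _ hi => isZero_singleC A (by omega)⟩

lemma gradedClass_singleC (A : C) (n : ℤ) :
    gradedClass (singleC A n).X = Pi.single n (SumClass.mk A) := by
  ext i
  by_cases h : i = n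
  · subst h
    rw [Pi.single_eq_same]
    exact SumClass.mk_eq_iff.2 ⟨HomologicalComplex.singleObjXSelf _ _ _⟩
  · rw [Pi.single_eq_of_ne h]
    exact SumClass.mk_of_isZero (isZero_singleC A h)

lemma isShortExactComplex_singleC {X Y Z : C} {f : X ⟶ Y} {g : Y ⟶ Z} (h : IsShortExact f g)
    (n : ℤ) : IsShortExactComplex ((HomologicalComplex.single C (ComplexShape.down ℤ) n).map f)
      ((HomologicalComplex.single C (ComplexShape.down ℤ) n).map g) := by
  intro i
  by_cases hi : i = n
  · subst hi
    refine h.of_iso (HomologicalComplex.singleObjXSelf _ _ _).symm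
      (HomologicalComplex.singleObjXSelf _ _ _).symm
      (HomologicalComplex.singleObjXSelf _ _ _).symm ?_ ?_ <;>
    simp [HomologicalComplex.single_map_f_self]
  · exact isShortExact_of_isZero _ _ (isZero_singleC X hi) (isZero_singleC Y hi)
      (isZero_singleC Z hi)

lemma gradedClass_pred (X : ℤ → C) :
    gradedClass (fun i => X (i - 1)) = fun i => gradedClass X (i - 1) := rfl

lemma single_pred {G : Type*} [Zero G] (n : ℤ) (x : G) :
    (fun i => (Pi.single n x : ℤ → G) (i - 1)) = Pi.single (n + 1) x := by
  ext i
  simp only [Pi.single_apply, sub_eq_iff_eq_add]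

/-- The cone of the identity of `A` in degree `n` is acyclic with `A` in degrees `n` and `n + 1`, so
single-degree classes are invertible. -/
lemma acyclicQuot_single_add (A : C) (n : ℤ) :
    acyclicQuot (Pi.single (n + 1) (SumClass.mk A)) + acyclicQuot (Pi.single n (SumClass.mk A)) =
      0 := by
  have := acyclicQuot_of_isAcyclic ((singleC_bounded A n).cone (singleC_bounded A n) _)
    (isAcyclic_cone_id (singleC A n))
  rwa [gradedClass_biprod, gradedClass_pred, gradedClass_singleC, single_pred, map_add] at this

/-- The invertible class of an object placed in degree `0`. -/
def acyclicUnit (A : C) : AddUnits (AcyclicQuot C) where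
  val := acyclicQuot (Pi.single 0 (SumClass.mk A))
  neg := acyclicQuot (Pi.single 1 (SumClass.mk A))
  val_neg := by rw [add_comm]; exact acyclicQuot_single_add A 0
  neg_val := acyclicQuot_single_add A 0


/-- The iterated cone of `X ⟶ Y ⟶ Z` is acyclic with `X`, `Y`, `Z` in degrees `2`, `1`, `0`. Moving
all three to degree `0` with `acyclicQuot_single_add` gives additivity. -/
lemma acyclicUnit_add (hC : SupportsLongExactSequences C) {X Y Z : C} {f : X ⟶ Y} {g : Y ⟶ Z} (h : IsShortExact f g) :
    acyclicUnit Y = acyclicUnit X + acyclicUnit Z := by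
  have hs := isShortExactComplex_singleC h 0
  have bX := singleC_bounded X 0
  have bY := singleC_bounded Y 0
  have bZ := singleC_bounded Z 0
  have q := IsQuasiIso.coneDesc hC hs (Category.id_comp _) hs.zero bX bY (isQuasiIso_id _)
  have := acyclicQuot_of_isAcyclic ((bX.cone bY _).cone bZ _) ((isQuasiIso_iff _).1 q)
  rw [gradedClass_biprod, gradedClass_pred, gradedClass_biprod, gradedClass_pred,
    gradedClass_singleC, gradedClass_singleC, gradedClass_singleC, single_pred] at this
  have e : (fun i : ℤ => ((Pi.single (0 + 1) (SumClass.mk X) : ℤ → SumClass C) +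
      (Pi.single 0 (SumClass.mk Y) : ℤ → SumClass C)) (i - 1)) =
        (Pi.single (1 + 1) (SumClass.mk X) : ℤ → SumClass C) +
          (Pi.single 1 (SumClass.mk Y) : ℤ → SumClass C) := by
    funext i
    simp only [Pi.add_apply, Pi.single_apply, sub_eq_iff_eq_add]
    rfl
  rw [e, map_add, map_add] at this
  have hX₀ := acyclicQuot_single_add X 0
  have hX₁ := acyclicQuot_single_add X 1
  have hY := acyclicQuot_single_add Y 0
  rw [zero_add] at hX₀ hY
  apply AddUnits.ext
  change acyclicQuot (Pi.single 0 (SumClass.mk Y)) =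
    acyclicQuot (Pi.single 0 (SumClass.mk X)) + acyclicQuot (Pi.single 0 (SumClass.mk Z))
  generalize acyclicQuot (Pi.single 0 (SumClass.mk Y)) = y₀ at *
  generalize acyclicQuot (Pi.single 1 (SumClass.mk Y)) = y₁ at *
  generalize acyclicQuot (Pi.single 0 (SumClass.mk X)) = x₀ at *
  generalize acyclicQuot (Pi.single 1 (SumClass.mk X)) = x₁ at *
  generalize acyclicQuot (Pi.single (1 + 1) (SumClass.mk X)) = x₂ at *
  generalize acyclicQuot (Pi.single 0 (SumClass.mk Z)) = z₀ at *
  calc y₀ = y₀ + (x₂ + y₁ + z₀) := by rw [this, add_zero]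
    _ = (y₁ + y₀) + (x₂ + z₀) := by abel
    _ = (x₁ + x₀) + (x₂ + z₀) := by rw [hY, hX₀]
    _ = (x₂ + x₁) + (x₀ + z₀) := by abel
    _ = x₀ + z₀ := by rw [hX₁, zero_add]

/-- The map from `K₀` to graded isomorphism classes modulo acyclic complexes. -/
def K0.toAcyclicQuot (hC : SupportsLongExactSequences C) : K0 C →+ AddUnits (AcyclicQuot C) :=
  K0.lift acyclicUnit fun _ _ h => acyclicUnit_add hC h

lemma val_negOnePow_smul_acyclicUnit (A : C) (n : ℤ) :
    (n.negOnePow • acyclicUnit A).val = acyclicQuot (Pi.single n (SumClass.mk A)) := by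
  have neg : ∀ (u : AddUnits (AcyclicQuot C)) (y : AcyclicQuot C),
      y + u.val = 0 → (-u).val = y := fun u y h => (AddUnits.eq_neg_of_add_eq_zero_left (by rwa [add_comm])).symm
  induction n using Int.induction_on with
  | zero => rw [Int.negOnePow_zero, one_smul]; rfl
  | succ n ih =>
    rw [Int.negOnePow_succ, Units.neg_smul]
    exact neg _ _ (by rw [ih]; exact acyclicQuot_single_add A n)
  | pred n ih =>
    have e : (-(n : ℤ) - 1).negOnePow = -(-(n : ℤ)).negOnePow := by
      simp [Int.negOnePow_sub]
    rw [e, Units.neg_smul]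
    refine neg _ _ ?_
    rw [ih, add_comm]
    have := acyclicQuot_single_add A (-n - 1)
    rwa [sub_add_cancel] at this

/-- The sign `(-1)^n` amounts to placing the object in degree `n`, so the alternating sum becomes
the plain sum of the graded pieces. -/
lemma toAcyclicQuot_eulerChar (hC : SupportsLongExactSequences C) {K : ChainComplex C ℤ}
    (hK : IsBoundedGraded K.X) :
    (K0.toAcyclicQuot hC (eulerChar K)).val = acyclicQuot (gradedClass K.X) := by
  obtain ⟨s, hs⟩ := hK.exists_finset
  have e : gradedClass K.X = ∑ i ∈ s, Pi.single i (SumClass.mk (K.X i)) := by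
    ext i
    rw [Finset.sum_apply]
    simp only [Pi.single_apply, Finset.sum_ite_eq]
    split_ifs with h
    · rfl
    · exact SumClass.mk_of_isZero (hs i h)
  rw [eulerChar_eq_sum hs, e, map_sum, map_sum, ← AddUnits.coeHom_apply, map_sum]
  refine Finset.sum_congr rfl fun i _ => ?_
  rw [Units.smul_def, map_zsmul, K0.toAcyclicQuot, K0.lift_cls]
  exact val_negOnePow_smul_acyclicUnit _ _

/-- Bounded complexes with the same Euler characteristic become isomorphic as graded objects after
adding acyclic complexes. -/
lemma exists_iso_of_eulerChar_eq (hC : SupportsLongExactSequences C) {K L : ChainComplex C ℤ}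
    (hK : IsBoundedGraded K.X)
    (hL : IsBoundedGraded L.X) (h : eulerChar K = eulerChar L) :
    ∃ P Q : ChainComplex C ℤ, IsBoundedGraded P.X ∧ IsBoundedGraded Q.X ∧ IsAcyclic P ∧
      IsAcyclic Q ∧ ∀ i, Nonempty (K.X i ⊞ P.X i ≅ L.X i ⊞ Q.X i) := by
  have e : acyclicQuot (gradedClass K.X) = acyclicQuot (gradedClass L.X) := by
    rw [← toAcyclicQuot_eulerChar hC hK, ← toAcyclicQuot_eulerChar hC hL, h]
  obtain ⟨P, Q, bP, bQ, aP, aQ, h⟩ := (AddCon.eq _).1 e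
  refine ⟨P, Q, bP, bQ, aP, aQ, fun i => SumClass.mk_eq_iff.1 ?_⟩
  rw [SumClass.mk_biprod, SumClass.mk_biprod]
  exact congrFun h i

end AcyclicCongruence

/-! ### Binary complexes from equal Euler characteristics -/

section ExistsBinary

variable {C : Type u} [Category.{v} C] [Preadditive C] [HasZeroObject C]
  [HasBinaryBiproducts C] [ExactCategory C]

/-- The chain complex obtained by transporting the differentials along isomorphisms. -/
@[simps]
def transportComplex {X : ℤ → C} (K : ChainComplex C ℤ) (e : ∀ i, X i ≅ K.X i) :
    ChainComplex C ℤ where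
  X := X
  d i j := (e i).hom ≫ K.d i j ≫ (e j).inv
  shape i j h := by simp [K.shape i j h]

/-- The transported complex is isomorphic to the original one. -/
def transportIso {X : ℤ → C} (K : ChainComplex C ℤ) (e : ∀ i, X i ≅ K.X i) :
    transportComplex K e ≅ K :=
  HomologicalComplex.Hom.isoOfComponents e fun i j _ => by simp [transportComplex]

/-- Two bounded complexes with the same Euler characteristic are quasi-isomorphic to the top and
bottom of a binary complex. -/
lemma exists_binaryComplex (hC : SupportsLongExactSequences C) {K L : ChainComplex C ℤ}
    (hK : IsBoundedGraded K.X) (hL : IsBoundedGraded L.X) (h : eulerChar K = eulerChar L) :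
    ∃ (B : BinaryComplex C) (_ : IsBoundedGraded B.X) (a : B.top ⟶ K) (b : B.bot ⟶ L)
      (a' : K ⟶ B.top) (b' : L ⟶ B.bot),
      IsQuasiIso a ∧ IsQuasiIso b ∧ IsQuasiIso a' ∧ IsQuasiIso b' := by
  obtain ⟨P, Q, bP, bQ, aP, aQ, e⟩ := exists_iso_of_eulerChar_eq hC hK hL h
  let e' : ∀ i, (sumC K P).X i ≅ (sumC L Q).X i := fun i => (e i).some
  -- The differential of `L ⊕ Q`, carried to the graded object of `K ⊕ P`, becomes the bottom
  -- differential.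
  let T := transportComplex (sumC L Q) e'
  have hB : IsBoundedGraded (sumC K P).X := hK.biprod bP
  have hB' : IsBoundedGraded (sumC L Q).X := hL.biprod bQ
  have hT : IsBoundedGraded T.X := hB
  have q : IsQuasiIso (transportIso (sumC L Q) e').hom := isQuasiIso_of_isIso hC _ hT
  have q' : IsQuasiIso (transportIso (sumC L Q) e').inv := isQuasiIso_of_isIso hC _ hB'
  -- The projections serve to put a binary complex over given sources, the inclusions to build
  -- comparison maps in `B[F]`. Both are quasi-isomorphisms since `P` and `Q` are acyclic.
  refine ⟨⟨(sumC K P).X, (sumC K P).d, T.d, (sumC K P).shape, T.shape, (sumC K P).d_comp_d,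
    T.d_comp_d⟩, hB, sumC.fst K P, (transportIso (sumC L Q) e').hom ≫ sumC.fst L Q,
    sumC.inl K P, sumC.inl L Q ≫ (transportIso (sumC L Q) e').inv, ?_, ?_, ?_, ?_⟩
  · exact .of_acyclic_kernel hC (isShortExactComplex_inr_fst K P) hB aP
  · exact .comp hC hT hB' hL q
      (.of_acyclic_kernel hC (isShortExactComplex_inr_fst L Q) hB' aQ)
  · exact .of_acyclic_cokernel hC (isShortExactComplex_inl_snd K P) hB aP
  · exact .comp hC hL hB' hT
      (.of_acyclic_cokernel hC (isShortExactComplex_inl_snd L Q) hB' aQ) q'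

end ExistsBinary

/-! ### `K₀ Ω[F]`, direct sums in `B[F]`, and the maps `i` and `p` -/

section Relative

variable {M : Type u₁} [Category.{v₁} M] [Preadditive M] [HasZeroObject M]
  [HasBinaryBiproducts M] [ExactCategory M]
  {N : Type u₂} [Category.{v₂} N] [Preadditive N] [HasZeroObject N]
  [HasBinaryBiproducts N] [ExactCategory N]
  {F : M ⥤ N} [F.Additive]

namespace K0Omega

lemma cls_add {X Y Z : RelBinary F} {f : RelBinary.Hom X Y} {g : RelBinary.Hom Y Z}
    (h : RelBinary.IsShortExactRel f g) : cls Y = cls X + cls Z := by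
  rw [← sub_eq_zero, ← sub_sub]
  exact (QuotientAddGroup.eq_zero_iff _).2
    (AddSubgroup.subset_closure (Or.inl (Or.inl ⟨X, Y, Z, f, g, h, rfl⟩)))

lemma cls_diag (X : RelComplex F) : cls (RelBinary.diag X) = 0 :=
  (QuotientAddGroup.eq_zero_iff _).2 (AddSubgroup.subset_closure (Or.inl (Or.inr ⟨X, rfl⟩)))

lemma cls_eq_of_isP {X Y : RelBinary F} (f : RelBinary.Hom X Y) (h : f.IsP) :
    cls X = cls Y := by
  rw [eq_comm, ← sub_eq_zero]
  exact (QuotientAddGroup.eq_zero_iff _).2 (AddSubgroup.subset_closure (Or.inr ⟨X, Y, f, h, rfl⟩))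

lemma hom_ext {G : Type*} [AddCommGroup G] {φ ψ : K0Omega F →+ G}
    (h : ∀ X, φ (cls X) = ψ (cls X)) : φ = ψ :=
  QuotientAddGroup.addMonoidHom_ext _ (FreeAbelianGroup.lift_ext _ _ fun X => h X)

/-- A function on the objects of `B[F]` respecting the relations induces a map on `K₀ Ω[F]`. -/
def lift {G : Type*} [AddCommGroup G] (φ : RelBinary F → G)
    (h : ∀ {X Y Z : RelBinary F} (f : RelBinary.Hom X Y) (g : RelBinary.Hom Y Z),
      RelBinary.IsShortExactRel f g → φ Y = φ X + φ Z)
    (h₀ : ∀ X : RelComplex F, φ (.diag X) = 0)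
    (h₁ : ∀ {X Y : RelBinary F} (f : RelBinary.Hom X Y), f.IsP → φ X = φ Y) : K0Omega F →+ G :=
  QuotientAddGroup.lift (AddSubgroup.closure (K0OmegaRelations F)) (FreeAbelianGroup.lift φ) (by
    rw [AddSubgroup.closure_le]
    rintro r ((⟨X, Y, Z, f, g, hfg, rfl⟩ | ⟨X, rfl⟩) | ⟨X, Y, f, hf, rfl⟩)
    · simp only [SetLike.mem_coe, AddMonoidHom.mem_ker, map_sub, FreeAbelianGroup.lift_apply_of]
      rw [h f g hfg]; abel
    · simp only [SetLike.mem_coe, AddMonoidHom.mem_ker, FreeAbelianGroup.lift_apply_of, h₀]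
    · simp only [SetLike.mem_coe, AddMonoidHom.mem_ker, map_sub, FreeAbelianGroup.lift_apply_of,
        h₁ f hf, sub_self])

end K0Omega

namespace RelBinary

/-- The map of objects `(0, N, 0)` induced by a map of acyclic binary complexes. -/
@[simps]
def ofAcyclicMap {A B : AcyclicBinaryComplex N} (f : A.cx ⟶ B.cx) :
    Hom (ofAcyclic F A) (ofAcyclic F B) where
  srcTop := 0
  srcBot := 0
  tar := f
  comm_top := by ext i; exact (F.map_isZero (isZero_zero M)).eq_of_src _ _
  comm_bot := by ext i; exact (F.map_isZero (isZero_zero M)).eq_of_src _ _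

lemma isShortExactRel_ofAcyclicMap {A B D : AcyclicBinaryComplex N} {f : A.cx ⟶ B.cx}
    {g : B.cx ⟶ D.cx} (h : BinaryComplex.IsShortExactBinary f g) :
    IsShortExactRel (ofAcyclicMap (F := F) f) (ofAcyclicMap g) :=
  have z := isShortExact_of_isZero (0 : (0 : M) ⟶ 0) (0 : (0 : M) ⟶ 0) (isZero_zero M)
    (isZero_zero M) (isZero_zero M)
  ⟨fun _ => z, fun _ => z, h⟩

/-- The object of `C[F]` of an acyclic complex. -/
def relOfAcyclic (K : ChainComplex N ℤ) (hb : IsBoundedGraded K.X) (ha : IsAcyclic K) :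
    RelComplex F where
  src := HomologicalComplex.zero
  src_bounded := isBoundedGraded_zero
  tar := K
  tar_bounded := hb
  comp := 0
  comp_quasiIso := IsQuasiIso.of_isZero _ (fun _ => F.map_isZero (isZero_zero M)) ha

/-- Composition of maps in `B[F]`. -/
@[simps]
def Hom.comp {X Y Z : RelBinary F} (f : Hom X Y) (g : Hom Y Z) : Hom X Z where
  srcTop := f.srcTop ≫ g.srcTop
  srcBot := f.srcBot ≫ g.srcBot
  tar := f.tar ≫ g.tar
  comm_top := by
    rw [Functor.map_comp, Category.assoc, g.comm_top, ← Category.assoc, f.comm_top,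
      Category.assoc, BinaryComplex.topMap_comp]
  comm_bot := by
    rw [Functor.map_comp, Category.assoc, g.comm_bot, ← Category.assoc, f.comm_bot,
      Category.assoc, BinaryComplex.botMap_comp]

instance : Category (RelBinary F) where
  Hom := Hom
  id := Hom.id
  comp := Hom.comp
  id_comp _ := Hom.ext (Category.id_comp _) (Category.id_comp _) (Category.id_comp _)
  comp_id _ := Hom.ext (Category.comp_id _) (Category.comp_id _) (Category.comp_id _)
  assoc _ _ _ := Hom.ext (Category.assoc _ _ _) (Category.assoc _ _ _) (Category.assoc _ _ _)

lemma isShortExact_map_inl_snd (X Y : M) :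
    IsShortExact (F.map (biprod.inl : X ⟶ X ⊞ Y)) (F.map (biprod.snd : X ⊞ Y ⟶ Y)) :=
  isShortExact_of_splitting (F.map biprod.fst) (F.map biprod.inr)
    (by simp [← F.map_comp]) (by simp [← F.map_comp])
    (by rw [← F.map_comp, biprod.inl_snd, F.map_zero])
    (by rw [← F.map_comp, ← F.map_comp, ← F.map_add, biprod.total, F.map_id])

lemma map_inl_lift {K L : M} {K' L' : N} (u : F.obj K ⟶ K') (v : F.obj L ⟶ L') :
    u ≫ biprod.inl = F.map (biprod.inl : K ⟶ K ⊞ L) ≫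
      biprod.lift (F.map biprod.fst ≫ u) (F.map biprod.snd ≫ v) := by
  ext <;> simp [← F.map_comp_assoc]

lemma map_lift_lift {T K L : M} {T' K' L' : N} {t : F.obj T ⟶ T'} {u : F.obj K ⟶ K'}
    {v : F.obj L ⟶ L'} {f : T ⟶ K} {g : T ⟶ L} {f' : T' ⟶ K'} {g' : T' ⟶ L'}
    (hf : F.map f ≫ u = t ≫ f') (hg : F.map g ≫ v = t ≫ g') :
    F.map (biprod.lift f g) ≫ biprod.lift (F.map biprod.fst ≫ u) (F.map biprod.snd ≫ v) =
      t ≫ biprod.lift f' g' := by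
  ext <;> simp [← F.map_comp_assoc, hf, hg]

variable (F) in
/-- The image of a direct sum of complexes maps to the direct sum of the targets. -/
abbrev sumComp {K L : ChainComplex M ℤ} {K' L' : ChainComplex N ℤ} (u : (mapC F).obj K ⟶ K')
    (v : (mapC F).obj L ⟶ L') : (mapC F).obj (sumC K L) ⟶ sumC K' L' :=
  sumC.lift ((mapC F).map (sumC.fst K L) ≫ u) ((mapC F).map (sumC.snd K L) ≫ v)

lemma sumComp_quasiIso {K L : ChainComplex M ℤ} {K' L' : ChainComplex N ℤ}
    {u : (mapC F).obj K ⟶ K'} {v : (mapC F).obj L ⟶ L'} (hK : IsBoundedGraded K.X)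
    (hL : IsBoundedGraded L.X) (hK' : IsBoundedGraded K'.X) (hL' : IsBoundedGraded L'.X)
    (hu : IsQuasiIso u) (hv : IsQuasiIso v) : IsQuasiIso (sumComp F u v) := by
  have h : IsShortExactComplex ((mapC F).map (sumC.inl K L)) ((mapC F).map (sumC.snd K L)) :=
    fun i => isShortExact_map_inl_snd _ _
  refine .ladder_middle h (isShortExactComplex_inl_snd K' L') ?_ ?_ ((hK.biprod hL).map F)
    (hK'.biprod hL') hu hv
  · refine HomologicalComplex.hom_ext _ _ fun i => ?_
    exact map_inl_lift (u.f i) (v.f i)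
  · ext i; simp

lemma sumComp_fst {K L : ChainComplex M ℤ} {K' L' : ChainComplex N ℤ}
    (u : (mapC F).obj K ⟶ K') (v : (mapC F).obj L ⟶ L') :
    sumComp F u v ≫ sumC.fst _ _ = (mapC F).map (sumC.fst K L) ≫ u := by
  ext i; simp

lemma sumComp_snd {K L : ChainComplex M ℤ} {K' L' : ChainComplex N ℤ}
    (u : (mapC F).obj K ⟶ K') (v : (mapC F).obj L ⟶ L') :
    sumComp F u v ≫ sumC.snd _ _ = (mapC F).map (sumC.snd K L) ≫ v := by
  ext i; simp

lemma map_sumC_lift_sumComp {T K L : ChainComplex M ℤ} {T' K' L' : ChainComplex N ℤ}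
    {t : (mapC F).obj T ⟶ T'} {u : (mapC F).obj K ⟶ K'} {v : (mapC F).obj L ⟶ L'} {f : T ⟶ K}
    {g : T ⟶ L} {f' : T' ⟶ K'} {g' : T' ⟶ L'} (hf : (mapC F).map f ≫ u = t ≫ f')
    (hg : (mapC F).map g ≫ v = t ≫ g') :
    (mapC F).map (sumC.lift f g) ≫ sumComp F u v = t ≫ sumC.lift f' g' := by
  refine HomologicalComplex.hom_ext _ _ fun i => ?_
  have h₁ := HomologicalComplex.congr_hom hf i
  have h₂ := HomologicalComplex.congr_hom hg i
  simp only [HomologicalComplex.comp_f, Functor.mapHomologicalComplex_map_f] at h₁ h₂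
  exact map_lift_lift h₁ h₂

/-- The direct sum of two objects of `B[F]`. -/
abbrev sum (X Y : RelBinary F) : RelBinary F where
  srcTop := sumC X.srcTop Y.srcTop
  srcBot := sumC X.srcBot Y.srcBot
  srcTop_bounded := X.srcTop_bounded.biprod Y.srcTop_bounded
  srcBot_bounded := X.srcBot_bounded.biprod Y.srcBot_bounded
  tar := .sum X.tar Y.tar
  tar_bounded := X.tar_bounded.biprod Y.tar_bounded
  compTop := sumComp F X.compTop Y.compTop
  compBot := sumComp F X.compBot Y.compBot
  compTop_quasiIso := sumComp_quasiIso X.srcTop_bounded Y.srcTop_bounded X.tar_bounded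
    Y.tar_bounded X.compTop_quasiIso Y.compTop_quasiIso
  compBot_quasiIso := sumComp_quasiIso X.srcBot_bounded Y.srcBot_bounded X.tar_bounded
    Y.tar_bounded X.compBot_quasiIso Y.compBot_quasiIso

/-- The first projection. -/
@[simps]
def sumFst (X Y : RelBinary F) : sum X Y ⟶ X where
  srcTop := sumC.fst _ _
  srcBot := sumC.fst _ _
  tar := BinaryComplex.fst _ _
  comm_top := (sumComp_fst _ _).symm
  comm_bot := (sumComp_fst _ _).symm

/-- The second projection. -/
@[simps]
def sumSnd (X Y : RelBinary F) : sum X Y ⟶ Y where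
  srcTop := sumC.snd _ _
  srcBot := sumC.snd _ _
  tar := BinaryComplex.snd _ _
  comm_top := (sumComp_snd _ _).symm
  comm_bot := (sumComp_snd _ _).symm

/-- The map into a direct sum with given components. -/
@[simps]
def sumLift {T X Y : RelBinary F} (f : T ⟶ X) (g : T ⟶ Y) : T ⟶ sum X Y where
  srcTop := sumC.lift (Hom.srcTop f) (Hom.srcTop g)
  srcBot := sumC.lift (Hom.srcBot f) (Hom.srcBot g)
  tar := BinaryComplex.homMk (fun i => biprod.lift (BinaryComplex.Hom.f (Hom.tar f) i)
      (BinaryComplex.Hom.f (Hom.tar g) i))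
    (fun i j => by ext <;> simp [BinaryComplex.Hom.comm])
    (fun i j => by ext <;> simp [BinaryComplex.Hom.comm'])
  comm_top := map_sumC_lift_sumComp (Hom.comm_top f) (Hom.comm_top g)
  comm_bot := map_sumC_lift_sumComp (Hom.comm_bot f) (Hom.comm_bot g)

/-- The zero map. -/
@[simps]
def Hom.zero (X Y : RelBinary F) : X ⟶ Y where
  srcTop := 0
  srcBot := 0
  tar := 0
  comm_top := by simp
  comm_bot := by simp

lemma isShortExactRel_sum (X Y : RelBinary F) :
    IsShortExactRel (sumLift (Hom.id X : X ⟶ X) (Hom.zero X Y)) (sumSnd X Y) :=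
  ⟨fun _ => isShortExact_of_splitting biprod.fst biprod.inr (biprod.lift_fst _ _) (by simp)
      (biprod.lift_snd _ _) (by ext <;> simp),
    fun _ => isShortExact_of_splitting biprod.fst biprod.inr (biprod.lift_fst _ _) (by simp)
      (biprod.lift_snd _ _) (by ext <;> simp),
    fun _ => isShortExact_of_splitting biprod.fst biprod.inr (biprod.lift_fst _ _) (by simp)
      (biprod.lift_snd _ _) (by ext <;> simp)⟩

variable (F) in
/-- The sum of two objects of `B[F]` is their product. -/
def sumIsLimit (X Y : RelBinary F) : IsLimit (BinaryFan.mk (sumFst X Y) (sumSnd X Y)) :=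
  BinaryFan.IsLimit.mk _ (fun f g => sumLift f g)
    (fun _ _ => Hom.ext (HomologicalComplex.hom_ext _ _ fun _ => biprod.lift_fst _ _)
      (HomologicalComplex.hom_ext _ _ fun _ => biprod.lift_fst _ _)
      (BinaryComplex.hom_ext fun _ => biprod.lift_fst _ _))
    (fun _ _ => Hom.ext (HomologicalComplex.hom_ext _ _ fun _ => biprod.lift_snd _ _)
      (HomologicalComplex.hom_ext _ _ fun _ => biprod.lift_snd _ _)
      (BinaryComplex.hom_ext fun _ => biprod.lift_snd _ _))
    (by
      rintro T f g m rfl rfl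
      refine Hom.ext (HomologicalComplex.hom_ext _ _ fun _ => ?_)
        (HomologicalComplex.hom_ext _ _ fun _ => ?_) (BinaryComplex.hom_ext fun _ => ?_) <;>
      exact biprod.hom_ext _ _ (biprod.lift_fst _ _).symm (biprod.lift_snd _ _).symm)

variable (F) in
/-- The zero object is terminal. -/
def zeroIsTerminal : IsTerminal (zero F) :=
  .ofUniqueHom (fun X => Hom.toZero X) fun _ _ => Hom.ext
    (HomologicalComplex.hom_ext _ _ fun _ => (isZero_zero M).eq_of_tgt _ _)
    (HomologicalComplex.hom_ext _ _ fun _ => (isZero_zero M).eq_of_tgt _ _)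
    (BinaryComplex.hom_ext fun _ => (isZero_zero N).eq_of_tgt _ _)

end RelBinary

variable (F) in
/-- The map from `K₁` of the target to `K₀ Ω[F]`. -/
def K1.toK0Omega : K1 N →+ K0Omega F :=
  K1.lift (fun Y => K0Omega.cls (.ofAcyclic F Y))
    (fun _ _ h => K0Omega.cls_add (RelBinary.isShortExactRel_ofAcyclicMap h))
    (fun K hb ha => K0Omega.cls_diag (RelBinary.relOfAcyclic K hb ha))

@[simp]
lemma K1.toK0Omega_cls (Y : AcyclicBinaryComplex N) :
    K1.toK0Omega F (K1.cls Y) = K0Omega.cls (.ofAcyclic F Y) :=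
  FreeAbelianGroup.lift_apply_of
    (fun Y : AcyclicBinaryComplex N => K0Omega.cls (RelBinary.ofAcyclic F Y)) Y

variable (F) in
/-- The map from `K₀ Ω[F]` to `K₀` of the source. -/
def K0Omega.toK0 : K0Omega F →+ K0 M :=
  K0Omega.lift (fun X => eulerChar X.srcTop - eulerChar X.srcBot)
    (fun {X Y Z} _ _ h => by
      rw [eulerChar_add h.1 Y.srcTop_bounded, eulerChar_add h.2.1 Y.srcBot_bounded]; abel)
    (fun X => sub_self _)
    (fun {X Y} _ h => by
      rw [h.1.eulerChar_eq X.srcTop_bounded Y.srcTop_bounded,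
        h.2.1.eulerChar_eq X.srcBot_bounded Y.srcBot_bounded])

@[simp]
lemma K0Omega.toK0_cls (X : RelBinary F) :
    K0Omega.toK0 F (K0Omega.cls X) = eulerChar X.srcTop - eulerChar X.srcBot :=
  FreeAbelianGroup.lift_apply_of (fun X : RelBinary F => eulerChar X.srcTop - eulerChar X.srcBot) X

lemma K0Omega.map_toK0 (hF : IsExactFunctor F) (x : K0Omega F) :
    K0.map F hF (K0Omega.toK0 F x) = 0 := by
  have : (K0.map F hF).comp (K0Omega.toK0 F) = 0 := by
    refine K0Omega.hom_ext fun X => ?_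
    rw [AddMonoidHom.comp_apply, K0Omega.toK0_cls, map_sub, K0.map_eulerChar F hF X.srcTop_bounded,
      K0.map_eulerChar F hF X.srcBot_bounded,
      X.compTop_quasiIso.eulerChar_eq (X.srcTop_bounded.map F) X.tar_bounded,
      X.compBot_quasiIso.eulerChar_eq (X.srcBot_bounded.map F) X.tar_bounded]
    exact sub_self _
  exact DFunLike.congr_fun this x

end Relative

/-! ### The value as a partially defined invariant -/

section HasVal

variable {M : Type u₁} [Category.{v₁} M] [Preadditive M] [HasZeroObject M]
  [HasBinaryBiproducts M] [ExactCategory M]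
  {N : Type u₂} [Category.{v₂} N] [Preadditive N] [HasZeroObject N]
  [HasBinaryBiproducts N] [ExactCategory N]
  {F : M ⥤ N} [F.Additive]

namespace RelBinary

/-- The object of `B[F]` with top and bottom exchanged. -/
abbrev swap (X : RelBinary F) : RelBinary F where
  srcTop := X.srcBot
  srcBot := X.srcTop
  srcTop_bounded := X.srcBot_bounded
  srcBot_bounded := X.srcTop_bounded
  tar := X.tar.swap
  tar_bounded := X.tar_bounded
  compTop := X.compBot
  compBot := X.compTop
  compTop_quasiIso := X.compBot_quasiIso
  compBot_quasiIso := X.compTop_quasiIso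

/-- The direct sum of two maps. -/
def sumMap {X Y X' Y' : RelBinary F} (f : Hom X Y) (f' : Hom X' Y') :
    Hom (sum X X') (sum Y Y') :=
  sumLift (Hom.comp (sumFst X X') f : sum X X' ⟶ Y) (Hom.comp (sumSnd X X') f' : sum X X' ⟶ Y')

lemma biprod_lift_fst_snd {C : Type*} [Category C] [Preadditive C] [HasBinaryBiproducts C]
    {A B A' B' : C} (a : A ⟶ B) (b : A' ⟶ B') :
    biprod.lift (biprod.fst ≫ a) (biprod.snd ≫ b) = biprod.map a b := by
  ext <;> simp

lemma isIso_biprod_map {C : Type*} [Category C] [Preadditive C] [HasBinaryBiproducts C]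
    {A B A' B' : C} (a : A ⟶ B) (b : A' ⟶ B') [IsIso a] [IsIso b] : IsIso (biprod.map a b) :=
  inferInstanceAs (IsIso (biprod.mapIso (asIso a) (asIso b)).hom)

lemma sumMap_srcTop {X Y X' Y' : RelBinary F} (f : Hom X Y) (f' : Hom X' Y') :
    (sumMap f f').srcTop = sumC.map f.srcTop f'.srcTop :=
  HomologicalComplex.hom_ext _ _ fun _ => biprod_lift_fst_snd _ _

lemma sumMap_srcBot {X Y X' Y' : RelBinary F} (f : Hom X Y) (f' : Hom X' Y') :
    (sumMap f f').srcBot = sumC.map f.srcBot f'.srcBot :=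
  HomologicalComplex.hom_ext _ _ fun _ => biprod_lift_fst_snd _ _

lemma sumMap_tar_f {X Y X' Y' : RelBinary F} (f : Hom X Y) (f' : Hom X' Y') (i : ℤ) :
    BinaryComplex.Hom.f (sumMap f f').tar i =
      biprod.map (BinaryComplex.Hom.f f.tar i) (BinaryComplex.Hom.f f'.tar i) :=
  biprod_lift_fst_snd _ _

lemma IsShortExactRel.sumMap {X Y Z X' Y' Z' : RelBinary F} {f : Hom X Y} {g : Hom Y Z}
    {f' : Hom X' Y'} {g' : Hom Y' Z'} (h : IsShortExactRel f g) (h' : IsShortExactRel f' g') :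
    IsShortExactRel (sumMap f f') (sumMap g g') := by
  refine ⟨?_, ?_, fun i => ?_⟩
  · rw [sumMap_srcTop, sumMap_srcTop]; exact h.1.map h'.1
  · rw [sumMap_srcBot, sumMap_srcBot]; exact h.2.1.map h'.2.1
  · rw [sumMap_tar_f, sumMap_tar_f]; exact (h.2.2 i).biprod_map (h'.2.2 i)

lemma IsQuasiIso.sumC_map {C : Type u} [Category.{v} C] [Preadditive C] [HasZeroObject C]
    [HasBinaryBiproducts C] [ExactCategory C] {K L K' L' : ChainComplex C ℤ} {φ : K ⟶ L}
    {φ' : K' ⟶ L'} (h : IsQuasiIso φ) (h' : IsQuasiIso φ') (bK : IsBoundedGraded K.X)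
    (bL : IsBoundedGraded L.X) (bK' : IsBoundedGraded K'.X) (bL' : IsBoundedGraded L'.X) :
    IsQuasiIso (sumC.map φ φ') :=
  .ladder_middle (isShortExactComplex_inl_snd K K') (isShortExactComplex_inl_snd L L')
    (by ext i <;> simp) (by ext i <;> simp) (bK.biprod bK') (bL.biprod bL') h h'

lemma Hom.IsP.sumMap {X Y X' Y' : RelBinary F} {f : Hom X Y} {f' : Hom X' Y'} (h : f.IsP)
    (h' : f'.IsP) : (sumMap f f').IsP := by
  refine ⟨?_, ?_, ?_⟩
  · rw [sumMap_srcTop]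
    exact IsQuasiIso.sumC_map h.1 h'.1 X.srcTop_bounded Y.srcTop_bounded X'.srcTop_bounded
      Y'.srcTop_bounded
  · rw [sumMap_srcBot]
    exact IsQuasiIso.sumC_map h.2.1 h'.2.1 X.srcBot_bounded Y.srcBot_bounded X'.srcBot_bounded
      Y'.srcBot_bounded
  · have := h.2.2
    have := h'.2.2
    have : ∀ i, IsIso (BinaryComplex.Hom.f (RelBinary.sumMap f f').tar i) := fun i => by
      rw [sumMap_tar_f]; exact isIso_biprod_map _ _
    exact BinaryComplex.isIso_of_components _

lemma Hom.isP_id (X : RelBinary F) : (Hom.id X).IsP :=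
  ⟨isQuasiIso_id _, isQuasiIso_id _, inferInstanceAs (IsIso (𝟙 X.tar))⟩

lemma isP_of_iso (hM : SupportsLongExactSequences M) {X Y : RelBinary F} (e : X ≅ Y) :
    Hom.IsP e.hom := by
  have h₁ : IsIso (Hom.srcTop e.hom) := ⟨Hom.srcTop e.inv,
    congrArg Hom.srcTop e.hom_inv_id, congrArg Hom.srcTop e.inv_hom_id⟩
  have h₂ : IsIso (Hom.srcBot e.hom) := ⟨Hom.srcBot e.inv,
    congrArg Hom.srcBot e.hom_inv_id, congrArg Hom.srcBot e.inv_hom_id⟩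
  exact ⟨isQuasiIso_of_isIso hM _ X.srcTop_bounded, isQuasiIso_of_isIso hM _ X.srcBot_bounded,
    ⟨Hom.tar e.inv, congrArg Hom.tar e.hom_inv_id, congrArg Hom.tar e.inv_hom_id⟩⟩

variable (hM : SupportsLongExactSequences M) (hN : SupportsLongExactSequences N)
  (hF : IsExactFunctor F)

/-- The object of `B[F]` has a binary complex over it, and its class is the given one. -/
def HasVal (X : RelBinary F) (g : K1Coker F hF) : Prop := ∃ o : Over X, o.gval hN hF = g

variable {hN hF}

lemma HasVal.eulerChar_eq {X : RelBinary F} {g : K1Coker F hF} (h : HasVal hN hF X g) :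
    eulerChar X.srcTop = eulerChar X.srcBot := by
  obtain ⟨o, -⟩ := h
  rw [← o.qa.eulerChar_eq o.bounded X.srcTop_bounded,
    ← o.qb.eulerChar_eq o.bounded X.srcBot_bounded]
  -- The top and the bottom of `o.B` have the same graded object.
  rfl

variable (hN hF) in
lemma exists_hasVal (hM : SupportsLongExactSequences M) {X : RelBinary F}
    (h : eulerChar X.srcTop = eulerChar X.srcBot) : ∃ g, HasVal hN hF X g := by
  obtain ⟨B, hB, a, b, -, -, qa, qb, -, -⟩ :=
    exists_binaryComplex hM X.srcTop_bounded X.srcBot_bounded h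
  exact ⟨_, ⟨B, hB, a, b, qa, qb⟩, rfl⟩

lemma HasVal.unique (hM : SupportsLongExactSequences M) {X : RelBinary F} {g g' : K1Coker F hF}
    (h : HasVal hN hF X g) (h' : HasVal hN hF X g') : g = g' := by
  obtain ⟨o, rfl⟩ := h
  obtain ⟨o', rfl⟩ := h'
  exact Over.gval_eq hN hF hM o o'

/-- Euler characteristics add, so some complex lies over `Y`. By uniqueness the complex that
`Over.quot` puts over `Z` has the given value `z`. -/
lemma HasVal.add (hM : SupportsLongExactSequences M) {X Y Z : RelBinary F} {f : Hom X Y}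
    {g : Hom Y Z} (h : IsShortExactRel f g) {x z : K1Coker F hF} (hX : HasVal hN hF X x)
    (hZ : HasVal hN hF Z z) : HasVal hN hF Y (x + z) := by
  obtain ⟨y, oY, rfl⟩ := exists_hasVal hN hF hM (X := Y) (by
    rw [eulerChar_add h.1 Y.srcTop_bounded, eulerChar_add h.2.1 Y.srcBot_bounded,
      hX.eulerChar_eq, hZ.eulerChar_eq])
  obtain ⟨oX, rfl⟩ := hX
  refine ⟨oY, ?_⟩
  rw [Over.gval_quot oX oY hM h hN hF, HasVal.unique hM ⟨_, rfl⟩ hZ]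

lemma HasVal.sum (hM : SupportsLongExactSequences M) {X Y : RelBinary F} {x y : K1Coker F hF}
    (hX : HasVal hN hF X x) (hY : HasVal hN hF Y y) : HasVal hN hF (sum X Y) (x + y) :=
  .add hM (isShortExactRel_sum X Y) hX hY

/-- The complex over `X` lies over `Y` by composition, and the cone changes only by the isomorphism
of targets. -/
lemma HasVal.of_isP (hM : SupportsLongExactSequences M) {X Y : RelBinary F} {f : Hom X Y}
    (h : f.IsP) {x : K1Coker F hF} (hX : HasVal hN hF X x) : HasVal hN hF Y x := by
  obtain ⟨o, rfl⟩ := hX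
  let o' : Over Y :=
    { B := o.B
      bounded := o.bounded
      a := o.a ≫ f.srcTop
      b := o.b ≫ f.srcBot
      qa := o.qa.comp hM o.bounded X.srcTop_bounded Y.srcTop_bounded h.1
      qb := o.qb.comp hM o.bounded X.srcBot_bounded Y.srcBot_bounded h.2.1 }
  refine ⟨o', ?_⟩
  have e₁ : (mapC F).map (o.a ≫ f.srcTop) ≫ Y.compTop =
      ((mapC F).map o.a ≫ X.compTop) ≫ BinaryComplex.topMap f.tar := by
    rw [Functor.map_comp, Category.assoc, f.comm_top, Category.assoc]
  have e₂ : (mapC F).map (o.b ≫ f.srcBot) ≫ Y.compBot =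
      ((mapC F).map o.b ≫ X.compBot) ≫ BinaryComplex.botMap f.tar := by
    rw [Functor.map_comp, Category.assoc, f.comm_bot, Category.assoc]
  have h₁ : o.compTop ≫ BinaryComplex.topMap f.tar =
      BinaryComplex.topMap (𝟙 (o.B.map F)) ≫ o'.compTop := e₁.symm.trans (Category.id_comp _).symm
  have h₂ : o.compBot ≫ BinaryComplex.botMap f.tar =
      BinaryComplex.botMap (𝟙 (o.B.map F)) ≫ o'.compBot := e₂.symm.trans (Category.id_comp _).symm
  have := h.2.2
  have i : ∀ i, IsIso (BinaryComplex.Hom.f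
      (BinaryComplex.coneMap (𝟙 (o.B.map F)) f.tar h₁ h₂) i) := fun i =>
    isIso_biprod_map _ _
  have e : o.val hN hF = o'.val hN hF :=
    K1.cls_of_isIso (BinaryComplex.coneMap (𝟙 (o.B.map F)) f.tar h₁ h₂)
  rw [Over.gval, Over.gval, e]

variable (hN hF) in
lemma hasVal_diag (X : RelComplex F) : HasVal hN hF (diag X) 0 := by
  refine ⟨⟨.diag X.src, X.src_bounded, 𝟙 _, 𝟙 _, isQuasiIso_id _, isQuasiIso_id _⟩, ?_⟩
  exact (congrArg (QuotientAddGroup.mk' (K1.map F hF).range) (K1.cls_of_d_eq _ rfl)).trans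
    (map_zero _)

variable (hN hF) in
lemma hasVal_ofAcyclic (Y : AcyclicBinaryComplex N) :
    HasVal hN hF (ofAcyclic F Y) (QuotientAddGroup.mk (K1.cls Y)) := by
  refine ⟨⟨.zero, isBoundedGraded_zero, 𝟙 _, 𝟙 _, isQuasiIso_id _, isQuasiIso_id _⟩, ?_⟩
  exact congrArg (QuotientAddGroup.mk' (K1.map F hF).range) (coneCls_of_source_isZero _ _ _ _
    (fun _ => F.map_isZero (isZero_zero M)) Y.acyclic_top Y.acyclic_bot)

end RelBinary

end HasVal

/-! ### From the partial invariant to `K₀ Ω[F]` -/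

section RelClass

variable {M : Type u₁} [Category.{v₁} M] [Preadditive M] [HasZeroObject M]
  [HasBinaryBiproducts M] [ExactCategory M]
  {N : Type u₂} [Category.{v₂} N] [Preadditive N] [HasZeroObject N]
  [HasBinaryBiproducts N] [ExactCategory N]

/-- The monoid of isomorphism classes of `B[F]`, under direct sum. -/
def RelClass (F : M ⥤ N) [F.Additive] : Type _ := Additive (Skeleton (RelBinary F))

variable {F : M ⥤ N} [F.Additive]

instance : AddCommMonoid (RelClass F) :=
  isoClassMonoid ⟨_, RelBinary.zeroIsTerminal F⟩ fun X Y => ⟨_, RelBinary.sumIsLimit F X Y⟩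

namespace RelClass

/-- The isomorphism class of an object of `B[F]`. -/
def mk (X : RelBinary F) : RelClass F := Additive.ofMul (toSkeleton X)

lemma mk_eq_iff {X Y : RelBinary F} : mk X = mk Y ↔ Nonempty (X ≅ Y) :=
  toSkeleton_eq_toSkeleton_iff

lemma exists_eq_mk (x : RelClass F) : ∃ X, x = mk X :=
  ⟨_, (toSkeleton_fromSkeleton_obj (C := RelBinary F) x).symm⟩

lemma mk_sum (X Y : RelBinary F) : mk (.sum X Y) = mk X + mk Y :=
  (isoClassMonoid_add (D := RelBinary F) ⟨_, RelBinary.zeroIsTerminal F⟩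
    (fun X Y => ⟨_, RelBinary.sumIsLimit F X Y⟩) X Y).symm

lemma mk_zero : mk (.zero F) = 0 := rfl

variable (hM : SupportsLongExactSequences M) (hN : SupportsLongExactSequences N)
  (hF : IsExactFunctor F)

/-- The isomorphism classes of two objects with the same value. -/
def SameVal (x y : RelClass F) : Prop :=
  ∃ X Y g, x = mk X ∧ y = mk Y ∧ RelBinary.HasVal hN hF X g ∧ RelBinary.HasVal hN hF Y g

variable {hN hF}

lemma SameVal.symm {x y : RelClass F} : SameVal hN hF x y → SameVal hN hF y x :=
  fun ⟨X, Y, g, hx, hy, hX, hY⟩ => ⟨Y, X, g, hy, hx, hY, hX⟩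

variable (hN hF) in
lemma SameVal.zero : SameVal hN hF 0 0 :=
  have h := RelBinary.hasVal_ofAcyclic (F := F) hN hF .zero
  ⟨.zero F, .zero F, _, rfl, rfl, h, h⟩

lemma SameVal.add (hM : SupportsLongExactSequences M) {x y x' y' : RelClass F} : SameVal hN hF x y → SameVal hN hF x' y' →
    SameVal hN hF (x + x') (y + y') :=
  fun ⟨X, Y, g, hx, hy, hX, hY⟩ ⟨X', Y', g', hx', hy', hX', hY'⟩ =>
    ⟨.sum X X', .sum Y Y', g + g', by rw [hx, hx', mk_sum], by rw [hy, hy', mk_sum],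
      hX.sum hM hX', hY.sum hM hY'⟩

variable (hN hF) in
/-- Pairs of isomorphism classes, seen as formal differences, modulo differences of objects with
the same value. -/
def con : AddCon (RelClass F × RelClass F) where
  -- Formally `a - b = v - u`, a difference of two objects of equal value. The cancelling term `c`
  -- is arbitrary and may have no value itself.
  r a b := ∃ c u v, SameVal hN hF u v ∧ a.1 + b.2 + c + u = b.1 + a.2 + c + v
  iseqv :=
    { refl := fun a => ⟨0, 0, 0, .zero hN hF, rfl⟩
      symm := fun ⟨c, u, v, h, e⟩ => ⟨c, v, u, h.symm, e.symm⟩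
      trans := fun {a b d} ⟨c, u, v, h, e⟩ ⟨c', u', v', h', e'⟩ =>
        ⟨b.1 + b.2 + c + c', u + u', v + v', SameVal.add hM h h', by
          calc a.1 + d.2 + (b.1 + b.2 + c + c') + (u + u')
              = (a.1 + b.2 + c + u) + (b.1 + d.2 + c' + u') := by abel
            _ = (b.1 + a.2 + c + v) + (d.1 + b.2 + c' + v') := by rw [e, e']
            _ = _ := by abel⟩ }
  add' := fun {a b d f} ⟨c, u, v, h, e⟩ ⟨c', u', v', h', e'⟩ =>
    ⟨c + c', u + u', v + v', SameVal.add hM h h', by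
      calc (a.1 + d.1) + (b.2 + f.2) + (c + c') + (u + u')
          = (a.1 + b.2 + c + u) + (d.1 + f.2 + c' + u') := by abel
        _ = (b.1 + a.2 + c + v) + (f.1 + d.2 + c' + v') := by rw [e, e']
        _ = _ := by simp only [Prod.fst_add, Prod.snd_add]; abel⟩

variable (hN hF) in
/-- The quotient of the monoid of formal differences. -/
def Diff : Type _ := (con hM hN hF).Quotient

instance : AddCommMonoid (Diff hM hN hF) :=
  inferInstanceAs (AddCommMonoid (con hM hN hF).Quotient)

variable (hN hF) in
/-- The class of a formal difference. -/
def diff : RelClass F × RelClass F →+ Diff hM hN hF := (con hM hN hF).mk'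

lemma diff_eq_iff {a b : RelClass F × RelClass F} : diff hM hN hF a = diff hM hN hF b ↔
    ∃ c u v, SameVal hN hF u v ∧ a.1 + b.2 + c + u = b.1 + a.2 + c + v :=
  (con hM hN hF).eq

variable (hN hF) in
/-- The class of an object of `B[F]` in the group of formal differences. -/
def unit (X : RelBinary F) : AddUnits (Diff hM hN hF) where
  val := diff hM hN hF (mk X, 0)
  neg := diff hM hN hF (0, mk X)
  val_neg := by
    rw [← map_add, ← map_zero (diff hM hN hF), diff_eq_iff]
    exact ⟨0, 0, 0, .zero hN hF, by simp⟩
  neg_val := by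
    rw [← map_add, ← map_zero (diff hM hN hF), diff_eq_iff]
    exact ⟨0, 0, 0, .zero hN hF, by simp⟩

/-- Adding the swap of `Y` balances the sources. The case `Y = X` makes every object a summand of
one with a value. -/
lemma eulerChar_sum_swap_eq {X Y : RelBinary F}
    (h : eulerChar X.srcTop - eulerChar X.srcBot = eulerChar Y.srcTop - eulerChar Y.srcBot) :
    eulerChar (RelBinary.sum X Y.swap).srcTop = eulerChar (RelBinary.sum X Y.swap).srcBot := by
  rw [eulerChar_sumC X.srcTop_bounded Y.srcBot_bounded,
    eulerChar_sumC X.srcBot_bounded Y.srcTop_bounded]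
  rw [sub_eq_sub_iff_add_eq_add] at h
  rw [h, add_comm]

variable (hN hF) in
lemma exists_hasVal_sum_swap (hM : SupportsLongExactSequences M) (X : RelBinary F) :
    ∃ g, RelBinary.HasVal hN hF (.sum X X.swap) g :=
  RelBinary.exists_hasVal hN hF hM (eulerChar_sum_swap_eq rfl)

variable (hN hF) in
/-- The map from `K₀ Ω[F]` to the group of formal differences. -/
def ofK0Omega : K0Omega F →+ AddUnits (Diff hM hN hF) :=
  K0Omega.lift (unit hM hN hF)
    (fun {X Y Z} f g h => by
      apply AddUnits.ext
      change diff hM hN hF (mk Y, 0) = diff hM hN hF (mk X, 0) + diff hM hN hF (mk Z, 0)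
      rw [← map_add, diff_eq_iff]
      obtain ⟨x, hx⟩ := exists_hasVal_sum_swap hN hF hM X
      obtain ⟨z, hz⟩ := exists_hasVal_sum_swap hN hF hM Z
      -- None of `X`, `Y`, `Z` need have a value, so `X.swap` and `Z.swap` are added. Then `Y ⊕
      -- (X.swap ⊕ Z.swap)` is an extension of `Z ⊕ Z.swap` by `X ⊕ X.swap`, with the same value as
      -- their direct sum.
      refine ⟨mk X.swap + mk Z.swap, mk (.sum (.sum X X.swap) (.sum Z Z.swap)),
        mk (.sum Y (.sum X.swap Z.swap)), ⟨_, _, _, rfl, rfl, hx.sum hM hz,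
          hx.add hM (h.sumMap (RelBinary.isShortExactRel_sum X.swap Z.swap)) hz⟩, ?_⟩
      simp only [mk_sum, Prod.fst_add, Prod.snd_add, add_zero]
      abel)
    (fun X => by
      apply AddUnits.ext
      change diff hM hN hF (mk _, 0) = 0
      rw [← map_zero (diff hM hN hF), diff_eq_iff]
      have h := RelBinary.hasVal_ofAcyclic (F := F) hN hF .zero
      rw [K1.cls_of_isZero _ fun _ => isZero_zero N] at h
      exact ⟨0, mk (.zero F), mk (.diag X), ⟨_, _, _, rfl, rfl, h,
        RelBinary.hasVal_diag hN hF X⟩, by simp [mk_zero]⟩)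
    (fun {X Y} f h => by
      apply AddUnits.ext
      change diff hM hN hF (mk X, 0) = diff hM hN hF (mk Y, 0)
      rw [diff_eq_iff]
      obtain ⟨x, hx⟩ := exists_hasVal_sum_swap hN hF hM X
      refine ⟨mk X.swap, mk (.sum Y X.swap), mk (.sum X X.swap), ⟨_, _, _, rfl, rfl,
        hx.of_isP hM (h.sumMap (RelBinary.Hom.isP_id X.swap)), hx⟩, ?_⟩
      simp only [mk_sum, add_zero]
      abel)

lemma ofK0Omega_cls (X : RelBinary F) :
    ofK0Omega hM hN hF (K0Omega.cls X) = unit hM hN hF X :=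
  FreeAbelianGroup.lift_apply_of (unit hM hN hF) X

/-- Objects with the same class in `K₀ Ω[F]` have the same value. -/
lemma _root_.RelK.RelBinary.HasVal.eq_of_cls_eq (hM : SupportsLongExactSequences M)
    {X Y : RelBinary F}
    (h : K0Omega.cls X = K0Omega.cls Y) {x y : K1Coker F hF} (hX : RelBinary.HasVal hN hF X x)
    (hY : RelBinary.HasVal hN hF Y y) : x = y := by
  have e := congrArg (fun t => (ofK0Omega hM hN hF t).val) h
  simp only [ofK0Omega_cls] at e
  obtain ⟨c, u, v, ⟨U, V, g, rfl, rfl, hU, hV⟩, e⟩ := (diff_eq_iff hM).1 e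
  obtain ⟨C, rfl⟩ := c.exists_eq_mk
  -- Adding `C.swap` as well completes `C` to an object with a value. Both sides then have values,
  -- which are compared by uniqueness and cancelled in the group `K1Coker`.
  obtain ⟨c, hc⟩ := exists_hasVal_sum_swap hN hF hM C
  have e' : mk (.sum (.sum X (.sum C C.swap)) U) = mk (.sum (.sum Y (.sum C C.swap)) V) := by
    simp only [mk_sum, add_zero] at e ⊢
    calc _ = (mk X + mk C + mk U) + mk C.swap := by abel
      _ = (mk Y + mk C + mk V) + mk C.swap := by rw [e]
      _ = _ := by abel
  obtain ⟨i⟩ := mk_eq_iff.1 e'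
  have := (((hX.sum hM hc).sum hM hU).of_isP hM (RelBinary.isP_of_iso hM i)).unique hM
    ((hY.sum hM hc).sum hM hV)
  simpa using this

end RelClass

end RelClass

/-! ### The exact sequence -/

section ExactSequence

variable {M : Type u₁} [Category.{v₁} M] [Preadditive M] [HasZeroObject M]
  [HasBinaryBiproducts M] [ExactCategory M]
  {N : Type u₂} [Category.{v₂} N] [Preadditive N] [HasZeroObject N]
  [HasBinaryBiproducts N] [ExactCategory N]
  {F : M ⥤ N} [F.Additive]

variable (hM : SupportsLongExactSequences M) (hN : SupportsLongExactSequences N)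
  (hF : IsExactFunctor F)

variable (F) in
/-- The image of a binary complex of the source, as an object of `B[F]`. -/
abbrev RelBinary.ofBinary (B : BinaryComplex M)
    (hB : IsBoundedGraded B.X) : RelBinary F where
  srcTop := B.top
  srcBot := B.bot
  srcTop_bounded := hB
  srcBot_bounded := hB
  tar := B.map F
  tar_bounded := hB.map F
  compTop := 𝟙 ((mapC F).obj B.top)
  compBot := 𝟙 ((mapC F).obj B.bot)
  compTop_quasiIso := isQuasiIso_id _
  compBot_quasiIso := isQuasiIso_id _

/-- The map of objects of `B[F]` induced by a map of binary complexes. -/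
abbrev RelBinary.ofBinaryMap {A B : BinaryComplex M} (hA : IsBoundedGraded A.X)
    (hB : IsBoundedGraded B.X) (f : A ⟶ B) :
    RelBinary.Hom (RelBinary.ofBinary F A hA) (RelBinary.ofBinary F B hB) where
  srcTop := BinaryComplex.topMap f
  srcBot := BinaryComplex.botMap f
  tar := BinaryComplex.mapHom F f
  comm_top := (Category.comp_id ((mapC F).map (BinaryComplex.topMap f))).trans
    (Category.id_comp ((mapC F).map (BinaryComplex.topMap f))).symm
  comm_bot := (Category.comp_id ((mapC F).map (BinaryComplex.botMap f))).trans
    (Category.id_comp ((mapC F).map (BinaryComplex.botMap f))).symm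

/-- The class is additive in `B` and zero for diagonal `B`, so `BinaryComplex.eq_zero_of_additive`
applies. -/
lemma K0Omega.cls_ofBinary (hF : IsExactFunctor F) (B : BinaryComplex M)
    (hB : IsBoundedGraded B.X) : K0Omega.cls (RelBinary.ofBinary F B hB) = 0 := by
  refine BinaryComplex.eq_zero_of_additive
    (fun B hB => K0Omega.cls (RelBinary.ofBinary F B hB)) ?_ ?_ B hB
  · intro X Y Z hX hY hZ f g h
    exact K0Omega.cls_add (f := RelBinary.ofBinaryMap hX hY f) (g := RelBinary.ofBinaryMap hY hZ g)
      ⟨h, h, h.map hF⟩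
  · intro K hK
    exact K0Omega.cls_diag ⟨K, hK, (mapC F).obj K, hK.map F, 𝟙 _, isQuasiIso_id _⟩

/-- For acyclic `X` the map `(0, F X, 0) ⟶ (X, F X, 1)` belongs to `p`, and its target has class
zero by `K0Omega.cls_ofBinary`. -/
lemma K1.toK0Omega_map (hM : SupportsLongExactSequences M) (hF : IsExactFunctor F) (x : K1 M) :
    K1.toK0Omega F (K1.map F hF x) = 0 := by
  have : (K1.toK0Omega F).comp (K1.map F hF) = 0 := by
    refine QuotientAddGroup.addMonoidHom_ext _ (FreeAbelianGroup.lift_ext _ _ fun X => ?_)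
    change K1.toK0Omega F (K1.map F hF (K1.cls X)) = 0
    rw [K1.map_cls, K1.toK0Omega_cls, ← K0Omega.cls_ofBinary hF X.cx X.bounded]
    refine K0Omega.cls_eq_of_isP
      ⟨0, 0, 𝟙 (X.cx.map F), ?_, ?_⟩ ⟨?_, ?_, ?_⟩
    · ext i; exact (F.map_isZero (isZero_zero M)).eq_of_src _ _
    · ext i; exact (F.map_isZero (isZero_zero M)).eq_of_src _ _
    · exact (isQuasiIso_iff_of_acyclic_source hM _ isBoundedGraded_zero X.bounded
        isAcyclic_zero).2 X.acyclic_top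
    · exact (isQuasiIso_iff_of_acyclic_source hM _ isBoundedGraded_zero X.bounded
        isAcyclic_zero).2 X.acyclic_bot
    · exact inferInstanceAs (IsIso (𝟙 (X.cx.map F)))
  exact DFunLike.congr_fun this x

lemma K1.exists_sub {C : Type u} [Category.{v} C] [Preadditive C] [HasZeroObject C]
    [HasBinaryBiproducts C] [ExactCategory C] (x : K1 C) :
    ∃ A B : AcyclicBinaryComplex C, x = K1.cls A - K1.cls B := by
  obtain ⟨x, rfl⟩ := QuotientAddGroup.mk'_surjective _ x
  refine FreeAbelianGroup.exists_of_sub_of (G := K1 C) _ .zero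
    (K1.cls_of_isZero _ fun _ => isZero_zero C)
    (fun X Y => ⟨.sum X.cx Y.cx, X.bounded.biprod Y.bounded,
      X.acyclic_top.sumC Y.acyclic_top X.bounded Y.bounded,
      X.acyclic_bot.sumC Y.acyclic_bot X.bounded Y.bounded⟩) (fun X Y => ?_) x
  exact K1.cls_add (X := X) (Z := Y) (Y := ⟨.sum X.cx Y.cx, X.bounded.biprod Y.bounded,
      X.acyclic_top.sumC Y.acyclic_top X.bounded Y.bounded,
      X.acyclic_bot.sumC Y.acyclic_bot X.bounded Y.bounded⟩) _ _
    (BinaryComplex.isShortExactBinary_inl_snd X.cx Y.cx)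

theorem exact_map_toK0Omega (hM : SupportsLongExactSequences M)
    (hN : SupportsLongExactSequences N) (hF : IsExactFunctor F) :
    Function.Exact (K1.map F hF) (K1.toK0Omega F) := by
  intro y
  constructor
  · intro h
    obtain ⟨A, B, rfl⟩ := K1.exists_sub y
    rw [map_sub, K1.toK0Omega_cls, K1.toK0Omega_cls, sub_eq_zero] at h
    have := RelBinary.HasVal.eq_of_cls_eq hM h (RelBinary.hasVal_ofAcyclic hN hF A)
      (RelBinary.hasVal_ofAcyclic hN hF B)
    have := QuotientAddGroup.eq.1 this.symm
    rwa [neg_add_eq_sub] at this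
  · rintro ⟨x, rfl⟩
    exact K1.toK0Omega_map hM hF x

/-- The degree shift of a binary complex. -/
abbrev BinaryComplex.shift {C : Type u} [Category.{v} C] [Preadditive C] (B : BinaryComplex C) :
    BinaryComplex C where
  X i := B.X (i - 1)
  d := (RelK.shift B.top).d
  d' := (RelK.shift B.bot).d
  shape := (RelK.shift B.top).shape
  shape' := (RelK.shift B.bot).shape
  d_comp_d := (RelK.shift B.top).d_comp_d
  d'_comp_d' := (RelK.shift B.bot).d_comp_d

namespace RelBinary

/-- The comparison map of the cone of the identity. -/
abbrev coneComp {K : ChainComplex M ℤ} {L : ChainComplex N ℤ} (u : (mapC F).obj K ⟶ L) :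
    (mapC F).obj (cone (𝟙 K)) ⟶ cone u :=
  (mapConeIso F (𝟙 K)).hom ≫ coneMap (𝟙 _) u (by simp)

lemma coneComp_quasiIso (hN : SupportsLongExactSequences N) (hF : IsExactFunctor F)
    {K : ChainComplex M ℤ} {L : ChainComplex N ℤ} {u : (mapC F).obj K ⟶ L}
    (hK : IsBoundedGraded K.X) (hL : IsBoundedGraded L.X) (h : IsQuasiIso u) :
    IsQuasiIso (coneComp u) :=
  (isQuasiIso_iff_of_acyclic_source hN _ ((hK.cone hK (𝟙 K)).map F) ((hK.map F).cone hL u)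
    ((isAcyclic_cone_id K).map F hF)).2 ((isQuasiIso_iff u).1 h)

lemma map_inr_lift_map {X Y : M} {Y' : N} (u : F.obj Y ⟶ Y') :
    F.map (biprod.inr : Y ⟶ X ⊞ Y) ≫
      biprod.lift (F.map biprod.fst) (F.map biprod.snd) ≫ biprod.map (𝟙 (F.obj X)) u =
      u ≫ biprod.inr := by
  ext <;> simp [← F.map_comp, ← F.map_comp_assoc]

lemma lift_map_fst {X Y : M} {Y' : N} (u : F.obj Y ⟶ Y') :
    (biprod.lift (F.map biprod.fst) (F.map biprod.snd) ≫ biprod.map (𝟙 (F.obj X)) u) ≫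
      biprod.fst = F.map (biprod.fst : X ⊞ Y ⟶ X) := by
  simp

lemma coneComp_inr {K : ChainComplex M ℤ} {L : ChainComplex N ℤ} (u : (mapC F).obj K ⟶ L) :
    (mapC F).map (coneInr (𝟙 K)) ≫ coneComp u = u ≫ coneInr u :=
  HomologicalComplex.hom_ext _ _ fun i => map_inr_lift_map (u.f i)

variable {X : RelBinary F}

/-- The object of `B[F]` with the sources replaced by a binary complex over them. -/
abbrev ofOver (hN : SupportsLongExactSequences N) (hF : IsExactFunctor F) (o : Over X) :
    RelBinary F where
  srcTop := o.B.top
  srcBot := o.B.bot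
  srcTop_bounded := o.bounded
  srcBot_bounded := o.bounded
  tar := X.tar
  tar_bounded := X.tar_bounded
  compTop := o.compTop
  compBot := o.compBot
  compTop_quasiIso := o.compTop_quasiIso hN hF
  compBot_quasiIso := o.compBot_quasiIso hN hF

/-- The cone of the identity of the sources and of the comparison maps. -/
abbrev coneOver (hN : SupportsLongExactSequences N) (hF : IsExactFunctor F) (o : Over X) :
    RelBinary F where
  srcTop := cone (𝟙 o.B.top)
  srcBot := cone (𝟙 o.B.bot)
  srcTop_bounded := IsBoundedGraded.cone (K := o.B.top) (L := o.B.top) o.bounded o.bounded (𝟙 _)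
  srcBot_bounded := IsBoundedGraded.cone (K := o.B.bot) (L := o.B.bot) o.bounded o.bounded (𝟙 _)
  tar := BinaryComplex.cone o.compTop o.compBot
  tar_bounded := (o.bounded.map F).shift.biprod X.tar_bounded
  compTop := coneComp (K := o.B.top) o.compTop
  compBot := coneComp (K := o.B.bot) o.compBot
  compTop_quasiIso := coneComp_quasiIso (K := o.B.top) hN hF o.bounded X.tar_bounded
    (o.compTop_quasiIso hN hF)
  compBot_quasiIso := coneComp_quasiIso (K := o.B.bot) hN hF o.bounded X.tar_bounded
    (o.compBot_quasiIso hN hF)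

/-- The inclusion into the cone. -/
def ofOverToCone (o : Over X) : Hom (ofOver hN hF o) (coneOver hN hF o) where
  srcTop := coneInr (𝟙 o.B.top)
  srcBot := coneInr (𝟙 o.B.bot)
  tar := BinaryComplex.coneInr _ _
  comm_top := coneComp_inr (K := o.B.top) o.compTop
  comm_bot := coneComp_inr (K := o.B.bot) o.compBot

/-- The projection of the cone onto the shift. -/
def coneToShift (o : Over X) :
    Hom (coneOver hN hF o) (ofBinary F o.B.shift o.bounded.shift) where
  srcTop := coneFst (𝟙 o.B.top)
  srcBot := coneFst (𝟙 o.B.bot)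
  tar := BinaryComplex.homMk (fun _ => biprod.fst)
    (fun i j => (congrArg (biprod.fst ≫ ·) (F.map_neg (f := o.B.d (i - 1) (j - 1)))).trans
      ((coneFst o.compTop).comm i j))
    (fun i j => (congrArg (biprod.fst ≫ ·) (F.map_neg (f := o.B.d' (i - 1) (j - 1)))).trans
      ((coneFst o.compBot).comm i j))
  comm_top := (Category.comp_id ((mapC F).map (coneFst (𝟙 o.B.top)))).trans
    (HomologicalComplex.hom_ext _ _ fun i => (lift_map_fst (o.compTop.f i)).symm)
  comm_bot := (Category.comp_id ((mapC F).map (coneFst (𝟙 o.B.bot)))).trans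
    (HomologicalComplex.hom_ext _ _ fun i => (lift_map_fst (o.compBot.f i)).symm)

lemma isShortExactRel_cone (o : Over X) :
    IsShortExactRel (ofOverToCone hN hF o) (coneToShift hN hF o) :=
  ⟨isShortExactComplex_coneInr_coneFst (𝟙 o.B.top),
    isShortExactComplex_coneInr_coneFst (𝟙 o.B.bot), fun _ => isShortExact_inr_fst _ _⟩

end RelBinary

variable {X : RelBinary F}

/-- The class of an object of `B[F]` with a binary complex over it is the image of its value. -/
lemma K0Omega.cls_eq_toK0Omega_val (hM : SupportsLongExactSequences M) (o : Over X) :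
    K0Omega.cls X = K1.toK0Omega F (o.val hN hF) := by
  -- The maps `o.a` and `o.b`, with the identity on the target, form a map in `p`.
  have e₁ : K0Omega.cls (RelBinary.ofOver hN hF o) = K0Omega.cls X :=
    K0Omega.cls_eq_of_isP ⟨o.a, o.b, 𝟙 X.tar, (Category.comp_id _).symm, (Category.comp_id _).symm⟩
      ⟨o.qa, o.qb, inferInstanceAs (IsIso (𝟙 X.tar))⟩
  -- The quotient of the cone is a shifted binary complex together with its image under `F`, so it
  -- contributes nothing.
  have e₂ := K0Omega.cls_add (RelBinary.isShortExactRel_cone hN hF o)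
  rw [K0Omega.cls_ofBinary hF, add_zero, e₁] at e₂
  rw [← e₂]
  refine Eq.trans ?_ (K1.toK0Omega_cls _).symm
  -- The sources of the cone are acyclic, so a map in `p` replaces them by zero.
  refine (K0Omega.cls_eq_of_isP ⟨0, 0, 𝟙 (BinaryComplex.cone o.compTop o.compBot), ?_, ?_⟩
    ⟨?_, ?_, ?_⟩).symm
  · ext i; exact (F.map_isZero (isZero_zero M)).eq_of_src _ _
  · ext i; exact (F.map_isZero (isZero_zero M)).eq_of_src _ _
  · exact (isQuasiIso_iff_of_acyclic_source hM _ isBoundedGraded_zero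
      (RelBinary.coneOver hN hF o).srcTop_bounded isAcyclic_zero).2 (isAcyclic_cone_id o.B.top)
  · exact (isQuasiIso_iff_of_acyclic_source hM _ isBoundedGraded_zero
      (RelBinary.coneOver hN hF o).srcBot_bounded isAcyclic_zero).2 (isAcyclic_cone_id o.B.bot)
  · exact inferInstanceAs (IsIso (𝟙 (BinaryComplex.cone o.compTop o.compBot)))

lemma K0Omega.exists_sub (x : K0Omega F) : ∃ X Y, x = K0Omega.cls X - K0Omega.cls Y := by
  obtain ⟨x, rfl⟩ := QuotientAddGroup.mk'_surjective _ x
  refine FreeAbelianGroup.exists_of_sub_of (G := K0Omega F) _ (.zero F) ?_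
    RelBinary.sum (fun X Y => K0Omega.cls_add (RelBinary.isShortExactRel_sum X Y)) x
  refine (K1.toK0Omega_cls _).symm.trans ?_
  rw [K1.cls_of_isZero _ fun _ => isZero_zero N, map_zero]

theorem exact_toK0Omega_toK0 (hM : SupportsLongExactSequences M)
    (hN : SupportsLongExactSequences N) (hF : IsExactFunctor F) :
    Function.Exact (K1.toK0Omega F) (K0Omega.toK0 F) := by
  intro x
  constructor
  · intro h
    obtain ⟨X, Y, rfl⟩ := K0Omega.exists_sub x
    rw [map_sub, K0Omega.toK0_cls, K0Omega.toK0_cls, sub_eq_zero] at h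
    have key : ∀ W : RelBinary F, eulerChar W.srcTop = eulerChar W.srcBot →
        K0Omega.cls W ∈ (K1.toK0Omega F).range := fun W hW => by
      obtain ⟨-, o, -⟩ := RelBinary.exists_hasVal hN hF hM hW
      exact ⟨_, (K0Omega.cls_eq_toK0Omega_val hN hF hM o).symm⟩
    -- `X - Y` is written as `(X ⊕ Y.swap) - (Y ⊕ Y.swap)`, where both terms have balanced sources.
    have := sub_mem (key _ (RelClass.eulerChar_sum_swap_eq h))
      (key _ (RelClass.eulerChar_sum_swap_eq (X := Y) (Y := Y) rfl))
    rwa [K0Omega.cls_add (RelBinary.isShortExactRel_sum X Y.swap),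
      K0Omega.cls_add (RelBinary.isShortExactRel_sum Y Y.swap), add_sub_add_right_eq_sub] at this
  · rintro ⟨y, rfl⟩
    obtain ⟨A, B, rfl⟩ := K1.exists_sub y
    rw [map_sub, map_sub, K1.toK0Omega_cls, K1.toK0Omega_cls, K0Omega.toK0_cls, K0Omega.toK0_cls]
    exact sub_eq_zero.2 ((sub_self _).trans (sub_self _).symm)

lemma eulerChar_singleC {C : Type u} [Category.{v} C] [Preadditive C] [HasZeroObject C]
    [HasBinaryBiproducts C] [ExactCategory C] (A : C) : eulerChar (singleC A 0) = K0.cls A := by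
  rw [eulerChar_eq_sum (s := {0}) fun i hi => isZero_singleC A (by simpa using hi),
    Finset.sum_singleton, Int.negOnePow_zero, one_smul]
  have := K0.cls_add (isShortExact_iso_zero
    (HomologicalComplex.singleObjXSelf (ComplexShape.down ℤ) 0 A).hom 0 (isZero_zero C))
  rw [this, K0.cls_of_isZero (isZero_zero C), add_zero]

/-- If `[F A] = [F B]`, place `A` and `B` in degree `0` as sources; the binary complex of
`exists_binaryComplex` in `N` is then a target for them. -/
theorem exact_toK0_map (hN : SupportsLongExactSequences N) (hF : IsExactFunctor F) :
    Function.Exact (K0Omega.toK0 F) (K0.map F hF) := by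
  intro x
  constructor
  · intro h
    obtain ⟨A, B, rfl⟩ := K0.exists_sub x
    rw [map_sub, ← eulerChar_singleC, ← eulerChar_singleC, sub_eq_zero,
      K0.map_eulerChar F hF (singleC_bounded A 0), K0.map_eulerChar F hF (singleC_bounded B 0)] at h
    obtain ⟨T, hT, -, -, a, b, -, -, qa, qb⟩ := exists_binaryComplex hN
      ((singleC_bounded A 0).map F) ((singleC_bounded B 0).map F) h
    refine ⟨K0Omega.cls ⟨singleC A 0, singleC B 0, singleC_bounded A 0, singleC_bounded B 0, T, hT,
      a, b, qa, qb⟩, ?_⟩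
    rw [K0Omega.toK0_cls, eulerChar_singleC, eulerChar_singleC]
  · rintro ⟨y, rfl⟩
    exact K0Omega.map_toK0 hF y

end ExactSequence

/-! ### The case of a zero category -/

section ZeroCategory

variable {Z : Type u₃} [Category.{v₃} Z] [Preadditive Z] [HasZeroObject Z]
  [HasBinaryBiproducts Z] [ExactCategory Z] (hZ : ∀ z : Z, IsZero z)
  {N : Type u₂} [Category.{v₂} N] [Preadditive N] [HasZeroObject N]
  [HasBinaryBiproducts N] [ExactCategory N] (hN : SupportsLongExactSequences N)

include hZ

lemma supportsLongExactSequences_of_isZero : SupportsLongExactSequences Z := by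
  intro X Y p _
  obtain rfl : p = 0 := (hZ X).eq_of_src _ _
  infer_instance

lemma subsingleton_K1_of_isZero (x : K1 Z) : x = 0 := by
  obtain ⟨A, B, rfl⟩ := K1.exists_sub x
  rw [K1.cls_of_isZero _ fun _ => hZ _, K1.cls_of_isZero _ fun _ => hZ _, sub_zero]

lemma subsingleton_K0_of_isZero (x : K0 Z) : x = 0 := by
  obtain ⟨A, B, rfl⟩ := K0.exists_sub x
  rw [K0.cls_of_isZero (hZ _), K0.cls_of_isZero (hZ _), sub_zero]

lemma isExactFunctor_of_isZero_source (G : Z ⥤ N) [G.Additive] : IsExactFunctor G :=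
  fun X Y W _ _ _ => isShortExact_of_isZero _ _ (G.map_isZero (hZ X)) (G.map_isZero (hZ Y))
    (G.map_isZero (hZ W))

lemma isExactFunctor_of_isZero_target (H : N ⥤ Z) [H.Additive] : IsExactFunctor H :=
  fun _ _ _ _ _ _ => isShortExact_of_isZero _ _ (hZ _) (hZ _) (hZ _)

include hN

/-- `K₁ Z` and `K₀ Z` vanish, so exactness at `K₁ N` gives injectivity and exactness at `K₀ Ω[G]`
gives surjectivity. -/
lemma bijective_toK0Omega_of_isZero (G : Z ⥤ N) [G.Additive] :
    Function.Bijective (K1.toK0Omega G) := by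
  have hM := supportsLongExactSequences_of_isZero hZ
  have hG := isExactFunctor_of_isZero_source hZ G
  refine ⟨(injective_iff_map_eq_zero _).2 fun y hy => ?_, fun x => ?_⟩
  · obtain ⟨w, rfl⟩ := (exact_map_toK0Omega hM hN hG y).1 hy
    rw [subsingleton_K1_of_isZero hZ w, map_zero]
  · exact (exact_toK0Omega_toK0 hM hN hG x).1 (subsingleton_K0_of_isZero hZ _)

/-- Here the vanishing groups stand at the two ends, so exactness at `K₀ Ω[H]` and at `K₀ N` is
used. -/
lemma bijective_toK0_of_isZero (H : N ⥤ Z) [H.Additive] :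
    Function.Bijective (K0Omega.toK0 H) := by
  have hM := supportsLongExactSequences_of_isZero hZ
  have hH := isExactFunctor_of_isZero_target hZ H
  refine ⟨(injective_iff_map_eq_zero _).2 fun y hy => ?_, fun x => ?_⟩
  · obtain ⟨w, rfl⟩ := (exact_toK0Omega_toK0 hN hM hH y).1 hy
    rw [subsingleton_K1_of_isZero hZ w, map_zero]
  · exact (exact_toK0_map hM hH x).1 (subsingleton_K0_of_isZero hZ _)

end ZeroCategory

end RelK

end

theorem mainTheorem2
    {M : Type u₁} [Category.{v₁} M] [Preadditive M]
    [HasZeroObject M] [HasBinaryBiproducts M]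
    [RelK.ExactCategory M]
    {N : Type u₂} [Category.{v₂} N] [Preadditive N]
    [HasZeroObject N] [HasBinaryBiproducts N]
    [RelK.ExactCategory N]
    (hM : RelK.SupportsLongExactSequences M) (hN : RelK.SupportsLongExactSequences N)
    (F : M ⥤ N) [F.Additive] (hF : RelK.IsExactFunctor F) :
    (∃ (k₁ : RelK.K1 M →+ RelK.K1 N) (i : RelK.K1 N →+ RelK.K0Omega F)
        (p : RelK.K0Omega F →+ RelK.K0 M) (k₀ : RelK.K0 M →+ RelK.K0 N),
      (∀ X : RelK.AcyclicBinaryComplex M, k₁ (RelK.K1.cls X) = RelK.K1.cls (X.map F hF)) ∧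
      (∀ Y : RelK.AcyclicBinaryComplex N,
        i (RelK.K1.cls Y) = RelK.K0Omega.cls (RelK.RelBinary.ofAcyclic F Y)) ∧
      (∀ X : RelK.RelBinary F,
        p (RelK.K0Omega.cls X) = RelK.eulerChar X.srcTop - RelK.eulerChar X.srcBot) ∧
      (∀ A : M, k₀ (RelK.K0.cls A) = RelK.K0.cls (F.obj A)) ∧
      Function.Exact k₁ i ∧ Function.Exact i p ∧ Function.Exact p k₀) ∧
    (∀ {Z : Type u₃} [Category.{v₃} Z] [Preadditive Z]
        [HasZeroObject Z] [HasBinaryBiproducts Z]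
        [RelK.ExactCategory Z] (_ : ∀ z : Z, IsZero z),
      (∀ (G : Z ⥤ N) [G.Additive], ∃ e : RelK.K1 N ≃+ RelK.K0Omega G,
        ∀ Y : RelK.AcyclicBinaryComplex N,
          e (RelK.K1.cls Y) = RelK.K0Omega.cls (RelK.RelBinary.ofAcyclic G Y)) ∧
      (∀ (H : N ⥤ Z) [H.Additive], ∃ e : RelK.K0Omega H ≃+ RelK.K0 N,
        ∀ X : RelK.RelBinary H,
          e (RelK.K0Omega.cls X) = RelK.eulerChar X.srcTop - RelK.eulerChar X.srcBot)) := by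
  refine ⟨⟨RelK.K1.map F hF, RelK.K1.toK0Omega F, RelK.K0Omega.toK0 F, RelK.K0.map F hF,
    RelK.K1.map_cls F hF, RelK.K1.toK0Omega_cls, RelK.K0Omega.toK0_cls, RelK.K0.map_cls F hF,
    RelK.exact_map_toK0Omega hM hN hF, RelK.exact_toK0Omega_toK0 hM hN hF,
    RelK.exact_toK0_map hN hF⟩, fun {Z} _ _ _ _ _ hZ => ⟨fun G _ => ?_, fun H _ => ?_⟩⟩
  · exact ⟨.ofBijective _ (RelK.bijective_toK0Omega_of_isZero hZ hN G), RelK.K1.toK0Omega_cls⟩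
  · exact ⟨.ofBijective _ (RelK.bijective_toK0_of_isZero hZ hN H), RelK.K0Omega.toK0_cls⟩
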